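/- Work over $\mathbb C$. For a nonzero coherent sheaf $F$ on $\mathbb P^1$ (over $\mathbb C$ or an extension field) of class $[F]=(\operatorname{rk}F,\deg F)\in\mathbb Z^2$ let $\phi(F)=\frac1\pi\arg(\operatorname{rk}F+\sqrt{-1}\deg F)\in\,]-\frac12,\frac12]$ be its phase, and let $\mathcal P(\phi)$, $\phi\in\mathbb R$, be the slicing of $D^b(\mathrm{Coh}\,\mathbb P^1)$ for which $\mathcal P(\phi)$ consists of $0$ and the shifts $F[m]$ of semistable sheaves $F$ with $\phi(F)+m=\phi$. For an interval $I$ of length at most one, $\mathrm{Coh}^I\subset D^b(\mathrm{Coh}\,\mathbb P^1)$ is the full subcategory of the objects whose Harder--Narasimhan factors have phases in $I$; $\mathrm{Coh}^\nu=\mathrm{Coh}^{]\nu-1,\nu]}$ is an abelian heart, with $\mathrm{Coh}^{1/2}=\mathrm{Coh}\,\mathbb P^1$, and $K_0(\mathrm{Coh}^\nu)^+\subset\mathbb Z^2$ is the monoid of classes of its objects. Put $\nu_n=\phi(\mathcal O(-n))+1=1-\frac1\pi\arctan n$. For sequences $\underline\alpha=(\alpha_1,\dots,\alpha_s)$, $\underline\alpha'=(\alpha'_1,\dots,\alpha'_l)$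 in $\mathbb Z^2$, let $Z^{\nu,I}_{\underline\alpha,\underline\alpha'}$ be the stack of pairs of filtrations $0=F_0\subseteq\dots\subseteq F_s=F$, $0=F'_0\subseteq\dots\subseteq F'_l=F$ in $\mathrm{Coh}^\nu$ of one object $F\in\mathrm{Coh}^I$, with $[F_i/F_{i-1}]=\alpha_i$ and $[F'_j/F'_{j-1}]=\alpha'_j$; its objects over a $\mathbb C$-algebra $R$ are the pairs of chains of perfect complexes on $\mathbb P^1_R$ (with identified last terms) all of whose fibres at field-valued points of $\operatorname{Spec}R$ are of this form. For an $s\times l$ matrix $w$ with entries in $\mathbb Z^2$, the cell $Z^{\nu,I}_{\underline\alpha,\underline\alpha'}(w)$ consists of the pairs for which $$\Big[\,F_i\cap F'_j\big/\big(F_{i-1}\cap F'_j+F_i\cap F'_{j-1}\big)\Big]=w_{ij}\qquad\text{for all } i,j,$$ intersections, sums and quotients being taken in the abelian category $\mathrm{Coh}^\nu$. Let $W(\underline\alpha,\underline\alpha')^{\nu,I}$ be the set of matrices $w$ with entries in $K_0(\mathrm{Coh}^\nu)^+$, row sums $\sum_jw_{ij}=\alpha_i$, column sums $\sum_iw_{ij}=\alpha'_j$,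 and $Z^{\nu,I}_{\underline\alpha,\underline\alpha'}(w)\neq\varnothing$. **Proposition.** Let $\sigma\in\,]\frac12,1]$, $I=\,]\sigma-1,\frac12]$, and let $\underline\alpha,\underline\alpha'$ be two sequences of elements of $K_0(\mathrm{Coh}\,\mathbb P^1)^+=\{(r,d): r>0,\text{ or } r=0\text{ and } d\ge0\}$ with the same sum. 1. There is $n_0\in\mathbb N$ such that for every $n\ge n_0$ the stacks $Z^{\frac12,I}_{\underline\alpha,\underline\alpha'}$ and $Z^{\nu_n,I}_{\underline\alpha,\underline\alpha'}$ are canonically isomorphic, through the identity on the underlying chains of complexes, and this isomorphism identifies $Z^{\frac12,I}_{\underline\alpha,\underline\alpha'}(w)$ with $Z^{\nu_n,I}_{\underline\alpha,\underline\alpha'}(w)$ for every matrix $w$. 2. There is $\nu_0\in\,]\frac12,\sigma]$ such that $W(\underline\alpha,\underline\alpha')^{\frac12,I}=W(\underline\alpha,\underline\alpha')^{\nu,I}$ for every $\frac12<\nu\le\nu_0$. -/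

import Mathlib

open CategoryTheory AlgebraicGeometry

noncomputable section

namespace SteinbergP1

/-! ### The projective line over a ring and base change -/

attribute [local instance] MvPolynomial.gradedAlgebra

/-- The projective line `ℙ¹_R = Proj R[X₀, X₁]`. -/
abbrev P1 (R : Type) [CommRing R] : Scheme.{0} :=
  Proj (MvPolynomial.homogeneousSubmodule (Fin 2) R)

/-- The graded ring homomorphism `R[X₀, X₁] → S[X₀, X₁]` induced by `R → S`. -/
def coordMap {R S : Type} [CommRing R] [CommRing S] (f : R →+* S) :
    MvPolynomial.homogeneousSubmodule (Fin 2) R →+*ᵍ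
      MvPolynomial.homogeneousSubmodule (Fin 2) S where
  toRingHom := MvPolynomial.map f
  map_mem {_ _} h := MvPolynomial.IsHomogeneous.map h f

theorem irrelevant_le_map_coordMap {R S : Type} [CommRing R] [CommRing S] (f : R →+* S) :
    HomogeneousIdeal.irrelevant (MvPolynomial.homogeneousSubmodule (Fin 2) S) ≤
      (HomogeneousIdeal.irrelevant (MvPolynomial.homogeneousSubmodule (Fin 2) R)).map
        (coordMap f) := by
  have hX : ∀ i : Fin 2, (MvPolynomial.X i : MvPolynomial (Fin 2) S) ∈
      ((HomogeneousIdeal.irrelevant (MvPolynomial.homogeneousSubmodule (Fin 2) R)).map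
        (coordMap f)).toIdeal := by
    intro i
    have h0 : (MvPolynomial.X i : MvPolynomial (Fin 2) R) ∈
        HomogeneousIdeal.irrelevant (MvPolynomial.homogeneousSubmodule (Fin 2) R) :=
      HomogeneousIdeal.mem_irrelevant_of_mem _ one_pos (MvPolynomial.isHomogeneous_X R i)
    have h1 := Ideal.mem_map_of_mem (coordMap f) h0
    have h2 : coordMap f (MvPolynomial.X i) = MvPolynomial.X i := MvPolynomial.map_X f i
    rw [h2] at h1
    exact h1
  refine (HomogeneousIdeal.toIdeal_irrelevant_le _).mpr fun n hn p hp => ?_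
  have hspan : Ideal.span ((MvPolynomial.X : Fin 2 → MvPolynomial (Fin 2) S) '' Set.univ) ≤
      ((HomogeneousIdeal.irrelevant (MvPolynomial.homogeneousSubmodule (Fin 2) R)).map
        (coordMap f)).toIdeal := by
    rw [Ideal.span_le]
    rintro _ ⟨i, -, rfl⟩
    exact hX i
  refine hspan (MvPolynomial.mem_ideal_span_X_image.mpr fun m hm => ?_)
  by_contra! hcon
  have hm0 : m = 0 := Finsupp.ext fun i => hcon i (Set.mem_univ i)
  have hdeg : Finsupp.weight 1 m = n :=
    (MvPolynomial.mem_homogeneousSubmodule n p).mp hp (MvPolynomial.mem_support_iff.mp hm)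
  rw [hm0, map_zero] at hdeg
  omega

/-- The projection `ℙ¹_S → ℙ¹_R` induced by a ring homomorphism `R → S`. -/
def P1.map {R S : Type} [CommRing R] [CommRing S] (f : R →+* S) : P1 S ⟶ P1 R :=
  Proj.map (coordMap f) (irrelevant_le_map_coordMap f)

/-- The structure morphism `ℙ¹_R → Spec R`. -/
def P1.toSpec (R : Type) [CommRing R] : P1 R ⟶ Spec (CommRingCat.of R) :=
  Proj.toSpecZero (MvPolynomial.homogeneousSubmodule (Fin 2) R) ≫
    Spec.map (CommRingCat.ofHom
      (algebraMap R (MvPolynomial.homogeneousSubmodule (Fin 2) R 0)))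

/-- The scalars `R → Γ(ℙ¹_R, U)`. -/
def P1.scalars (R : Type) [CommRing R] (U : (P1 R).Opens) : R →+* Γ(P1 R, U) :=
  ((Scheme.ΓSpecIso (CommRingCat.of R)).inv ≫ (P1.toSpec R).appLE ⊤ U le_top).hom

/-- The standard affine open subset `D₊(Xᵢ)` of `ℙ¹_R`. -/
def P1.chart (R : Type) [CommRing R] (i : Fin 2) : (P1 R).Opens :=
  Proj.basicOpen (MvPolynomial.homogeneousSubmodule (Fin 2) R) (MvPolynomial.X i)

section Sheaves

variable {R : Type} [CommRing R]

/-- Sections of a sheaf of modules on `ℙ¹_R` form an `R`-module. -/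
instance (M : (P1 R).Modules) (U : (P1 R).Opens) : Module R Γ(M, U) :=
  Module.compHom Γ(M, U) (P1.scalars R U)

/-- Restriction of sections, as an `R`-linear map. -/
def restrictSections (M : (P1 R).Modules) {U V : (P1 R).Opens} (h : V ≤ U) :
    Γ(M, U) →ₗ[R] Γ(M, V) where
  toFun := M.presheaf.map (homOfLE h).op
  map_add' := map_add _
  map_smul' := by
    intro r x
    refine (M.map_smul (homOfLE h) (P1.scalars R U r) x).trans ?_
    have hr : (P1 R).presheaf.map (homOfLE h).op (P1.scalars R U r) = P1.scalars R V r := by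
      have := Scheme.Hom.appLE_map (P1.toSpec R) (U := ⊤) (V := U) le_top (homOfLE h).op
      rw [P1.scalars, P1.scalars, ← this]
      rfl
    rw [hr]
    rfl

/-- The Čech differential `Γ(U₀, M) × Γ(U₁, M) → Γ(U₀ ∩ U₁, M)`, `(a, b) ↦ b - a`, of the
standard affine cover of `ℙ¹`. Its kernel is `H⁰(ℙ¹, M)` and, for `M` quasi-coherent, its
cokernel is `H¹(ℙ¹, M)`. -/
def cech (M : (P1 R).Modules) :
    (Γ(M, P1.chart R 0) × Γ(M, P1.chart R 1)) →ₗ[R] Γ(M, P1.chart R 0 ⊓ P1.chart R 1) :=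
  (restrictSections M inf_le_right).comp (LinearMap.snd R _ _) -
    (restrictSections M inf_le_left).comp (LinearMap.fst R _ _)

/-- Coherent sheaves on a (locally noetherian) scheme. -/
def IsCoherent {X : Scheme.{0}} (M : X.Modules) : Prop :=
  SheafOfModules.IsQuasicoherent M ∧
    ∀ U : X.Opens, IsAffineOpen U → Module.Finite Γ(X, U) Γ(M, U)

/-- Vector bundles: locally free sheaves of modules of finite type. -/
def IsVectorBundle {X : Scheme.{0}} (M : X.Modules) : Prop :=
  SheafOfModules.IsLocallyFree M ∧ SheafOfModules.IsFiniteType M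

end Sheaves

/-! ### Rank, degree and the derived category -/

/-- The derived category of sheaves of modules on `ℙ¹_R` (over a field, `D^b(Coh ℙ¹)` is its full
subcategory of complexes with bounded coherent cohomology, which contains everything below). -/
instance (R : Type) [CommRing R] : HasDerivedCategory.{1} (P1 R).Modules :=
  HasDerivedCategory.standard _

/-- `D(ℙ¹_R)`. -/
abbrev DP1 (R : Type) [CommRing R] := DerivedCategory (P1 R).Modules

section Field

variable (K : Type) [Field K]

variable {K} in
/-- The (generic) rank of a coherent sheaf on `ℙ¹_K`. -/
def rank (M : (P1 K).Modules) : ℤ :=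
  Module.finrank Γ(P1 K, P1.chart K 0) Γ(M, P1.chart K 0)

variable {K} in
/-- The Euler characteristic `dim H⁰ - dim H¹` of a coherent sheaf on `ℙ¹_K`. -/
def eulerChar (M : (P1 K).Modules) : ℤ :=
  (Module.finrank K (LinearMap.ker (cech M)) : ℤ) -
    Module.finrank K (Γ(M, P1.chart K 0 ⊓ P1.chart K 1) ⧸ LinearMap.range (cech M))

variable {K} in
/-- The class `(rank, degree)` of a coherent sheaf on `ℙ¹_K`, the degree being defined by
`χ(M) = deg M + rank M`. -/
def sheafClass (M : (P1 K).Modules) : ℤ × ℤ :=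
  (rank M, eulerChar M - rank M)

variable {K} in
/-- The class in `K₀(ℙ¹_K) = ℤ²` of a bounded complex with coherent cohomology. -/
def cls (E : DP1 K) : ℤ × ℤ :=
  ∑ᶠ i : ℤ, (Int.negOnePow i : ℤ) •
    sheafClass ((DerivedCategory.homologyFunctor (P1 K).Modules i).obj E)

/-! ### Phases, Harder–Narasimhan filtrations and the categories `Coh^I` -/

/-- The phase in `]-1/2, 1/2]` of the class `(r, d)` of a nonzero sheaf, with respect to the
central charge `r + d √-1`. -/
def phase (γ : ℤ × ℤ) : ℝ := Complex.arg ⟨γ.1, γ.2⟩ / Real.pi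

variable {K} in
/-- Semistable (nonzero) coherent sheaves on `ℙ¹_K`. -/
def IsSemistable (F : (P1 K).Modules) : Prop :=
  IsCoherent F ∧ ¬ Limits.IsZero F ∧
    ∀ (G : (P1 K).Modules) (i : G ⟶ F), IsCoherent G → Mono i → ¬ Limits.IsZero G →
      phase (sheafClass G) ≤ phase (sheafClass F)

variable {K} in
/-- The nonzero objects of the slice `P(φ)`: the shifts `F[m]` of semistable coherent sheaves `F`
with `φ = φ(F) + m`. -/
def IsSlice (φ : ℝ) (E : DP1 K) : Prop :=
  ∃ (F : (P1 K).Modules) (m : ℤ), IsSemistable F ∧ phase (sheafClass F) + m = φ ∧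
    Nonempty (E ≅ ((DerivedCategory.singleFunctor (P1 K).Modules 0).obj F)⟦m⟧)

variable {K} in
/-- `HasHN ℓ E`: the object `E` has a Harder–Narasimhan filtration
`0 = E₀ → E₁ → ⋯ → E_k = E` whose factors have phases `φ₁ > ⋯ > φ_k`, where
`ℓ = [φ_k, …, φ₁]`. -/
inductive HasHN : List ℝ → DP1 K → Prop
  | zero (E : DP1 K) : Limits.IsZero E → HasHN [] E
  | cons (φ : ℝ) (ℓ : List ℝ) (T : Pretriangulated.Triangle (DP1 K)) :
      T ∈ Pretriangulated.distinguishedTriangles → HasHN ℓ T.obj₁ → IsSlice φ T.obj₃ →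
      (∀ ψ ∈ ℓ, φ < ψ) → HasHN (φ :: ℓ) T.obj₂

/-- `Coh^I`: the objects all of whose Harder–Narasimhan factors have phases in `I`. -/
def cohI (I : Set ℝ) : ObjectProperty (DP1 K) :=
  fun E => ∃ ℓ : List ℝ, HasHN ℓ E ∧ ∀ φ ∈ ℓ, φ ∈ I

/-- The heart `Coh^ν = Coh^{]ν-1, ν]}`. -/
abbrev heart (ν : ℝ) : ObjectProperty (DP1 K) := cohI K (Set.Ioc (ν - 1) ν)

/-- The abelian category `Coh^ν`. -/
abbrev Heart (ν : ℝ) := (heart K ν).FullSubcategory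

/-- The monoid `K₀(Coh^ν)⁺` of classes of objects of `Coh^ν`. -/
def K0plus (ν : ℝ) : Set (ℤ × ℤ) := {γ | ∃ E : DP1 ℂ, heart ℂ ν E ∧ cls E = γ}

/-! ### Filtrations in `Coh^ν` -/

/-- In a category with zero morphisms, `Q` is the cokernel of `f`. -/
def IsCokernelOf {C : Type*} [Category* C] [Limits.HasZeroMorphisms C] {X Y : C} (f : X ⟶ Y)
    (Q : C) : Prop :=
  ∃ (p : Y ⟶ Q) (w : f ≫ p = 0), Nonempty (Limits.IsColimit (Limits.CokernelCofork.ofπ p w))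

variable {K}

/-- The chain of objects `A` is a filtration `0 = A₀ ⊆ A₁ ⊆ ⋯ ⊆ A_s` in the abelian category
`Coh^ν` such that `A_{i+1} / A_i` is of class `α i`. -/
structure IsFlag (ν : ℝ) {s : ℕ} (α : Fin s → ℤ × ℤ) (A : Fin (s + 1) ⥤ DP1 K) : Prop where
  mem : ∀ i, heart K ν (A.obj i)
  zero : Limits.IsZero (A.obj 0)
  mono : ∀ {i j : Fin (s + 1)} (h : i ⟶ j), Mono (((heart K ν).lift A mem).map h)
  quot : ∀ i : Fin s, ∃ Q : Heart K ν,
    IsCokernelOf (((heart K ν).lift A mem).map (homOfLE i.castSucc_lt_succ.le)) Q ∧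
      cls Q.obj = α i

/-- The term `A_i` of a filtration, as a subobject of `A_s` in the abelian category `Coh^ν`. -/
def IsFlag.sub {ν : ℝ} {s : ℕ} {α : Fin s → ℤ × ℤ} {A : Fin (s + 1) ⥤ DP1 K}
    (h : IsFlag ν α A) (i : Fin (s + 1)) :
    Subobject (((heart K ν).lift A h.mem).obj (Fin.last s)) :=
  haveI := h.mono (homOfLE (Fin.le_last i))
  Subobject.mk (((heart K ν).lift A h.mem).map (homOfLE (Fin.le_last i)))

end Field

/-! ### Pairs of filtrations -/

/-- Pairs of chains `A₀ → ⋯ → A_s` and `B₀ → ⋯ → B_l` together with an isomorphism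
`A_s ≅ B_l`. -/
abbrev FlagPair (C : Type*) [Category* C] (s l : ℕ) :=
  Limits.CategoricalPullback ((evaluation (Fin (s + 1)) C).obj (Fin.last s))
    ((evaluation (Fin (l + 1)) C).obj (Fin.last l))

/-- The image of a pair of chains under a functor. -/
def FlagPair.mapObj {C D : Type*} [Category* C] [Category* D] {s l : ℕ} (G : C ⥤ D)
    (z : FlagPair C s l) : FlagPair D s l where
  fst := z.fst ⋙ G
  snd := z.snd ⋙ G
  iso := G.mapIso z.iso

section Points

variable {K : Type} [Field K] {s l : ℕ}

/-- The points over `K` of the Steinberg stack `Z^{ν,I}_{α,α'}`: pairs of filtrations in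
`Coh^ν` of types `α` and `α'`, of the same object, which lies in `Coh^I`. -/
structure IsSteinbergPoint (ν : ℝ) (I : Set ℝ) (α : Fin s → ℤ × ℤ) (α' : Fin l → ℤ × ℤ)
    (z : FlagPair (DP1 K) s l) : Prop where
  fst : IsFlag ν α z.fst
  snd : IsFlag ν α' z.snd
  mem : cohI K I (z.fst.obj (Fin.last s))

/-- The `i`-th term `F_i` of the first filtration, as a subobject in `Coh^ν` of the total object
`F`. -/
def IsSteinbergPoint.subFst {ν : ℝ} {I : Set ℝ} {α : Fin s → ℤ × ℤ} {α' : Fin l → ℤ × ℤ}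
    {z : FlagPair (DP1 K) s l} (h : IsSteinbergPoint ν I α α' z) (i : Fin (s + 1)) :
    Subobject (((heart K ν).lift z.fst h.fst.mem).obj (Fin.last s)) :=
  h.fst.sub i

/-- The `j`-th term `F'_j` of the second filtration, as a subobject in `Coh^ν` of the total object
`F`. -/
def IsSteinbergPoint.subSnd {ν : ℝ} {I : Set ℝ} {α : Fin s → ℤ × ℤ} {α' : Fin l → ℤ × ℤ}
    {z : FlagPair (DP1 K) s l} (h : IsSteinbergPoint ν I α α' z) (j : Fin (l + 1)) :
    Subobject (((heart K ν).lift z.fst h.fst.mem).obj (Fin.last s)) :=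
  (Subobject.mapIsoToOrderIso ((heart K ν).isoMk z.iso.symm :
    ((heart K ν).lift z.snd h.snd.mem).obj (Fin.last l) ≅
      ((heart K ν).lift z.fst h.fst.mem).obj (Fin.last s))) (h.snd.sub j)

/-- The pair of filtrations `z` is of type `w`: for all `i`, `j`, the subquotient
`F_i ∩ F'_j / (F_{i-1} ∩ F'_j + F_i ∩ F'_{j-1})` in the abelian category `Coh^ν` is of class
`w i j` (intersections and sums are meets and joins of subobjects, the indices of `w` start
at `0`). -/
def IsSteinbergPoint.HasType {ν : ℝ} {I : Set ℝ} {α : Fin s → ℤ × ℤ} {α' : Fin l → ℤ × ℤ}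
    {z : FlagPair (DP1 K) s l} (h : IsSteinbergPoint ν I α α' z)
    (w : Matrix (Fin s) (Fin l) (ℤ × ℤ)) : Prop :=
  ∀ (i : Fin s) (j : Fin l),
    ∃ P P₁ P₂ S : Subobject (((heart K ν).lift z.fst h.fst.mem).obj (Fin.last s)),
      IsGLB {h.subFst i.succ, h.subSnd j.succ} P ∧
      IsGLB {h.subFst i.castSucc, h.subSnd j.succ} P₁ ∧
      IsGLB {h.subFst i.succ, h.subSnd j.castSucc} P₂ ∧
      IsLUB {P₁, P₂} S ∧
      ∃ (hSP : S ≤ P) (Q : Heart K ν), IsCokernelOf (Subobject.ofLE S P hSP) Q ∧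
        cls Q.obj = w i j

end Points

/-! ### Families, Steinberg stacks and their cells -/

/-- Strictly perfect complexes: bounded complexes of vector bundles. -/
def IsStrictlyPerfect {X : Scheme.{0}} (E : CochainComplex X.Modules ℤ) : Prop :=
  (∀ n, IsVectorBundle (E.X n)) ∧ ∃ a b : ℤ, E.IsStrictlyGE a ∧ E.IsStrictlyLE b

/-- A family over `R` of pairs of chains of perfect complexes on `ℙ¹` with isomorphic ends.
Since perfect complexes on `ℙ¹_R` can be resolved by vector bundles, all such families are
represented by diagrams of strictly perfect complexes. -/
structure FlagFamily (R : Type) [CommRing R] (s l : ℕ) where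
  /-- The underlying diagram of complexes. -/
  pair : FlagPair (CochainComplex (P1 R).Modules ℤ) s l
  fst_perfect : ∀ i, IsStrictlyPerfect (pair.fst.obj i)
  snd_perfect : ∀ j, IsStrictlyPerfect (pair.snd.obj j)

section Stacks

variable {R : Type} [CommRing R] {s l : ℕ}

/-- Morphisms of families are morphisms of diagrams in the derived category `D(ℙ¹_R)`. -/
instance : Category (FlagFamily R s l) :=
  inferInstanceAs (Category (InducedCategory (FlagPair (DP1 R) s l)
    fun z : FlagFamily R s l => FlagPair.mapObj DerivedCategory.Q z.pair))

/-- The (derived) fibre of a family at a point `Spec K → Spec R`. The terms of the complexes are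
vector bundles, so the derived pullback is computed termwise. -/
def FlagFamily.fibre (z : FlagFamily R s l) {K : Type} [Field K] (f : R →+* K) :
    FlagPair (DP1 K) s l :=
  FlagPair.mapObj ((Scheme.Modules.pullback (P1.map f)).mapHomologicalComplex (ComplexShape.up ℤ) ⋙
    DerivedCategory.Q) z.pair

/-- The Steinberg stack `Z^{ν,I}_{α,α'}`, as a full substack of the stack of pairs of chains of
perfect complexes: its objects over `Spec R` are the families all of whose fibres are pairs of
filtrations in `Coh^ν` of types `α` and `α'` of an object of `Coh^I`. (The groupoid of objects over
`Spec R` is the core of the corresponding full subcategory.) -/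
def steinberg (ν : ℝ) (I : Set ℝ) (α : Fin s → ℤ × ℤ) (α' : Fin l → ℤ × ℤ)
    (R : Type) [CommRing R] : ObjectProperty (FlagFamily R s l) :=
  fun z => ∀ (K : Type) [Field K] (f : R →+* K), IsSteinbergPoint ν I α α' (z.fibre f)

/-- The cell `Z^{ν,I}_{α,α'}(w)`: the families all of whose fibres are of type `w`. -/
def cell (ν : ℝ) (I : Set ℝ) (α : Fin s → ℤ × ℤ) (α' : Fin l → ℤ × ℤ)
    (w : Matrix (Fin s) (Fin l) (ℤ × ℤ)) (R : Type) [CommRing R] :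
    ObjectProperty (FlagFamily R s l) :=
  fun z => ∀ (K : Type) [Field K] (f : R →+* K),
    ∃ h : IsSteinbergPoint ν I α α' (z.fibre f), h.HasType w

/-- The set `W^ν(α, α')` of matrices with entries in `K₀(Coh^ν)⁺`, row sums `α` and column
sums `α'`. -/
def W (ν : ℝ) (α : Fin s → ℤ × ℤ) (α' : Fin l → ℤ × ℤ) : Set (Matrix (Fin s) (Fin l) (ℤ × ℤ)) :=
  {w | (∀ i j, w i j ∈ K0plus ν) ∧ (∀ i, ∑ j, w i j = α i) ∧ ∀ j, ∑ i, w i j = α' j}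

/-- The set `W(α, α')^{ν,I}` of those `w ∈ W^ν(α, α')` for which the cell `Z^{ν,I}_{α,α'}(w)` is
nonempty, i.e. has a point over `ℂ`. -/
def WI (ν : ℝ) (I : Set ℝ) (α : Fin s → ℤ × ℤ) (α' : Fin l → ℤ × ℤ) :
    Set (Matrix (Fin s) (Fin l) (ℤ × ℤ)) :=
  {w | w ∈ W ν α α' ∧ ∃ z : FlagFamily ℂ s l, cell ν I α α' w ℂ z}

/-- `ν_n = φ(𝒪(-n)) + 1 = 1 - arctan(n) / π`. -/
def nu (n : ℕ) : ℝ := 1 - Real.arctan n / Real.pi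

end Stacks

end SteinbergP1

end

open SteinbergP1

noncomputable section

namespace SteinbergP1

open Limits Opposite TopologicalSpace

universe u

/-! ### Sections of sheaves of modules -/

section Sections

variable {X : Scheme.{u}}

/-! Both stacks and their cells are defined by conditions on fibres at field-valued points, so it
suffices to describe these conditions over a field in terms that do not involve `ν`, for all `ν` in
`[1/2, nu n]` with `n` large. That description is by flags of subsheaves (`ShFlag`) and their
relative position (`ShType`).

For `1/2 ≤ ν ≤ 1` the heart `Coh^ν` is the tilt of coherent sheaves at the torsion pair of phase `μ
= ν - 1` (`heart_iff_inD`): `H⁰` lies in `T` (nonzero quotients have phase `> μ`), `H⁻¹` lies in `F`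
(nonzero subsheaves have phase `≤ μ`), and there is no other cohomology. For `ν = 1/2` the class `F`
is zero. An object of `Coh^I` is a sheaf `M` in `T` for `σ - 1`. If `nu c ≤ σ`, its quotients have
slope at least `-c`, so the degrees of its subsheaves are at most `C = |deg M| + c · rk M`
(`InT.degLE`).

Subobjects of such a sheaf in `Coh^ν` are again sheaves (`isSheaf_of_mono`), mapping to it with
sheaf kernel in `F` (`inF_kernel_of_mono`). The class of a quotient in `Coh^ν` is still the
difference of sheaf classes, so the terms of a flag have the partial sums of `α` as classes and
their degrees are at least `-B`, where `B = ∑ |deg α i|`. A nonzero kernel in `F` has degree at most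
`-n`, whereas the image has degree at most `C`; this is impossible once `n > B + C`, so the maps are
injective on sheaves (`DegLE.mono_of_inF_kernel`). Conversely, a subsheaf of degree at least `-B`
has no nonzero quotient of slope at most `-n`, hence lies in `T` and is a subobject in `Coh^ν`
(`DegLE.inT`).

For the cells, intersections of terms of the two flags also have degree bounded below, because their
sums have degree at most `C`; they therefore lie in `T` (`DegLE.inT_inf`). Then the meets, the joins
and the classes of subquotients needed for the type agree with those of sheaves
(`exists_subquotient_iff`). The join is the delicate point: a subobject in `Coh^ν` need not inject
on sheaves, and two lifts to it agree on an intersection because there are no nonzero maps from `T`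
to `F`.

What precedes this argument is the required theory of coherent sheaves on the projective line:
exactness of sections over affine opens, finiteness of Čech cohomology, additivity of rank and
degree, and Harder–Narasimhan filtrations. -/

/-- Restriction of sections of a sheaf of modules. -/
def res (M : X.Modules) {V U : X.Opens} (h : V ≤ U) : Γ(M, U) →+ Γ(M, V) :=
  (M.presheaf.map (homOfLE h).op).hom

/-- Restriction of functions. -/
def fres {V U : X.Opens} (h : V ≤ U) : Γ(X, U) →+* Γ(X, V) :=
  (X.presheaf.map (homOfLE h).op).hom

lemma res_res (M : X.Modules) {W V U : X.Opens} (h : V ≤ U) (h' : W ≤ V) (s : Γ(M, U)) :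
    res M h' (res M h s) = res M (h'.trans h) s := by
  have := ConcreteCategory.congr_hom (M.presheaf.map_comp (homOfLE h).op (homOfLE h').op) s
  exact this.symm

lemma fres_fres {W V U : X.Opens} (h : V ≤ U) (h' : W ≤ V) (s : Γ(X, U)) :
    fres h' (fres h s) = fres (h'.trans h) s := by
  have := ConcreteCategory.congr_hom (X.presheaf.map_comp (homOfLE h).op (homOfLE h').op) s
  exact this.symm

lemma res_smul (M : X.Modules) {V U : X.Opens} (h : V ≤ U) (r : Γ(X, U)) (s : Γ(M, U)) :
    res M h (r • s) = fres h r • res M h s :=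
  M.map_smul (homOfLE h) r s

/-- A morphism of sheaves of modules on sections, as a linear map. -/
def appL {M N : X.Modules} (φ : M ⟶ N) (U : X.Opens) : Γ(M, U) →ₗ[Γ(X, U)] Γ(N, U) where
  toFun := φ.app U
  map_add' := map_add _
  map_smul' := φ.app_smul

lemma appL_res {M N : X.Modules} (φ : M ⟶ N) {V U : X.Opens} (h : V ≤ U) (s : Γ(M, U)) :
    appL φ V (res M h s) = res N h (appL φ U s) :=
  ConcreteCategory.congr_hom (φ.mapPresheaf.naturality (homOfLE h).op) s

lemma appL_comp {M N P : X.Modules} (φ : M ⟶ N) (ψ : N ⟶ P) (U : X.Opens) (s : Γ(M, U)) :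
    appL (φ ≫ ψ) U s = appL ψ U (appL φ U s) := rfl

lemma appL_zero {M N : X.Modules} (U : X.Opens) (s : Γ(M, U)) :
    appL (0 : M ⟶ N) U s = 0 := rfl

/-- Sections which agree on a cover are equal. -/
lemma eq_of_res_eq (M : X.Modules) {ι : Type*} (V : ι → X.Opens) {U : X.Opens}
    (hV : ∀ i, V i ≤ U) (hU : U ≤ ⨆ i, V i) {s t : Γ(M, U)}
    (h : ∀ i, res M (hV i) s = res M (hV i) t) : s = t :=
  TopCat.Sheaf.eq_of_locally_eq' ⟨_, M.isSheaf⟩ V U (fun i => homOfLE (hV i)) hU s t h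

/-- Gluing of sections. -/
lemma exists_glue (M : X.Modules) {ι : Type*} (V : ι → X.Opens) {U : X.Opens}
    (hV : ∀ i, V i ≤ U) (hU : U ≤ ⨆ i, V i) (s : ∀ i, Γ(M, V i))
    (h : ∀ i j, res M (inf_le_left : V i ⊓ V j ≤ V i) (s i) =
      res M (inf_le_right : V i ⊓ V j ≤ V j) (s j)) :
    ∃ t : Γ(M, U), ∀ i, res M (hV i) t = s i := by
  obtain ⟨t, ht, -⟩ := TopCat.Sheaf.existsUnique_gluing' ⟨_, M.isSheaf⟩ V U
    (fun i => homOfLE (hV i)) hU s (fun i j => h i j)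
  exact ⟨t, ht⟩

end Sections

/-! ### Monomorphisms, epimorphisms and exactness on sections -/

section Exact

variable {X : Scheme.{u}}

lemma appL_injective_of_mono {M N : X.Modules} (φ : M ⟶ N) [Mono φ] (U : X.Opens) :
    Function.Injective (appL φ U) := by
  have h1 : Mono ((Scheme.Modules.toPresheaf X).map φ) := inferInstance
  have h2 : Mono (((Scheme.Modules.toPresheaf X).map φ).app (op U)) := inferInstance
  exact (AddCommGrpCat.mono_iff_injective _).1 h2

/-- Taking sections over a fixed open set preserves limits, in particular kernels. -/
lemma exists_of_exact {S : ShortComplex X.Modules} (hS : S.Exact) [Mono S.f] (U : X.Opens)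
    (s : Γ(S.X₂, U)) (hs : appL S.g U s = 0) : ∃ t, appL S.f U t = s := by
  let F : X.Modules ⥤ Ab := Scheme.Modules.toPresheaf X ⋙ (evaluation _ _).obj (op U)
  have hk : IsLimit (KernelFork.ofι S.f S.zero) := hS.fIsKernel
  have : PreservesLimits ((evaluation (Opens X)ᵒᵖ Ab.{u}).obj (op U)) :=
    evaluationPreservesLimits _
  have : PreservesLimits F := comp_preservesLimits _ _
  have : F.PreservesZeroMorphisms := ⟨fun _ _ => rfl⟩
  have h2 := KernelFork.mapIsLimit _ hk F
  have h3 : (ShortComplex.mk (F.map S.f) (F.map S.g) (by rw [← F.map_comp, S.zero, F.map_zero])).Exact :=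
    ShortComplex.exact_of_f_is_kernel _ h2
  rw [ShortComplex.ab_exact_iff] at h3
  exact h3 s hs

/-- Epimorphisms of sheaves of modules are locally surjective. -/
lemma isLocallySurjective_of_epi {C : Type*} [Category* C] {J : GrothendieckTopology C}
    {R : Sheaf J RingCat.{u}} [HasSheafify J AddCommGrpCat.{u}]
    [J.WEqualsLocallyBijective AddCommGrpCat.{u}] {M N : SheafOfModules.{u} R} (φ : M ⟶ N)
    [Epi φ] : Presheaf.IsLocallySurjective J ((PresheafOfModules.toPresheaf _).map φ.val) := by
  let G := SheafOfModules.forget.{u} R ⋙ PresheafOfModules.restrictScalars (𝟙 R.obj)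
  let adj := PresheafOfModules.sheafificationAdjunction.{u} (𝟙 R.obj)
  let φ' : G.obj M ⟶ G.obj N := G.map φ
  -- The presheaf cokernel followed by sheafification comes from a sheaf morphism out of `N` that
  -- kills `φ`, hence is zero. So every section of the presheaf cokernel is locally zero, which says
  -- that sections of `N` locally come from `M`.
  let π := cokernel.π φ'
  let η := adj.unit.app (cokernel φ')
  obtain ⟨ψ, hψ⟩ := G.map_surjective (π ≫ η)
  have h0 : ψ = 0 := by
    have : φ ≫ ψ = 0 := by
      apply G.map_injective
      rw [Functor.map_comp, hψ, ← Category.assoc]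
      have h2 : G.map φ ≫ π = 0 := cokernel.condition _
      rw [h2, zero_comp, Functor.map_zero]
    rw [← cancel_epi φ, this, comp_zero]
  have h1 : π ≫ η = 0 := by rw [← hψ, h0, Functor.map_zero]
  constructor
  intro U s
  let c : (cokernel φ').obj (op U) := π.app (op U) s
  have hc : η.app (op U) c = 0 := congr_arg (fun θ => θ.app (op U) s) h1
  have hinj : Presheaf.IsLocallyInjective J
      ((PresheafOfModules.toPresheaf _).map η) := by
    dsimp only [η, adj]
    rw [PresheafOfModules.toPresheaf_map_sheafificationAdjunction_unit_app]
    exact (J.W_toSheafify _).isLocallyInjective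
  have h3 := Presheaf.equalizerSieve_mem J ((PresheafOfModules.toPresheaf _).map η)
    (X := op U) c 0 (hc.trans (map_zero _).symm)
  refine J.superset_covering ?_ h3
  intro V f hf
  have hf' : π.app (op V) ((G.obj N).map f.op s) = 0 := by
    have h4 : (cokernel φ').map f.op c = 0 := hf.trans (map_zero _)
    exact (PresheafOfModules.naturality_apply π f.op s).trans h4
  have hex : (ShortComplex.mk φ' π (cokernel.condition _)).Exact :=
    ShortComplex.exact_of_g_is_cokernel _ (cokernelIsCokernel φ')
  have hex' := hex.map (PresheafOfModules.evaluation _ (op V))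
  rw [ShortComplex.moduleCat_exact_iff] at hex'
  obtain ⟨t, ht⟩ := hex' _ hf'
  exact ⟨t, ht⟩

lemma exists_local_lift {M N : X.Modules} (φ : M ⟶ N) [Epi φ] {U : X.Opens} (s : Γ(N, U))
    {x : X} (hx : x ∈ U) :
    ∃ (V : X.Opens) (h : V ≤ U) (_ : x ∈ V) (t : Γ(M, V)), appL φ V t = res N h s := by
  let φ' : SheafOfModules.Hom M N := φ
  have hepi : Epi (C := SheafOfModules.{u} X.ringCatSheaf) φ' := ‹Epi φ›
  have h := isLocallySurjective_of_epi (C := Opens X) (R := X.ringCatSheaf) φ'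
  obtain ⟨V, f, ⟨t, ht⟩, hxV⟩ := (Presheaf.imageSieve_mem (J := Opens.grothendieckTopology X)
    ((PresheafOfModules.toPresheaf _).map φ'.val) s) x hx
  exact ⟨V, f.le, hxV, t, ht⟩

end Exact

/-! ### Quasi-coherence in terms of sections -/

section Quasicoherent

variable {X : Scheme.{0}}

lemma fromSpec_image_le {U : X.Opens} (hU : IsAffineOpen U) (V : (Spec Γ(X, U)).Opens) :
    hU.fromSpec ''ᵁ V ≤ U :=
  (Scheme.Hom.image_mono _ le_top).trans (by simp)

lemma smul_restrict_fromSpec {U : X.Opens} (hU : IsAffineOpen U) (M : X.Modules)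
    (V : (Spec Γ(X, U)).Opens) (r : Γ(X, U)) (x : Γ(M.restrict hU.fromSpec, V)) :
    (r • x : Γ(M.restrict hU.fromSpec, V)) =
      (fres (fromSpec_image_le hU V) r • (show Γ(M, hU.fromSpec ''ᵁ V) from x) :
        Γ(M, hU.fromSpec ''ᵁ V)) := by
  rw [Scheme.Modules.smul_Spec_def]
  change ((hU.fromSpec.appIso V).inv _ : Γ(X, hU.fromSpec ''ᵁ V)) •
    (show Γ(M, hU.fromSpec ''ᵁ V) from x) = _
  congr 1
  rw [← ConcreteCategory.comp_apply, ← ConcreteCategory.comp_apply]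
  suffices h : ((Scheme.ΓSpecIso Γ(X, U)).inv ≫ (Spec Γ(X, U)).presheaf.map V.leTop.op) ≫
    (hU.fromSpec.appIso V).inv = X.presheaf.map (homOfLE (fromSpec_image_le hU V)).op from
      ConcreteCategory.congr_hom h r
  rw [Iso.comp_inv_eq, Scheme.Hom.appIso_hom', Scheme.Hom.map_appLE, Scheme.Hom.appLE,
    hU.fromSpec_app_self, Category.assoc, ← Functor.map_comp]
  rfl

/-- Restriction of sections of `M` from `U` to `V` is a localization away from `f`: the
existence and uniqueness of extensions up to powers of `f`. -/
structure IsLocalizingAt (M : X.Modules) {V U : X.Opens} (h : V ≤ U) (f : Γ(X, U)) : Prop where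
  exists_res_eq : ∀ s : Γ(M, V), ∃ (n : ℕ) (t : Γ(M, U)), res M h t = fres h f ^ n • s
  exists_smul_eq_zero : ∀ t : Γ(M, U), res M h t = 0 → ∃ n : ℕ, f ^ n • t = 0

lemma isLocalizedModule_iff {R : CommRingCat.{0}} (N : (Spec R).Modules) (D : (Spec R).Opens)
    (f : R) (hD : D ≤ PrimeSpectrum.basicOpen f) :
    IsLocalizedModule (.powers f) ((modulesSpecToSheaf.obj N).obj.map D.leTop.op).hom ↔
      (∀ s : Γ(N, D), ∃ (n : ℕ) (t : Γ(N, ⊤)), res N le_top t = f ^ n • s) ∧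
      (∀ t : Γ(N, ⊤), res N (le_top : D ≤ ⊤) t = 0 → ∃ n : ℕ, f ^ n • t = 0) := by
  let φ := ((modulesSpecToSheaf.obj N).obj.map D.leTop.op).hom
  refine ⟨fun hf => ⟨fun s => ?_, fun t ht => ?_⟩, fun h =>
    IsLocalizedModule.Away.mk_of_addCommGroup ?_ ?_ ?_⟩
  · obtain ⟨n, y, hy⟩ := IsLocalizedModule.Away.surj (f := φ) f s
    exact ⟨n, y, hy.symm⟩
  · obtain ⟨⟨_, n, rfl⟩, hn⟩ := (IsLocalizedModule.eq_zero_iff (.powers f) φ).mp ht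
    exact ⟨n, hn⟩
  · exact Scheme.Modules.isUnit_algebraMap_end_of_le_basicOpen f hD
  · intro x
    obtain ⟨n, t, ht⟩ := h.1 x
    exact ⟨n, t, ht.symm⟩
  · exact h.2

/-- The images of `⊤` and of `D(f)` under `fromSpec` are `U` and `D(f)` only up to a proof of
equality; this transports the localization property along such equalities. -/
lemma isLocalizingAt_iff_of_eq (M : X.Modules) {V U V' U' : X.Opens} (h : V ≤ U) (hU : U' = U)
    (hV : V' = V) (f : Γ(X, U)) :
    ((∀ s : Γ(M, V'), ∃ (n : ℕ) (t : Γ(M, U')), res M (hV.le.trans (h.trans hU.ge)) t =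
        fres (hV.le.trans h) (f ^ n) • s) ∧
      (∀ t : Γ(M, U'), res M (hV.le.trans (h.trans hU.ge)) t = 0 →
        ∃ n : ℕ, fres hU.le (f ^ n) • t = 0)) ↔ IsLocalizingAt M h f := by
  subst hU hV
  have h1 : ∀ n : ℕ, fres (le_refl U') (f ^ n) = f ^ n :=
    fun n => ConcreteCategory.congr_hom (X.presheaf.map_id (op U')) (f ^ n)
  simp only [h1, map_pow]
  exact ⟨fun h => ⟨h.1, h.2⟩, fun h => ⟨h.1, h.2⟩⟩

lemma isLocalizing_restrict_iff {U : X.Opens} (hU : IsAffineOpen U) (M : X.Modules) :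
    IsLocalizing (modulesSpecToSheaf.obj (M.restrict hU.fromSpec)) ↔
      ∀ f : Γ(X, U), IsLocalizingAt M (X.basicOpen_le f) f := by
  refine forall_congr' fun f => ?_
  have hU' : hU.fromSpec ''ᵁ ⊤ = U := by simp
  let D : (Spec Γ(X, U)).Opens := PrimeSpectrum.basicOpen f
  have hV' : hU.fromSpec ''ᵁ D = X.basicOpen f := hU.fromSpec_image_basicOpen f
  refine (isLocalizedModule_iff (M.restrict hU.fromSpec) D f le_rfl).trans
    (Iff.trans ?_ (isLocalizingAt_iff_of_eq M (X.basicOpen_le f) hU' hV' f))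
  refine and_congr (forall_congr' fun s => exists_congr fun n => exists_congr fun t => ?_)
    (forall_congr' fun t => imp_congr Iff.rfl (exists_congr fun n => ?_))
  · rw [smul_restrict_fromSpec]
    rfl
  · rw [smul_restrict_fromSpec]
    rfl

lemma isLocalizingAt_of_isQuasicoherent {M : X.Modules} (hM : SheafOfModules.IsQuasicoherent M)
    {U : X.Opens} (hU : IsAffineOpen U) (f : Γ(X, U)) :
    IsLocalizingAt M (X.basicOpen_le f) f := by
  have : (M.restrict hU.fromSpec).IsQuasicoherent :=
    @Scheme.Modules.isQuasicoherent_restrictFunctor _ _ hU.fromSpec _ M hM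
  exact (isLocalizing_restrict_iff hU M).1
    ((isIso_fromTildeΓ_iff_isLocalizing _).1
      (Scheme.Modules.isIso_fromTildeΓ_of_isQuasicoherent _)) f

/-- The localization property makes the restriction to `Spec Γ(X, U)` the sheaf associated with its
module of global sections, and a presentation of that module gives one of the sheaf. -/
lemma nonempty_presentation_restrict {M : X.Modules} {U : X.Opens} (hU : IsAffineOpen U)
    (h : ∀ f : Γ(X, U), IsLocalizingAt M (X.basicOpen_le f) f) :
    Nonempty (SheafOfModules.Presentation (M.restrict U.ι)) := by
  have h1 : IsIso (M.restrict hU.fromSpec).fromTildeΓ :=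
    (isIso_fromTildeΓ_iff_isLocalizing _).2 ((isLocalizing_restrict_iff hU M).2 h)
  let p : SheafOfModules.Presentation (M.restrict hU.fromSpec) :=
    @SheafOfModules.Presentation.ofIsIso _ _ _ _ _ _ _ _ (M.restrict hU.fromSpec).fromTildeΓ h1
      (presentationTilde.{0} _ .univ (by simp) _ (Submodule.span_eq _))
  let iso : Scheme.Modules.restrictFunctor hU.fromSpec ⋙
      Scheme.Modules.restrictFunctor hU.isoSpec.hom ≅ Scheme.Modules.restrictFunctor U.ι :=
    (Scheme.Modules.restrictFunctorComp _ _).symm ≪≫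
      Scheme.Modules.restrictFunctorCongr hU.isoSpec_hom_fromSpec
  have h2 : IsIso (iso.app M).hom := inferInstance
  exact ⟨@SheafOfModules.Presentation.ofIsIso _ _ _ _ _ _ _ _ (iso.app M).hom h2
    (Scheme.Modules.presentationRestrict hU.isoSpec.hom p)⟩

lemma isQuasicoherent_of_isLocalizingAt {M : X.Modules}
    (h : ∀ (U : X.Opens), IsAffineOpen U → ∀ f : Γ(X, U), IsLocalizingAt M (X.basicOpen_le f) f) :
    SheafOfModules.IsQuasicoherent M := by
  refine ⟨⟨⟨X.affineOpens, fun U => U.1, ?_, fun U => ?_⟩⟩⟩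
  · rw [Opens.coversTop_iff, IsOpenCover]
    exact iSup_affineOpens_eq_top X
  · let p := (nonempty_presentation_restrict U.2 (h U.1 U.2)).some
    let e := Scheme.Modules.overEquiv U.1
    have h1 : IsIso ((Scheme.Modules.overFunctorEquiv U.1).app M).inv := inferInstance
    let q : SheafOfModules.Presentation (e.functor.obj (SheafOfModules.over M U.1)) :=
      @SheafOfModules.Presentation.ofIsIso _ _ _ _ _ _ _ _
        ((Scheme.Modules.overFunctorEquiv U.1).app M).inv h1 p
    have : PreservesColimitsOfSize.{0, 0} e.inverse := inferInstance
    let q' := @SheafOfModules.Presentation.map _ _ _ _ _ _ _ _ _ _ _ _ _ q e.inverse this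
      (U.1.sheafOfModulesEquivOverInverseUnit X.ringCatSheaf).symm
    have h2 : IsIso (e.unitIso.app (SheafOfModules.over M U.1)).inv := inferInstance
    exact @SheafOfModules.Presentation.ofIsIso _ _ _ _ _ _ _ _
      (e.unitIso.app (SheafOfModules.over M U.1)).inv h2 q'

end Quasicoherent

/-! ### Exactness of sections over affine open subsets -/

section AffineExact

variable {X : Scheme.{0}}

lemma isLocalizingAt_inf {M : X.Modules} (hM : SheafOfModules.IsQuasicoherent M)
    {W U : X.Opens} (hW : IsAffineOpen W) (h : W ≤ U) (f : Γ(X, U)) :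
    IsLocalizingAt M (inf_le_left : W ⊓ X.basicOpen f ≤ W) (fres h f) := by
  have h1 := isLocalizingAt_of_isQuasicoherent hM hW (fres h f)
  have h2 : X.basicOpen (fres h f) = W ⊓ X.basicOpen f := X.basicOpen_res f (homOfLE h).op
  have key : ∀ (V : X.Opens) (hV : V ≤ W), X.basicOpen (fres h f) = V →
      IsLocalizingAt M hV (fres h f) := by
    rintro V hV rfl
    exact h1
  exact key _ _ h2

/-- Local lifts of a section, over a finite cover by principal open subsets. -/
lemma exists_finite_local_lifts {M N : X.Modules} (φ : M ⟶ N) [Epi φ] {U : X.Opens}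
    (hU : IsAffineOpen U) (s : Γ(N, U)) :
    ∃ (ι : Type) (_ : Finite ι) (g : ι → Γ(X, U)) (t : ∀ i, Γ(M, X.basicOpen (g i))),
      U ≤ ⨆ i, X.basicOpen (g i) ∧
      ∀ i, appL φ _ (t i) = res N (X.basicOpen_le (g i)) s := by
  have h : ∀ x : U, ∃ (g : Γ(X, U)) (_ : x.1 ∈ X.basicOpen g) (t : Γ(M, X.basicOpen g)),
      appL φ _ t = res N (X.basicOpen_le g) s := by
    intro x
    obtain ⟨V, hV, hx, t, ht⟩ := exists_local_lift φ s x.2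
    obtain ⟨g, hg, hxg⟩ := hU.exists_basicOpen_le ⟨x.1, hx⟩ x.2
    exact ⟨g, hxg, res M hg t, by rw [appL_res, ht, res_res]⟩
  choose g hg t ht using h
  obtain ⟨T, hT⟩ := hU.isCompact.elim_finite_subcover (fun x : U => (X.basicOpen (g x) : Set X))
    (fun x => (X.basicOpen (g x)).isOpen) (fun x hx => Set.mem_iUnion.2 ⟨⟨x, hx⟩, hg ⟨x, hx⟩⟩)
  refine ⟨T, inferInstance, fun i => g i.1, fun i => t i.1, ?_, fun i => ht i.1⟩
  intro x hx
  obtain ⟨i, hi, hxi⟩ := Set.mem_iUnion₂.1 (hT hx)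
  exact Opens.mem_iSup.2 ⟨⟨i, hi⟩, hxi⟩

/-- Local lifts of `s` on a finite principal cover differ from `t`, on the intersection with `D(f)`,
by sections of the subsheaf. After multiplication by a power of `f` these differences extend over
the cover by quasi-coherence, and the corrected lifts agree on overlaps up to a further power of
`f`, so they glue. -/
lemma exists_lift_pow_smul {S : ShortComplex X.Modules} (hS : S.ShortExact)
    (hM : SheafOfModules.IsQuasicoherent S.X₁) {U : X.Opens} (hU : IsAffineOpen U)
    (s : Γ(S.X₃, U)) (f : Γ(X, U)) (t : Γ(S.X₂, X.basicOpen f))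
    (ht : appL S.g _ t = res S.X₃ (X.basicOpen_le f) s) :
    ∃ (n : ℕ) (t' : Γ(S.X₂, U)), appL S.g U t' = f ^ n • s := by
  have := hS.mono_f
  have := hS.epi_g
  obtain ⟨ι, _, g, ti, hcov, hti⟩ := exists_finite_local_lifts S.g hU s
  let W : ι → X.Opens := fun i => X.basicOpen (g i)
  have hWU : ∀ i, W i ≤ U := fun i => X.basicOpen_le _
  have hW : ∀ i, IsAffineOpen (W i) := fun i => hU.basicOpen (g i)
  have hWW : ∀ i j, IsAffineOpen (W i ⊓ W j) := fun i j => by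
    have := hU.basicOpen (g i * g j)
    rwa [X.basicOpen_mul] at this
  -- extensions of the differences on `W i ∩ D(f)`
  have h1 : ∀ i, ∃ (n : ℕ) (u : Γ(S.X₁, W i)), ∀ k : ℕ, n ≤ k →
      res S.X₂ inf_le_left (fres (hWU i) f ^ k • ti i +
        fres (hWU i) f ^ (k - n) • appL S.f _ u) =
      res S.X₂ (inf_le_right : W i ⊓ X.basicOpen f ≤ _) (fres (X.basicOpen_le f) f ^ k • t) := by
    intro i
    obtain ⟨m, hm⟩ := exists_of_exact hS.exact (W i ⊓ X.basicOpen f)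
      (res S.X₂ inf_le_right t - res S.X₂ inf_le_left (ti i)) (by
        rw [map_sub, appL_res, appL_res, ht]
        erw [hti i]
        rw [res_res, res_res, sub_self])
    obtain ⟨n, u, hu⟩ := (isLocalizingAt_inf hM (hW i) (hWU i) f).exists_res_eq m
    refine ⟨n, u, fun k hk => ?_⟩
    have h2 : (fres inf_le_left (fres (hWU i) f) : Γ(X, W i ⊓ X.basicOpen f)) =
      fres inf_le_right (fres (X.basicOpen_le f) f) := by rw [fres_fres, fres_fres]
    rw [map_add, res_smul, res_smul, res_smul, ← appL_res, hu, LinearMap.map_smul, hm, map_pow,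
      map_pow, map_pow, h2, smul_smul, ← pow_add, Nat.sub_add_cancel hk, ← smul_add]
    congr 1
    abel
  choose n u hu using h1
  obtain ⟨N, hN⟩ : ∃ N : ℕ, ∀ i, n i ≤ N := by
    obtain ⟨N, hN⟩ := (Set.finite_range n).bddAbove
    exact ⟨N, fun i => hN ⟨i, rfl⟩⟩
  let t' : ∀ i, Γ(S.X₂, W i) := fun i =>
    fres (hWU i) f ^ N • ti i + fres (hWU i) f ^ (N - n i) • appL S.f _ (u i)
  have ht' : ∀ i, appL S.g _ (t' i) = res S.X₃ (hWU i) (f ^ N • s) := by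
    intro i
    have h0 : appL S.g (W i) (appL S.f _ (u i)) = 0 := by
      rw [← appL_comp, S.zero, appL_zero]
    simp only [t', map_add, LinearMap.map_smul, h0, smul_zero, add_zero, res_smul, map_pow]
    congr 1
    exact hti i
  have h3 : ∀ i j, ∃ m : ℕ,
      (fres (inf_le_left.trans (hWU i)) f : Γ(X, W i ⊓ W j)) ^ m •
        (res S.X₂ inf_le_left (t' i) - res S.X₂ inf_le_right (t' j)) = 0 := by
    intro i j
    obtain ⟨a, ha⟩ := exists_of_exact hS.exact (W i ⊓ W j)
      (res S.X₂ inf_le_left (t' i) - res S.X₂ inf_le_right (t' j)) (by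
        rw [map_sub, appL_res, appL_res, ht', ht', res_res, res_res, sub_self])
    obtain ⟨m, hm⟩ := (isLocalizingAt_inf hM (hWW i j) (inf_le_left.trans (hWU i)) f).exists_smul_eq_zero
      a (by
        apply appL_injective_of_mono S.f
        have ha' : (W i ⊓ W j) ⊓ X.basicOpen f ≤ W i ⊓ X.basicOpen f :=
          inf_le_inf_right _ inf_le_left
        have hb' : (W i ⊓ W j) ⊓ X.basicOpen f ≤ W j ⊓ X.basicOpen f :=
          inf_le_inf_right _ inf_le_right
        rw [appL_res, ha, map_sub, res_res, res_res, map_zero,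
          ← res_res S.X₂ inf_le_left ha', ← res_res S.X₂ inf_le_left hb', hu i N (hN i),
          hu j N (hN j), res_res, res_res, sub_self])
    refine ⟨m, ?_⟩
    rw [← ha, ← LinearMap.map_smul, hm, map_zero]
  choose m hm using h3
  obtain ⟨K, hK⟩ : ∃ K : ℕ, ∀ i j, m i j ≤ K := by
    obtain ⟨K, hK⟩ := (Set.finite_range fun p : ι × ι => m p.1 p.2).bddAbove
    exact ⟨K, fun i j => hK ⟨(i, j), rfl⟩⟩
  obtain ⟨T, hT⟩ := exists_glue S.X₂ W hWU hcov (fun i => fres (hWU i) f ^ K • t' i) (by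
    intro i j
    rw [res_smul, res_smul, map_pow, map_pow, fres_fres, fres_fres, ← sub_eq_zero, ← smul_sub,
      ← Nat.sub_add_cancel (hK i j), pow_add, mul_smul, hm, smul_zero])
  refine ⟨K + N, T, eq_of_res_eq S.X₃ W hWU hcov fun i => ?_⟩
  rw [← appL_res, hT, LinearMap.map_smul, ht', pow_add, mul_smul, res_smul S.X₃ _ (f ^ K),
    map_pow]

/-- Sections over an affine open subset are exact when the subsheaf is quasi-coherent. -/
theorem appL_surjective {S : ShortComplex X.Modules} (hS : S.ShortExact)
    (hM : SheafOfModules.IsQuasicoherent S.X₁) {U : X.Opens} (hU : IsAffineOpen U) :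
    Function.Surjective (appL S.g U) := by
  have := hS.epi_g
  intro s
  obtain ⟨ι, _, g, ti, hcov, hti⟩ := exists_finite_local_lifts S.g hU s
  have hspan : Ideal.span (Set.range g) = ⊤ := by
    rw [← hU.self_le_iSup_basicOpen_iff]
    refine hcov.trans (iSup_le fun i => ?_)
    exact le_iSup (fun f : Set.range g => X.basicOpen (f : Γ(X, U))) ⟨g i, i, rfl⟩
  -- Some power of each `g i` multiplies `s` into the image, and the `g i` generate the unit ideal.
  have : s ∈ LinearMap.range (appL S.g U) := by
    refine Submodule.mem_of_span_eq_top_of_smul_pow_mem _ _ hspan _ ?_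
    rintro ⟨_, i, rfl⟩
    obtain ⟨n, t', ht'⟩ := exists_lift_pow_smul hS hM hU s (g i) (ti i) (hti i)
    exact ⟨n, t', ht'⟩
  exact this

end AffineExact

/-! ### Kernels, cokernels and extensions of coherent sheaves -/

section Coherent

variable {X : Scheme.{0}}

lemma isQuasicoherent_of_leftExact {S : ShortComplex X.Modules} (hS : S.Exact) [Mono S.f]
    (h₂ : SheafOfModules.IsQuasicoherent S.X₂) (h₃ : SheafOfModules.IsQuasicoherent S.X₃) :
    SheafOfModules.IsQuasicoherent S.X₁ := by
  refine isQuasicoherent_of_isLocalizingAt fun U hU f => ⟨fun s => ?_, fun t ht => ?_⟩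
  · obtain ⟨n, t, ht⟩ := (isLocalizingAt_of_isQuasicoherent h₂ hU f).exists_res_eq (appL S.f _ s)
    obtain ⟨m, hm⟩ := (isLocalizingAt_of_isQuasicoherent h₃ hU f).exists_smul_eq_zero
      (appL S.g U t) (by
        rw [← appL_res, ht, LinearMap.map_smul, ← appL_comp, S.zero, appL_zero, smul_zero])
    obtain ⟨a, ha⟩ := exists_of_exact hS U (f ^ m • t) (by rw [LinearMap.map_smul, hm])
    refine ⟨m + n, a, ?_⟩
    apply appL_injective_of_mono S.f
    rw [appL_res, ha, res_smul, ht, LinearMap.map_smul, map_pow, smul_smul, pow_add]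
  · obtain ⟨n, hn⟩ := (isLocalizingAt_of_isQuasicoherent h₂ hU f).exists_smul_eq_zero
      (appL S.f U t) (by rw [← appL_res, ht, map_zero])
    refine ⟨n, appL_injective_of_mono S.f U ?_⟩
    rw [LinearMap.map_smul, hn, map_zero]

/-- A five-lemma chase on the localization property: extend the image in the quotient, lift it over
the affine open, then correct by an extension of the error term from the subsheaf. -/
lemma isQuasicoherent_of_extension {S : ShortComplex X.Modules} (hS : S.ShortExact)
    (h₁ : SheafOfModules.IsQuasicoherent S.X₁) (h₃ : SheafOfModules.IsQuasicoherent S.X₃) :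
    SheafOfModules.IsQuasicoherent S.X₂ := by
  have := hS.mono_f
  refine isQuasicoherent_of_isLocalizingAt fun U hU f => ⟨fun s => ?_, fun t ht => ?_⟩
  · obtain ⟨n, t₃, ht₃⟩ := (isLocalizingAt_of_isQuasicoherent h₃ hU f).exists_res_eq (appL S.g _ s)
    obtain ⟨t₂, rfl⟩ := appL_surjective hS h₁ hU t₃
    obtain ⟨a, ha⟩ := exists_of_exact hS.exact (X.basicOpen f)
      (fres (X.basicOpen_le f) f ^ n • s - res S.X₂ (X.basicOpen_le f) t₂) (by
        rw [map_sub, LinearMap.map_smul, ← ht₃, appL_res, sub_self])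
    obtain ⟨m, b, hb⟩ := (isLocalizingAt_of_isQuasicoherent h₁ hU f).exists_res_eq a
    refine ⟨m + n, f ^ m • t₂ + appL S.f U b, ?_⟩
    rw [map_add, res_smul, ← appL_res, hb, LinearMap.map_smul, ha, map_pow, ← smul_add,
      add_sub_cancel, smul_smul, pow_add]
  · obtain ⟨n, hn⟩ := (isLocalizingAt_of_isQuasicoherent h₃ hU f).exists_smul_eq_zero
      (appL S.g U t) (by rw [← appL_res, ht, map_zero])
    obtain ⟨a, ha⟩ := exists_of_exact hS.exact U (f ^ n • t) (by rw [LinearMap.map_smul, hn])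
    obtain ⟨m, hm⟩ := (isLocalizingAt_of_isQuasicoherent h₁ hU f).exists_smul_eq_zero a (by
      apply appL_injective_of_mono S.f
      rw [appL_res, ha, res_smul, ht, smul_zero, map_zero])
    refine ⟨m + n, ?_⟩
    rw [pow_add, mul_smul, ← ha, ← LinearMap.map_smul, hm, map_zero]

lemma isQuasicoherent_of_quotient {S : ShortComplex X.Modules} (hS : S.ShortExact)
    (h₁ : SheafOfModules.IsQuasicoherent S.X₁) (h₂ : SheafOfModules.IsQuasicoherent S.X₂) :
    SheafOfModules.IsQuasicoherent S.X₃ := by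
  have := hS.mono_f
  refine isQuasicoherent_of_isLocalizingAt fun U hU f => ⟨fun s => ?_, fun t ht => ?_⟩
  · obtain ⟨s₂, rfl⟩ := appL_surjective hS h₁ (hU.basicOpen f) s
    obtain ⟨n, t, ht⟩ := (isLocalizingAt_of_isQuasicoherent h₂ hU f).exists_res_eq s₂
    exact ⟨n, appL S.g U t, by rw [← appL_res, ht, LinearMap.map_smul]⟩
  · obtain ⟨t₂, rfl⟩ := appL_surjective hS h₁ hU t
    obtain ⟨a, ha⟩ := exists_of_exact hS.exact _ (res S.X₂ (X.basicOpen_le f) t₂)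
      (by rw [appL_res, ht])
    obtain ⟨n, b, hb⟩ := (isLocalizingAt_of_isQuasicoherent h₁ hU f).exists_res_eq a
    obtain ⟨m, hm⟩ := (isLocalizingAt_of_isQuasicoherent h₂ hU f).exists_smul_eq_zero
      (f ^ n • t₂ - appL S.f U b) (by
        rw [map_sub, res_smul, ← appL_res, hb, LinearMap.map_smul, ha, map_pow, sub_self])
    refine ⟨m + n, ?_⟩
    have h0 : appL S.g U (appL S.f U b) = 0 := by rw [← appL_comp, S.zero, appL_zero]
    have := congr_arg (appL S.g U) hm
    rw [LinearMap.map_smul, map_sub, h0, sub_zero, LinearMap.map_smul, smul_smul, map_zero] at this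
    rwa [pow_add]

lemma isCoherent_of_iso {M N : X.Modules} (e : M ≅ N) (hM : IsCoherent M) : IsCoherent N := by
  have h1 : (ShortComplex.mk e.hom (0 : N ⟶ M) comp_zero).Exact :=
    (ShortComplex.exact_iff_epi _ rfl).2 (inferInstanceAs (Epi e.hom))
  have hU : ∀ U, Function.Surjective (appL e.hom U) := fun U s => ⟨appL e.inv U s, by
    rw [← appL_comp, e.inv_hom_id]; rfl⟩
  refine ⟨?_, fun U hU' => ?_⟩
  · have h2 : (ShortComplex.mk e.inv (0 : M ⟶ M) comp_zero).Exact :=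
      (ShortComplex.exact_iff_epi _ rfl).2 (inferInstanceAs (Epi e.inv))
    have : Mono (ShortComplex.mk e.inv (0 : M ⟶ M) comp_zero).f := inferInstanceAs (Mono e.inv)
    exact isQuasicoherent_of_leftExact h2 hM.1 hM.1
  · have := hM.2 U hU'
    exact Module.Finite.of_surjective (appL e.hom U) (hU U)

lemma isCoherent_of_quotient {S : ShortComplex X.Modules} (hS : S.ShortExact)
    (h₁ : IsCoherent S.X₁) (h₂ : IsCoherent S.X₂) : IsCoherent S.X₃ := by
  refine ⟨isQuasicoherent_of_quotient hS h₁.1 h₂.1, fun U hU => ?_⟩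
  have := h₂.2 U hU
  exact Module.Finite.of_surjective (appL S.g U) (appL_surjective hS h₁.1 hU)

lemma isCoherent_of_isZero {M : X.Modules} (hM : IsZero M) : IsCoherent M := by
  have hsub : ∀ U (s : Γ(M, U)), s = 0 := fun U s => by
    have h1 : appL (𝟙 M) U s = 0 := by rw [hM.eq_of_src (𝟙 M) 0]; rfl
    exact h1
  refine ⟨isQuasicoherent_of_isLocalizingAt fun U hU f => ⟨fun s => ⟨0, 0, ?_⟩, fun t _ => ⟨0, hsub _ _⟩⟩,
    fun U hU => ?_⟩
  · rw [hsub _ s, smul_zero, map_zero]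
  · have : Subsingleton Γ(M, U) := ⟨fun a b => by rw [hsub U a, hsub U b]⟩
    infer_instance

/-- The short exact sequence of a monomorphism and its cokernel. -/
abbrev monoSES {C : Type*} [Category* C] [Abelian C] {A B : C} (i : A ⟶ B) : ShortComplex C :=
  ShortComplex.mk i (cokernel.π i) (cokernel.condition i)

lemma monoSES_shortExact {C : Type*} [Category* C] [Abelian C] {A B : C} (i : A ⟶ B) [Mono i] :
    (monoSES i).ShortExact where
  exact := ShortComplex.exact_of_g_is_cokernel _ (cokernelIsCokernel i)
  mono_f := ‹Mono i›
  epi_g := inferInstanceAs (Epi (cokernel.π i))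

/-- The short exact sequence of an epimorphism and its kernel. -/
abbrev epiSES {C : Type*} [Category* C] [Abelian C] {A B : C} (p : A ⟶ B) : ShortComplex C :=
  ShortComplex.mk (kernel.ι p) p (kernel.condition p)

lemma epiSES_shortExact {C : Type*} [Category* C] [Abelian C] {A B : C} (p : A ⟶ B) [Epi p] :
    (epiSES p).ShortExact where
  exact := ShortComplex.exact_of_f_is_kernel _ (kernelIsKernel p)
  mono_f := inferInstanceAs (Mono (kernel.ι p))
  epi_g := ‹Epi p›

lemma isCoherent_cokernel_of_mono {M N : X.Modules} (i : M ⟶ N) [Mono i] (hM : IsCoherent M)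
    (hN : IsCoherent N) : IsCoherent (cokernel i) :=
  isCoherent_of_quotient (monoSES_shortExact i) hM hN

variable [IsLocallyNoetherian X]

lemma isCoherent_of_leftExact {S : ShortComplex X.Modules} (hS : S.Exact) [Mono S.f]
    (h₂ : IsCoherent S.X₂) (h₃ : IsCoherent S.X₃) : IsCoherent S.X₁ := by
  refine ⟨isQuasicoherent_of_leftExact hS h₂.1 h₃.1, fun U hU => ?_⟩
  have := IsLocallyNoetherian.component_noetherian ⟨U, hU⟩
  have := h₂.2 U hU
  exact Module.Finite.of_injective (appL S.f U) (appL_injective_of_mono S.f U)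

lemma isCoherent_of_extension {S : ShortComplex X.Modules} (hS : S.ShortExact)
    (h₁ : IsCoherent S.X₁) (h₃ : IsCoherent S.X₃) : IsCoherent S.X₂ := by
  refine ⟨isQuasicoherent_of_extension hS h₁.1 h₃.1, fun U hU => ?_⟩
  have := hS.mono_f
  have : IsNoetherianRing Γ(X, U) := IsLocallyNoetherian.component_noetherian ⟨U, hU⟩
  have := h₁.2 U hU
  have := h₃.2 U hU
  have : IsNoetherian Γ(X, U) Γ(S.X₂, U) :=
    isNoetherian_of_range_eq_ker (appL S.f U) (appL S.g U) (by
      ext s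
      constructor
      · rintro ⟨t, rfl⟩
        rw [LinearMap.mem_ker, ← appL_comp, S.zero, appL_zero]
      · intro h
        exact exists_of_exact hS.exact U s h)
  infer_instance

lemma isCoherent_kernel {M N : X.Modules} (φ : M ⟶ N) (hM : IsCoherent M) (hN : IsCoherent N) :
    IsCoherent (kernel φ) :=
  isCoherent_of_leftExact (ShortComplex.exact_of_f_is_kernel
    (ShortComplex.mk (kernel.ι φ) φ (kernel.condition φ)) (kernelIsKernel φ)) hM hN

lemma isCoherent_image {M N : X.Modules} (φ : M ⟶ N) (hM : IsCoherent M) (hN : IsCoherent N) :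
    IsCoherent (Abelian.image φ) := by
  have hk := isCoherent_kernel φ hM hN
  have h1 : IsCoherent (Abelian.coimage φ) := isCoherent_cokernel_of_mono (kernel.ι φ) hk hM
  exact isCoherent_of_iso (Abelian.coimageIsoImage φ) h1

lemma isCoherent_cokernel {M N : X.Modules} (φ : M ⟶ N) (hM : IsCoherent M)
    (hN : IsCoherent N) : IsCoherent (cokernel φ) := by
  have h2 := isCoherent_cokernel_of_mono (Abelian.image.ι φ) (isCoherent_image φ hM hN) hN
  have e : cokernel φ ≅ cokernel (Abelian.image.ι φ) :=
    (cokernelIsoOfEq (Abelian.image.fac φ).symm) ≪≫ cokernelEpiComp _ _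
  exact isCoherent_of_iso e.symm h2

end Coherent

/-! ### The charts of the projective line -/

section Charts

attribute [local instance] MvPolynomial.gradedAlgebra

open HomogeneousLocalization

variable (K : Type) [Field K]

local notation "𝒢" => MvPolynomial.homogeneousSubmodule (Fin 2) K

lemma X_mem (i : Fin 2) : (MvPolynomial.X i : MvPolynomial (Fin 2) K) ∈ 𝒢 1 :=
  MvPolynomial.isHomogeneous_X K i

lemma X_mem' (i : Fin 2) : (MvPolynomial.X i : MvPolynomial (Fin 2) K) ∈ 𝒢 (1 • 1) :=
  MvPolynomial.isHomogeneous_X K i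

lemma isAffineOpen_chart (i : Fin 2) : IsAffineOpen (P1.chart K i) :=
  Proj.isAffineOpen_basicOpen 𝒢 _ (X_mem K i) one_pos

lemma isAffineOpen_overlap : IsAffineOpen (P1.chart K 0 ⊓ P1.chart K 1) := by
  have h := Proj.isAffineOpen_basicOpen 𝒢 (MvPolynomial.X 0 * MvPolynomial.X 1)
    (SetLike.mul_mem_graded (X_mem K 0) (X_mem K 1)) (by norm_num)
  rwa [Proj.basicOpen_mul] at h

lemma iSup_chart : ⨆ i, P1.chart K i = ⊤ := by
  refine Proj.iSup_basicOpen_eq_top 𝒢 _ ?_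
  refine (HomogeneousIdeal.toIdeal_irrelevant_le _).mpr fun n hn p hp => ?_
  rw [← Set.image_univ]
  refine MvPolynomial.mem_ideal_span_X_image.mpr fun m hm => ?_
  by_contra! hcon
  have hm0 : m = 0 := Finsupp.ext fun i => hcon i (Set.mem_univ i)
  have hdeg : Finsupp.weight 1 m = n :=
    (MvPolynomial.mem_homogeneousSubmodule n p).mp hp (MvPolynomial.mem_support_iff.mp hm)
  rw [hm0, map_zero] at hdeg
  omega

/-- The ring `K[X₀, X₁]_{(Xᵢ)}`, identified with the functions on `D₊(Xᵢ)`. -/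
def chartIso (i : Fin 2) : Away 𝒢 (MvPolynomial.X i) ≃+* Γ(P1 K, P1.chart K i) :=
  (Proj.basicOpenIsoAway 𝒢 _ (X_mem K i) one_pos).commRingCatIsoToRingEquiv

/-- The other index. -/
abbrev other (i : Fin 2) : Fin 2 := 1 - i

/-- The coordinate `X_j / X_i`, `j ≠ i`. -/
def coordAway (i : Fin 2) : Away 𝒢 (MvPolynomial.X i) :=
  Away.mk 𝒢 (X_mem K i) 1 (MvPolynomial.X (other i)) (X_mem' K _)

/-- The coordinate function `X_j / X_i`, `j ≠ i`, on the chart `D₊(X_i)`. -/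
def coord (i : Fin 2) : Γ(P1 K, P1.chart K i) := chartIso K i (coordAway K i)

lemma val_inj (i : Fin 2) : Function.Injective
    (algebraMap (Away 𝒢 (MvPolynomial.X i)) (Localization.Away (MvPolynomial.X i : MvPolynomial (Fin 2) K))) :=
  fun _ _ h => HomogeneousLocalization.val_injective _ h

instance (i : Fin 2) : IsDomain Γ(P1 K, P1.chart K i) := by
  have : IsDomain (Localization.Away (MvPolynomial.X i : MvPolynomial (Fin 2) K)) :=
    IsLocalization.isDomain_localization
      (powers_le_nonZeroDivisors_of_noZeroDivisors (MvPolynomial.X_ne_zero i))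
  have : IsDomain (Away 𝒢 (MvPolynomial.X i)) := (val_inj K i).isDomain
  exact (chartIso K i).symm.injective.isDomain (chartIso K i).symm.toRingHom

/-- The constants in `K[X₀, X₁]_{(Xᵢ)}`. -/
def constAway (i : Fin 2) : K →+* Away 𝒢 (MvPolynomial.X i) :=
  (fromZeroRingHom 𝒢 (Submonoid.powers (MvPolynomial.X i))).comp (algebraMap K (𝒢 0))

/-- The scalars are defined through the structure morphism to `Spec K`; this compares them with
constants in the degree-zero localization, so that the charts can be computed algebraically. -/
lemma scalars_chart (i : Fin 2) (c : K) :
    P1.scalars K (P1.chart K i) c = chartIso K i (constAway K i c) := by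
  let φ : CommRingCat.of K ⟶ Γ(P1 K, P1.chart K i) :=
    CommRingCat.ofHom (constAway K i) ≫ Proj.awayToSection 𝒢 (MvPolynomial.X i)
  have h1 : (P1.chart K i).ι ≫ P1.toSpec K = (P1.chart K i).toSpecΓ ≫ Spec.map φ := by
    have h2 := Proj.awayι_toSpecZero 𝒢 (MvPolynomial.X i) (X_mem K i) one_pos
    rw [Proj.awayι, Category.assoc, Iso.inv_comp_eq, Proj.basicOpenIsoSpec_hom,
      Proj.basicOpenToSpec, Category.assoc, ← Spec.map_comp] at h2
    rw [P1.toSpec, ← Category.assoc]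
    refine (congr_arg (· ≫ _) h2).trans ?_
    rw [Category.assoc, ← Spec.map_comp]
    rfl
  have h4 : ((P1.chart K i).ι ≫ P1.toSpec K).appTop ≫ (P1.chart K i).topIso.hom =
      (P1.toSpec K).appLE ⊤ (P1.chart K i) le_top := by
    rw [Scheme.Hom.comp_appTop, Category.assoc, Scheme.Opens.ι_appTop]
    simp only [Scheme.Hom.appLE, Scheme.Opens.topIso_hom]
    erw [← Functor.map_comp]
    rfl
  have h5 : ((P1.chart K i).toSpecΓ ≫ Spec.map φ).appTop ≫ (P1.chart K i).topIso.hom =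
      (Scheme.ΓSpecIso (CommRingCat.of K)).hom ≫ φ := by
    rw [Scheme.Hom.comp_appTop, Scheme.Opens.toSpecΓ_appTop, Category.assoc, Category.assoc,
      Iso.inv_hom_id, Category.comp_id]
    exact Scheme.ΓSpecIso_naturality φ
  have h6 : (Scheme.ΓSpecIso (CommRingCat.of K)).inv ≫
      (P1.toSpec K).appLE ⊤ (P1.chart K i) le_top = φ := by
    rw [← h4, h1, h5, Iso.inv_hom_id_assoc]
  exact congr_arg (fun f => f.hom c) h6

/-- The surjection `K[X] → Γ(D₊(X_i))` sending `X` to the coordinate function. -/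
def polyToChart (i : Fin 2) : Polynomial K →+* Γ(P1 K, P1.chart K i) :=
  Polynomial.eval₂RingHom (P1.scalars K (P1.chart K i)) (coord K i)

lemma polyToChart_C (i : Fin 2) (c : K) :
    polyToChart K i (Polynomial.C c) = P1.scalars K (P1.chart K i) c :=
  Polynomial.eval₂_C _ _

lemma polyToChart_X (i : Fin 2) : polyToChart K i Polynomial.X = coord K i :=
  Polynomial.eval₂_X _ _

lemma polyToChart_surjective (i : Fin 2) : Function.Surjective (polyToChart K i) := by
  let θ : Polynomial K →+* Away 𝒢 (MvPolynomial.X i) :=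
    Polynomial.eval₂RingHom (constAway K i) (coordAway K i)
  have hθ : polyToChart K i = ((chartIso K i : _ →+* _)).comp θ := by
    refine Polynomial.ringHom_ext (fun c => ?_) ?_
    · rw [polyToChart_C, scalars_chart]
      simp [θ]
    · rw [polyToChart_X]
      simp [θ, coord]
  suffices h : Function.Surjective θ by
    rw [hθ]
    exact (chartIso K i).surjective.comp h
  intro z
  obtain ⟨n, p, hp, rfl⟩ := Away.mk_surjective 𝒢 (X_mem K i) z
  -- The dehomogenization of `p`: since `p` has degree `n`, the fraction `p / X_i ^ n` is a
  -- polynomial in `X_j / X_i`.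
  refine ⟨∑ m ∈ p.support, Polynomial.C (p.coeff m) * Polynomial.X ^ (m (other i)), ?_⟩
  apply val_inj K i
  set L := Localization.Away (MvPolynomial.X i : MvPolynomial (Fin 2) K)
  have hu : IsUnit (algebraMap (MvPolynomial (Fin 2) K) L (MvPolynomial.X i)) :=
    IsLocalization.Away.algebraMap_isUnit _
  have hX : algebraMap (MvPolynomial (Fin 2) K) L (MvPolynomial.X i) *
      algebraMap (Away 𝒢 (MvPolynomial.X i)) L (coordAway K i) =
      algebraMap (MvPolynomial (Fin 2) K) L (MvPolynomial.X (other i)) := by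
    rw [HomogeneousLocalization.algebraMap_apply, coordAway, Away.val_mk, Localization.mk_eq_mk', mul_comm]
    have h9 := IsLocalization.mk'_spec L (MvPolynomial.X (other i))
      (⟨MvPolynomial.X i ^ 1, 1, rfl⟩ : Submonoid.powers (MvPolynomial.X i : MvPolynomial (Fin 2) K))
    rwa [show ((⟨MvPolynomial.X i ^ 1, 1, rfl⟩ :
      Submonoid.powers (MvPolynomial.X i : MvPolynomial (Fin 2) K)) : MvPolynomial (Fin 2) K) =
        MvPolynomial.X i from pow_one _] at h9
  have hC : ∀ c, algebraMap (Away 𝒢 (MvPolynomial.X i)) L (constAway K i c) =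
      algebraMap (MvPolynomial (Fin 2) K) L (MvPolynomial.C c) := fun c => by
    have h8 := HomogeneousLocalization.val_mk (𝒜 := 𝒢) (x := Submonoid.powers (MvPolynomial.X i))
      ⟨0, algebraMap K (𝒢 0) c, 1, one_mem _⟩
    refine h8.trans ?_
    exact Localization.mk_one_eq_algebraMap _
  apply (hu.pow n).mul_left_cancel
  have hr : algebraMap (MvPolynomial (Fin 2) K) L (MvPolynomial.X i) ^ n *
      algebraMap (Away 𝒢 (MvPolynomial.X i)) L (Away.mk 𝒢 (X_mem K i) n p hp) =
      algebraMap (MvPolynomial (Fin 2) K) L p := by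
    rw [HomogeneousLocalization.algebraMap_apply, Away.val_mk, Localization.mk_eq_mk', mul_comm, ← map_pow]
    exact IsLocalization.mk'_spec L p
      (⟨MvPolynomial.X i ^ n, n, rfl⟩ : Submonoid.powers (MvPolynomial.X i : MvPolynomial (Fin 2) K))
  rw [hr, map_sum, map_sum, Finset.mul_sum]
  conv_rhs => rw [p.as_sum, map_sum]
  refine Finset.sum_congr rfl fun m hm => ?_
  have hmn : m i + m (other i) = n := by
    have hdeg : Finsupp.weight 1 m = n • 1 :=
      (MvPolynomial.mem_homogeneousSubmodule _ p).mp hp (MvPolynomial.mem_support_iff.mp hm)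
    rw [Finsupp.weight_apply, Finsupp.sum_fintype _ _ (by simp), Fin.sum_univ_two] at hdeg
    fin_cases i <;> simp [other] at hdeg ⊢ <;> omega
  have hmon : MvPolynomial.monomial m (p.coeff m) = MvPolynomial.C (p.coeff m) *
      (MvPolynomial.X i ^ m i * MvPolynomial.X (other i) ^ m (other i)) := by
    rw [MvPolynomial.monomial_eq, Finsupp.prod_fintype _ _ (by simp), Fin.prod_univ_two]
    fin_cases i <;> simp [other, mul_comm]
  have h7 : θ (Polynomial.C (p.coeff m) * Polynomial.X ^ (m (other i))) =
      constAway K i (p.coeff m) * coordAway K i ^ (m (other i)) := by simp [θ]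
  rw [hmon, h7, map_mul, map_mul, map_mul, map_pow, map_pow, map_pow, hC, ← hmn, pow_add, ← hX, mul_pow]
  ring

instance isNoetherianRing_chart (i : Fin 2) : IsNoetherianRing Γ(P1 K, P1.chart K i) :=
  isNoetherianRing_of_surjective _ _ (polyToChart K i) (polyToChart_surjective K i)

instance : IsLocallyNoetherian (P1 K) :=
  isLocallyNoetherian_of_affine_cover (S := fun i => ⟨P1.chart K i, isAffineOpen_chart K i⟩)
    (iSup_chart K) fun i => isNoetherianRing_chart K i

lemma isUnit_mapId_coordAway (i : Fin 2) (x : ProjectiveSpectrum 𝒢)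
    (hx : MvPolynomial.X i ∈ x.asHomogeneousIdeal.toIdeal.primeCompl) :
    IsUnit (HomogeneousLocalization.mapId 𝒢 (Q := x.asHomogeneousIdeal.toIdeal.primeCompl)
      (Submonoid.powers_le.mpr hx) (coordAway K i)) ↔
      MvPolynomial.X (other i) ∈ x.asHomogeneousIdeal.toIdeal.primeCompl := by
  refine (HomogeneousLocalization.isUnit_iff_isUnit_val _ _ _).symm.trans ?_
  have h1 : (HomogeneousLocalization.mapId 𝒢 (Q := x.asHomogeneousIdeal.toIdeal.primeCompl)
      (Submonoid.powers_le.mpr hx) (coordAway K i)).val =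
      Localization.mk (MvPolynomial.X (other i)) ⟨MvPolynomial.X i, hx⟩ := by
    refine (HomogeneousLocalization.val_mk _).trans ?_
    congr 1
    exact Subtype.ext (pow_one _)
  rw [h1, Localization.mk_eq_mk']
  exact IsLocalization.AtPrime.isUnit_mk'_iff _ _ _ _

lemma isUnit_germ_coord (i : Fin 2) (x : ProjectiveSpectrum 𝒢)
    (hx : MvPolynomial.X i ∈ x.asHomogeneousIdeal.toIdeal.primeCompl) :
    IsUnit ((ProjectiveSpectrum.Proj.structureSheaf 𝒢).presheaf.germ
        (ProjectiveSpectrum.basicOpen 𝒢 (MvPolynomial.X i)) x hx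
        ((ProjectiveSpectrum.Proj.awayToSection 𝒢 (MvPolynomial.X i)).hom (coordAway K i))) ↔
      MvPolynomial.X (other i) ∈ x.asHomogeneousIdeal.toIdeal.primeCompl := by
  have h1 := congr_arg (fun f => f.hom (coordAway K i))
    (ProjectiveSpectrum.Proj.awayToSection_germ 𝒢 (MvPolynomial.X i) x hx)
  refine Iff.trans ?_ (isUnit_mapId_coordAway K i x hx)
  refine Iff.trans (Eq.to_iff (congr_arg IsUnit h1)) ?_
  exact isUnit_map_iff (R := AtPrime 𝒢 x.asHomogeneousIdeal.toIdeal)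
    (S := (ProjectiveSpectrum.Proj.structureSheaf 𝒢).presheaf.stalk x) (Proj.stalkIso' 𝒢 x).symm
    (HomogeneousLocalization.mapId 𝒢 (Submonoid.powers_le.mpr hx) (coordAway K i))

/-- At a point of the chart, the germ of `X_j / X_i` is invertible exactly when `X_j` is outside the
homogeneous prime. -/
lemma basicOpen_coord (i : Fin 2) :
    (P1 K).basicOpen (coord K i) = P1.chart K i ⊓ P1.chart K (other i) := by
  have key : ∀ x (hx : x ∈ P1.chart K i),
      x ∈ (P1 K).basicOpen (coord K i) ↔ x ∈ P1.chart K (other i) := fun x hx => by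
    rw [Scheme.mem_basicOpen _ _ _ hx]
    exact isUnit_germ_coord K i x hx
  ext x
  constructor
  · intro h
    have hx := (P1 K).basicOpen_le _ h
    exact ⟨hx, (key x hx).1 h⟩
  · rintro ⟨hx, h⟩
    exact (key x hx).2 h

lemma fres_coord (i : Fin 2) (h : Proj.basicOpen 𝒢 (MvPolynomial.X 0 * MvPolynomial.X 1) ≤ P1.chart K i) :
    fres h (coord K i) = (Proj.awayToSection 𝒢 (MvPolynomial.X 0 * MvPolynomial.X 1)).hom
      (Away.mk 𝒢 (SetLike.mul_mem_graded (X_mem K 0) (X_mem K 1)) 1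
        (MvPolynomial.X (other i) * MvPolynomial.X (other i))
        (SetLike.mul_mem_graded (X_mem K _) (X_mem K _))) := by
  have hx : (MvPolynomial.X 0 * MvPolynomial.X 1 : MvPolynomial (Fin 2) K) =
      MvPolynomial.X i * MvPolynomial.X (other i) := by
    fin_cases i <;> simp [other, mul_comm]
  have h1 : (Proj.awayToSection 𝒢 (MvPolynomial.X 0 * MvPolynomial.X 1)).hom
      (awayMap 𝒢 (X_mem K (other i)) hx (coordAway K i)) = fres h (coord K i) :=
    congr_arg (fun f => f.hom (coordAway K i))
      (Proj.awayMap_awayToSection 𝒢 (X_mem K (other i)) hx)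
  rw [← h1]
  congr 1
  refine (awayMap_mk 𝒢 (X_mem K (other i)) hx 1 (X_mem K i) (MvPolynomial.X (other i)) (X_mem' K _)).trans ?_
  apply HomogeneousLocalization.val_injective
  rw [Away.val_mk, Away.val_mk, pow_one]

lemma fres_coord_mul (U : (P1 K).Opens) (h₀ : U ≤ P1.chart K 0) (h₁ : U ≤ P1.chart K 1) :
    fres h₀ (coord K 0) * fres h₁ (coord K 1) = 1 := by
  have hV : Proj.basicOpen 𝒢 (MvPolynomial.X 0 * MvPolynomial.X 1) =
    P1.chart K 0 ⊓ P1.chart K 1 := Proj.basicOpen_mul _ _ _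
  have hU := (le_inf h₀ h₁).trans hV.ge
  rw [← fres_fres (hV.le.trans inf_le_left) hU, ← fres_fres (hV.le.trans inf_le_right) hU, ← map_mul,
    fres_coord, fres_coord]
  have h1 : Away.mk 𝒢 (SetLike.mul_mem_graded (X_mem K 0) (X_mem K 1)) 1
        (MvPolynomial.X (other 0) * MvPolynomial.X (other 0))
        (SetLike.mul_mem_graded (X_mem K _) (X_mem K _)) *
      Away.mk 𝒢 (SetLike.mul_mem_graded (X_mem K 0) (X_mem K 1)) 1
        (MvPolynomial.X (other 1) * MvPolynomial.X (other 1))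
        (SetLike.mul_mem_graded (X_mem K _) (X_mem K _)) = 1 := by
    apply HomogeneousLocalization.val_injective
    rw [HomogeneousLocalization.val_mul, HomogeneousLocalization.val_one, Away.val_mk, Away.val_mk,
      Localization.mk_mul, ← Localization.mk_one, Localization.mk_eq_mk_iff, Localization.r_iff_exists]
    refine ⟨1, ?_⟩
    simp [other]
    ring
  have h2 := congr_arg (Proj.awayToSection 𝒢 (MvPolynomial.X 0 * MvPolynomial.X 1)).hom h1
  rw [map_mul, map_one] at h2
  exact (congr_arg (fres hU) h2).trans (map_one _)

end Charts

set_option linter.unusedSectionVars false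

/-! ### Two-chart gluing data over a field -/

section Gluing

open Polynomial

variable {K : Type*} [Field K]

/-- A single nonzero `p` annihilates the module, so remainders modulo `p` suffice as coefficients of
the generators. -/
lemma finite_of_isTorsion (M : Type*) [AddCommGroup M] [Module K M] [Module K[X] M]
    [IsScalarTower K K[X] M] [Module.Finite K[X] M] (hM : Module.IsTorsion K[X] M) :
    Module.Finite K M := by
  obtain ⟨p, hp, hp0⟩ := Submodule.annihilator_top_inter_nonZeroDivisors hM
  have hp0 : p ≠ 0 := nonZeroDivisors.ne_zero hp0
  obtain ⟨s, hs⟩ := Module.Finite.fg_top (R := K[X]) (M := M)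
  have hfg : (degreeLT K p.natDegree).FG :=
    Module.Finite.iff_fg.1 (Module.Finite.equiv (degreeLTEquiv K p.natDegree).symm)
  have key : (⨆ e ∈ s, (degreeLT K p.natDegree).map
      ((LinearMap.toSpanSingleton K[X] M e).restrictScalars K)) = ⊤ := by
    rw [eq_top_iff]
    rintro x -
    have hx : x ∈ Submodule.span K[X] (s : Set M) := hs ▸ Submodule.mem_top
    rw [Submodule.mem_span_finset] at hx
    obtain ⟨f, -, rfl⟩ := hx
    refine Submodule.sum_mem _ fun e he => ?_
    refine Submodule.mem_iSup_of_mem e (Submodule.mem_iSup_of_mem he ⟨f e % p, ?_, ?_⟩)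
    · rw [SetLike.mem_coe, mem_degreeLT, ← degree_eq_natDegree hp0]
      exact EuclideanDomain.mod_lt _ hp0
    · have h1 : p • e = 0 := (Submodule.mem_annihilator.1 hp) e Submodule.mem_top
      have h2 : f e • e = (f e % p) • e := by
        conv_lhs => rw [← EuclideanDomain.mod_add_div (f e) p]
        rw [add_smul, mul_comm, mul_smul, h1, smul_zero, add_zero]
      exact h2.symm
  refine ⟨key ▸ ?_⟩
  exact Submodule.fg_biSup _ _ fun e _ => hfg.map _

lemma torsion_fg (M : Type*) [AddCommGroup M] [Module K M] [Module K[X] M]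
    [IsScalarTower K K[X] M] [Module.Finite K[X] M] :
    ((Submodule.torsion K[X] M).restrictScalars K).FG :=
  Module.Finite.iff_fg.1
    (finite_of_isTorsion (K := K) (Submodule.torsion K[X] M) Submodule.torsion_isTorsion)

variable {M₀ M₁ N : Type*} [AddCommGroup M₀] [Module K M₀] [Module K[X] M₀]
  [IsScalarTower K K[X] M₀] [AddCommGroup M₁] [Module K M₁] [Module K[X] M₁]
  [IsScalarTower K K[X] M₁] [AddCommGroup N] [Module K N]

/-- The sections of a quasi-coherent sheaf on `ℙ¹` over the two standard charts and their
intersection, with the action of the two coordinates. -/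
structure IsGluing (ρ₀ : M₀ →ₗ[K] N) (ρ₁ : M₁ →ₗ[K] N) (u v : N →ₗ[K] N) : Prop where
  uv : ∀ z, u (v z) = z
  vu : ∀ z, v (u z) = z
  map₀ : ∀ x, ρ₀ ((X : K[X]) • x) = u (ρ₀ x)
  map₁ : ∀ y, ρ₁ ((X : K[X]) • y) = v (ρ₁ y)
  loc₀ : ∀ z, ∃ (n : ℕ) (x : M₀), ρ₀ x = (u ^ n) z
  loc₁ : ∀ z, ∃ (n : ℕ) (y : M₁), ρ₁ y = (v ^ n) z
  ker₀ : ∀ x, ρ₀ x = 0 → ∃ n : ℕ, (X : K[X]) ^ n • x = 0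
  ker₁ : ∀ y, ρ₁ y = 0 → ∃ n : ℕ, (X : K[X]) ^ n • y = 0

namespace IsGluing

variable {ρ₀ : M₀ →ₗ[K] N} {ρ₁ : M₁ →ₗ[K] N} {u v : N →ₗ[K] N}

lemma symm (h : IsGluing ρ₀ ρ₁ u v) : IsGluing ρ₁ ρ₀ v u :=
  ⟨h.vu, h.uv, h.map₁, h.map₀, h.loc₁, h.loc₀, h.ker₁, h.ker₀⟩

variable (h : IsGluing ρ₀ ρ₁ u v)

include h

lemma map_pow₀ (n : ℕ) (x : M₀) : ρ₀ ((X : K[X]) ^ n • x) = (u ^ n) (ρ₀ x) := by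
  induction n with
  | zero => simp
  | succ n ih => rw [pow_succ', mul_smul, h.map₀, ih, pow_succ', Module.End.mul_apply]

lemma map_pow₁ (n : ℕ) (y : M₁) : ρ₁ ((X : K[X]) ^ n • y) = (v ^ n) (ρ₁ y) :=
  h.symm.map_pow₀ n y

lemma vu_pow (n : ℕ) (z : N) : (v ^ n) ((u ^ n) z) = z := by
  have : v * u = 1 := LinearMap.ext h.vu
  have h2 : v ^ n * u ^ n = 1 := by
    have hc : Commute v u := by rw [Commute, SemiconjBy, this]; exact (LinearMap.ext h.uv).symm
    rw [← hc.mul_pow, this, one_pow]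
  exact LinearMap.congr_fun h2 z

lemma uv_pow (n : ℕ) (z : N) : (u ^ n) ((v ^ n) z) = z := h.symm.vu_pow n z

lemma ker₀_le_torsion {x : M₀} (hx : ρ₀ x = 0) : x ∈ Submodule.torsion K[X] M₀ := by
  obtain ⟨n, hn⟩ := h.ker₀ x hx
  exact ⟨⟨X ^ n, pow_mem (mem_nonZeroDivisors_of_ne_zero X_ne_zero) n⟩, hn⟩

lemma ker₀_fg [Module.Finite K[X] M₀] : (LinearMap.ker ρ₀).FG :=
  (torsion_fg (K := K) M₀).of_le fun _ hx => h.ker₀_le_torsion hx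

/-- This gives finiteness of `H¹`. Every element of `N` is a combination of `v ^ k (ρ₀ e)` and
elements of the range of `ρ₀`, with `e` among finitely many generators; for `k` large, `v ^ k (ρ₀
e)` lies in the range of `ρ₁`. -/
lemma cokernel_finite [Module.Finite K[X] M₀] :
    ∃ s : Set N, s.Finite ∧
      LinearMap.range ρ₀ ⊔ LinearMap.range ρ₁ ⊔ Submodule.span K s = ⊤ := by
  obtain ⟨G, hG⟩ := Module.Finite.fg_top (R := K[X]) (M := M₀)
  choose b y hy using fun e : M₀ => h.loc₁ (ρ₀ e)
  refine ⟨⋃ e ∈ G, (fun k => (v ^ k) (ρ₀ e)) '' Set.Iio (b e),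
    G.finite_toSet.biUnion fun e _ => (Set.finite_Iio _).image _, ?_⟩
  set T := LinearMap.range ρ₀ ⊔ LinearMap.range ρ₁ ⊔ Submodule.span K
    (⋃ e ∈ G, (fun k => (v ^ k) (ρ₀ e)) '' Set.Iio (b e)) with hT
  have hP : LinearMap.range ρ₀ ≤ T := le_sup_left.trans le_sup_left
  have hQ : LinearMap.range ρ₁ ≤ T := le_sup_right.trans le_sup_left
  have key : ∀ e ∈ G, ∀ n k : ℕ, (v ^ n) (ρ₀ ((X : K[X]) ^ k • e)) ∈ T := by
    intro e he n k
    rw [h.map_pow₀]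
    rcases le_total n k with hnk | hnk
    · obtain ⟨m, rfl⟩ := Nat.exists_eq_add_of_le hnk
      rw [pow_add, Module.End.mul_apply, h.vu_pow, ← h.map_pow₀]
      exact hP ⟨_, rfl⟩
    · obtain ⟨m, rfl⟩ := Nat.exists_eq_add_of_le hnk
      rw [add_comm, pow_add, Module.End.mul_apply, h.vu_pow]
      rcases lt_or_ge m (b e) with hm | hm
      · refine le_sup_right (a := LinearMap.range ρ₀ ⊔ LinearMap.range ρ₁) (Submodule.subset_span ?_)
        exact Set.mem_biUnion he ⟨m, hm, rfl⟩
      · obtain ⟨m, rfl⟩ := Nat.exists_eq_add_of_le hm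
        rw [add_comm, pow_add, Module.End.mul_apply, ← hy, ← h.map_pow₁]
        exact hQ ⟨_, rfl⟩
  have key2 : ∀ e ∈ G, ∀ (n : ℕ) (q : K[X]), (v ^ n) (ρ₀ (q • e)) ∈ T := by
    intro e he n q
    induction q using Polynomial.induction_on' with
    | add p q hp hq => rw [add_smul, map_add, map_add]; exact T.add_mem hp hq
    | monomial k c =>
      rw [← smul_X_eq_monomial, smul_assoc, map_smul, map_smul]
      exact T.smul_mem _ (key e he n k)
  rw [eq_top_iff]
  rintro z -
  obtain ⟨n, x, hx⟩ := h.loc₀ z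
  rw [← h.vu_pow n z, ← hx]
  have hx' : x ∈ Submodule.span K[X] (G : Set M₀) := hG ▸ Submodule.mem_top
  rw [Submodule.mem_span_finset] at hx'
  obtain ⟨f, -, rfl⟩ := hx'
  rw [map_sum, map_sum]
  exact T.sum_mem fun e he => key2 e he n (f e)

/-- Multiplying by a high power of the coordinate brings sections over the second chart to the
first one, with control of the degrees. -/
lemma exists_bounded_lift [Module.Finite K[X] M₁] {ι : Type*} [Finite ι]
    (π : M₀ →ₗ[K[X]] (ι → K[X])) :
    ∃ a D : ℕ, ∀ y : M₁, ∃ (m : ℕ) (x : M₀), ρ₀ x = (u ^ (a + m)) (ρ₁ y) ∧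
      ∀ i, (π x i).natDegree ≤ D + m := by
  obtain ⟨G, hG⟩ := Module.Finite.fg_top (R := K[X]) (M := M₁)
  choose n x hx using fun e : M₁ => h.loc₀ (ρ₁ e)
  let a := G.sup n
  let x' : M₁ → M₀ := fun e => (X : K[X]) ^ (a - n e) • x e
  have hx' : ∀ e ∈ G, ρ₀ (x' e) = (u ^ a) (ρ₁ e) := fun e he => by
    rw [h.map_pow₀, hx, ← Module.End.mul_apply, ← pow_add, Nat.sub_add_cancel (Finset.le_sup he)]
  have := Fintype.ofFinite ι
  let D := G.sup fun e => Finset.univ.sup fun i => (π (x' e) i).natDegree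
  refine ⟨a, D, fun y => ?_⟩
  let C' : Set M₁ := {y | ∃ (m : ℕ) (x : M₀), ρ₀ x = (u ^ (a + m)) (ρ₁ y) ∧
        ∀ i, (π x i).natDegree ≤ D + m}
  have hadd : ∀ y₁ ∈ C', ∀ y₂ ∈ C', y₁ + y₂ ∈ C' := by
    rintro y₁ ⟨m₁, x₁, h₁, d₁⟩ y₂ ⟨m₂, x₂, h₂, d₂⟩
    refine ⟨m₁ + m₂, (X : K[X]) ^ m₂ • x₁ + (X : K[X]) ^ m₁ • x₂, ?_, fun i => ?_⟩
    · rw [map_add, h.map_pow₀, h.map_pow₀, h₁, h₂, ← Module.End.mul_apply, ← pow_add,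
        ← Module.End.mul_apply, ← pow_add, map_add, map_add,
        show m₂ + (a + m₁) = a + (m₁ + m₂) by ring, show m₁ + (a + m₂) = a + (m₁ + m₂) by ring]
    · rw [map_add, map_smul, map_smul, Pi.add_apply, Pi.smul_apply, Pi.smul_apply, smul_eq_mul,
        smul_eq_mul]
      have := d₁ i
      have := d₂ i
      refine (natDegree_add_le _ _).trans (max_le ?_ ?_) <;>
      · refine natDegree_mul_le.trans ?_
        rw [natDegree_X_pow]
        omega
  let L : Submodule K[X] M₁ :=
    { carrier := C'
      zero_mem' := ⟨0, 0, by simp, by simp⟩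
      add_mem' := fun h₁ h₂ => hadd _ h₁ _ h₂
      smul_mem' := by
        intro q y hy
        induction q using Polynomial.induction_on' with
        | add p q hp hq =>
          rw [add_smul]
          exact hadd _ hp _ hq
        | monomial k c =>
          obtain ⟨m, x, h₁, d⟩ := hy
          -- The coordinate of the second chart acts on `N` as the inverse of `u`, so multiplication
          -- by `X ^ k` only raises the required power of `u` by `k`, with the same lift up to the
          -- scalar `c`.
          refine ⟨m + k, c • x, ?_, fun i => ?_⟩
          · rw [← smul_X_eq_monomial, smul_assoc, map_smul, map_smul, map_smul, h.map_pow₁, h₁,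
              ← add_assoc, pow_add _ (a + m), Module.End.mul_apply, h.uv_pow]
          · have : π (c • x) i = C c * π x i := by
              rw [← algebraMap_smul K[X] c x, map_smul]; rfl
            rw [this]
            exact (natDegree_C_mul_le _ _).trans ((d i).trans (by omega)) }
  have hL : Submodule.span K[X] (G : Set M₁) ≤ L := Submodule.span_le.2 fun e he =>
    ⟨0, x' e, by rw [hx' e he, add_zero], fun i =>
      (Finset.le_sup (f := fun i => (π (x' e) i).natDegree) (Finset.mem_univ i)).trans
        (Finset.le_sup (f := fun e => Finset.univ.sup fun i => (π (x' e) i).natDegree) he)⟩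
  exact hL (hG ▸ Submodule.mem_top)

/-- This gives finiteness of `H⁰`. The coordinates of a global section in a basis of the
torsion-free quotient of `M₀` have bounded degree; what remains is torsion in `M₀` and then `ker
ρ₁`, both finite-dimensional. -/
lemma kernel_fg [Module.Finite K[X] M₀] [Module.Finite K[X] M₁] (P : Submodule K (M₀ × M₁))
    (hP : ∀ p ∈ P, ρ₀ p.1 = ρ₁ p.2) : P.FG := by
  let F := M₀ ⧸ Submodule.torsion K[X] M₀
  have : Module.IsTorsionFree K[X] F := inferInstance
  let b := Module.Free.chooseBasis K[X] F
  let π : M₀ →ₗ[K[X]] (Module.Free.ChooseBasisIndex K[X] F → K[X]) :=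
    b.equivFun.toLinearMap ∘ₗ (Submodule.torsion K[X] M₀).mkQ
  have hπ : ∀ x, π x = 0 ↔ x ∈ Submodule.torsion K[X] M₀ := fun x => by
    rw [LinearMap.comp_apply, LinearEquiv.coe_coe, LinearEquiv.map_eq_zero_iff, Submodule.mkQ_apply,
      Submodule.Quotient.mk_eq_zero]
  obtain ⟨a, D, hD⟩ := h.exists_bounded_lift π
  -- `X ^ (a + m) • p.1` and the bounded lift `x` have the same image in `N`, so their difference is
  -- torsion and is killed by `π`; comparing degrees cancels `m`.
  have hdeg : ∀ p ∈ P, ∀ i, (π p.1 i).natDegree ≤ D := fun p hp i => by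
    obtain ⟨m, x, hx, hd⟩ := hD p.2
    have h1 : π ((X : K[X]) ^ (a + m) • p.1 - x) = 0 := by
      rw [hπ]
      apply h.ker₀_le_torsion
      rw [map_sub, h.map_pow₀, hx, hP p hp, sub_self]
    rw [map_sub, sub_eq_zero, map_smul] at h1
    have h2 := hd i
    rw [← h1, Pi.smul_apply, smul_eq_mul] at h2
    by_cases h0 : π p.1 i = 0
    · simp [h0]
    · rw [natDegree_X_pow_mul _ h0] at h2
      omega
  apply Submodule.fg_of_fg_map_of_fg_inf_ker ((π.restrictScalars K) ∘ₗ LinearMap.fst K M₀ M₁)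
  · have hfg : (Submodule.pi Set.univ fun _ : Module.Free.ChooseBasisIndex K[X] F =>
        degreeLT K (D + 1)).FG := Submodule.fg_pi fun _ =>
      Module.Finite.iff_fg.1 (Module.Finite.equiv (degreeLTEquiv K _).symm)
    refine hfg.of_le ?_
    rintro _ ⟨p, hp, rfl⟩ i -
    rw [SetLike.mem_coe, mem_degreeLT]
    exact degree_le_natDegree.trans_lt (by exact_mod_cast Nat.lt_succ_of_le (hdeg p hp i))
  · apply Submodule.fg_of_fg_map_of_fg_inf_ker (LinearMap.fst K M₀ M₁)
    · refine (torsion_fg (K := K) M₀).of_le ?_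
      rintro _ ⟨p, hp, rfl⟩
      exact (hπ _).1 hp.2
    · refine (h.symm.ker₀_fg.map (LinearMap.inr K M₀ M₁)).of_le ?_
      rintro ⟨x, y⟩ ⟨⟨hp, -⟩, hx⟩
      have hx : x = 0 := hx
      subst hx
      refine ⟨y, ?_, rfl⟩
      have := hP _ hp
      simpa using this.symm

/-- An injective endomorphism of a finite-dimensional space is bijective. Hence the range, stable
under `u`, is also stable under `u⁻¹`, and every element of `N` enters it after some power of `u`.
-/
lemma surjective_of_finite_range [Module.Finite K (LinearMap.range ρ₀)] :
    Function.Surjective ρ₀ := by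
  have hmap : ∀ z ∈ LinearMap.range ρ₀, u z ∈ LinearMap.range ρ₀ := by
    rintro _ ⟨x, rfl⟩
    exact ⟨_, h.map₀ x⟩
  have hinj : Function.Injective (u.restrict hmap) := fun z w hzw => Subtype.ext (by
    have := congr_arg (fun t => v t.1) hzw
    simpa [h.vu] using this)
  have hsurj := LinearMap.injective_iff_surjective.1 hinj
  have hstep : ∀ z, u z ∈ LinearMap.range ρ₀ → z ∈ LinearMap.range ρ₀ := fun z hz => by
    obtain ⟨w, hw⟩ := hsurj ⟨u z, hz⟩
    have := congr_arg (fun t => v t.1) hw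
    have h2 : w.1 = z := by simpa [h.vu] using this
    exact h2 ▸ w.2
  intro z
  obtain ⟨n, x, hx⟩ := h.loc₀ z
  have : (u ^ n) z ∈ LinearMap.range ρ₀ := ⟨x, hx⟩
  clear hx
  induction n with
  | zero => simpa using this
  | succ n ih =>
    apply ih
    rw [pow_succ', Module.End.mul_apply] at this
    exact hstep _ this

end IsGluing

end Gluing

/-! ### Additivity of the index -/

section Index

variable {K : Type*} [Field K] {M₁ M₂ M₃ N₁ N₂ N₃ : Type*}
  [AddCommGroup M₁] [Module K M₁] [AddCommGroup M₂] [Module K M₂] [AddCommGroup M₃] [Module K M₃]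
  [AddCommGroup N₁] [Module K N₁] [AddCommGroup N₂] [Module K N₂] [AddCommGroup N₃] [Module K N₃]

/-- The index `dim ker d - dim coker d` of a linear map. -/
def index {M N : Type*} [AddCommGroup M] [Module K M] [AddCommGroup N] [Module K N]
    (d : M →ₗ[K] N) : ℤ :=
  (Module.finrank K (LinearMap.ker d) : ℤ) - Module.finrank K (N ⧸ LinearMap.range d)

/-- Rank–nullity along the six-term exact sequence of the snake lemma. -/
lemma index_add (d₁ : M₁ →ₗ[K] N₁) (d₂ : M₂ →ₗ[K] N₂) (d₃ : M₃ →ₗ[K] N₃)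
    (f₁ : M₁ →ₗ[K] M₂) (f₂ : M₂ →ₗ[K] M₃) (g₁ : N₁ →ₗ[K] N₂) (g₂ : N₂ →ₗ[K] N₃)
    (hf : Function.Exact f₁ f₂) (hf₁ : Function.Injective f₁) (hf₂ : Function.Surjective f₂)
    (hg : Function.Exact g₁ g₂) (hg₁ : Function.Injective g₁) (hg₂ : Function.Surjective g₂)
    (h₁ : g₁ ∘ₗ d₁ = d₂ ∘ₗ f₁) (h₂ : g₂ ∘ₗ d₂ = d₃ ∘ₗ f₂)
    [Module.Finite K (LinearMap.ker d₂)] [Module.Finite K (LinearMap.ker d₃)]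
    [Module.Finite K (N₁ ⧸ LinearMap.range d₁)] [Module.Finite K (N₂ ⧸ LinearMap.range d₂)] :
    index d₂ = index d₁ + index d₃ := by
  let φ₁ : LinearMap.ker d₁ →ₗ[K] LinearMap.ker d₂ := f₁.restrict fun x hx => by
    rw [LinearMap.mem_ker, ← LinearMap.comp_apply, ← h₁, LinearMap.comp_apply, hx, map_zero]
  let φ₂ : LinearMap.ker d₂ →ₗ[K] LinearMap.ker d₃ := f₂.restrict fun x hx => by
    rw [LinearMap.mem_ker, ← LinearMap.comp_apply, ← h₂, LinearMap.comp_apply, hx, map_zero]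
  let ψ₁ : (N₁ ⧸ LinearMap.range d₁) →ₗ[K] (N₂ ⧸ LinearMap.range d₂) :=
    Submodule.mapQ _ _ g₁ (by
      rintro _ ⟨x, rfl⟩
      exact ⟨f₁ x, (LinearMap.congr_fun h₁ x).symm⟩)
  let ψ₂ : (N₂ ⧸ LinearMap.range d₂) →ₗ[K] (N₃ ⧸ LinearMap.range d₃) :=
    Submodule.mapQ _ _ g₂ (by
      rintro _ ⟨x, rfl⟩
      exact ⟨f₂ x, (LinearMap.congr_fun h₂ x).symm⟩)
  have e₂ : Function.Exact (LinearMap.ker d₂).subtype d₂ := LinearMap.exact_subtype_ker_map d₂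
  have e₃ : Function.Exact (LinearMap.ker d₃).subtype d₃ := LinearMap.exact_subtype_ker_map d₃
  have c₁ : Function.Exact d₁ (LinearMap.range d₁).mkQ := LinearMap.exact_map_mkQ_range d₁
  have c₂ : Function.Exact d₂ (LinearMap.range d₂).mkQ := LinearMap.exact_map_mkQ_range d₂
  let δ := SnakeLemma.δ' d₁ d₂ d₃ f₁ f₂ hf g₁ g₂ hg h₁ h₂ _ e₃ _ c₁ hf₂ hg₁
  have x₁ : Function.Exact φ₂ δ := SnakeLemma.exact_δ'_right d₁ d₂ d₃ f₁ f₂ hf g₁ g₂ hg h₁ h₂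
    _ e₂ _ e₃ _ c₁ hf₂ hg₁ φ₂ rfl Subtype.val_injective
  have x₂ : Function.Exact δ ψ₁ := SnakeLemma.exact_δ'_left d₁ d₂ d₃ f₁ f₂ hf g₁ g₂ hg h₁ h₂
    _ e₃ _ c₁ _ c₂ hf₂ hg₁ ψ₁ rfl (Submodule.mkQ_surjective _)
  have x₀ : Function.Exact φ₁ φ₂ := fun y => by
    constructor
    · intro hy
      obtain ⟨x, hx⟩ := (hf y.1).1 (congr_arg Subtype.val hy)
      refine ⟨⟨x, hg₁ ?_⟩, Subtype.ext hx⟩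
      rw [← LinearMap.comp_apply, h₁, LinearMap.comp_apply, hx, map_zero]
      exact y.2
    · rintro ⟨x, rfl⟩
      exact Subtype.ext (hf.apply_apply_eq_zero _)
  have x₃ : Function.Exact ψ₁ ψ₂ := fun y => by
    obtain ⟨y, rfl⟩ := Submodule.mkQ_surjective _ y
    constructor
    · intro hy
      have hy : (LinearMap.range d₃).mkQ (g₂ y) = 0 := hy
      rw [Submodule.mkQ_apply, Submodule.Quotient.mk_eq_zero] at hy
      obtain ⟨m₃, hm₃⟩ := hy
      obtain ⟨m₂, rfl⟩ := hf₂ m₃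
      obtain ⟨z, hz⟩ := (hg (y - d₂ m₂)).1 (by
        rw [map_sub, ← hm₃, sub_eq_zero]; exact (LinearMap.congr_fun h₂ m₂).symm)
      refine ⟨(LinearMap.range d₁).mkQ z, ?_⟩
      change (LinearMap.range d₂).mkQ (g₁ z) = _
      rw [hz, map_sub, sub_eq_self, Submodule.mkQ_apply, Submodule.Quotient.mk_eq_zero]
      exact ⟨_, rfl⟩
    · rintro ⟨x, hx⟩
      obtain ⟨x, rfl⟩ := Submodule.mkQ_surjective _ x
      rw [← hx]
      change (LinearMap.range d₃).mkQ (g₂ (g₁ x)) = _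
      rw [hg.apply_apply_eq_zero, map_zero]
  have i₁ : Function.Injective φ₁ := fun x y hxy => Subtype.ext (hf₁ (congr_arg Subtype.val hxy))
  have s₂ : Function.Surjective ψ₂ := fun y => by
    obtain ⟨y, rfl⟩ := Submodule.mkQ_surjective _ y
    obtain ⟨z, rfl⟩ := hg₂ y
    exact ⟨(LinearMap.range d₂).mkQ z, rfl⟩
  have r₁ := LinearMap.finrank_range_add_finrank_ker φ₂
  have r₂ := LinearMap.finrank_range_add_finrank_ker δ
  have r₃ := LinearMap.finrank_range_add_finrank_ker ψ₁
  have r₄ := LinearMap.finrank_range_add_finrank_ker ψ₂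
  rw [LinearMap.exact_iff.1 x₀, LinearMap.finrank_range_of_inj i₁] at r₁
  rw [LinearMap.exact_iff.1 x₁] at r₂
  rw [LinearMap.exact_iff.1 x₂] at r₃
  rw [LinearMap.exact_iff.1 x₃, LinearMap.range_eq_top.2 s₂, finrank_top] at r₄
  unfold index
  omega

end Index

/-! ### The class of a coherent sheaf on the projective line -/

section Cech

open Polynomial

variable {K : Type} [Field K]

/-- Sections over a chart as a module over the polynomial ring. -/
abbrev polyModule (M : (P1 K).Modules) (i : Fin 2) : Module K[X] Γ(M, P1.chart K i) :=
  Module.compHom _ (polyToChart K i)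

attribute [local instance] polyModule

lemma scalar_smul_def (M : (P1 K).Modules) (U : (P1 K).Opens) (c : K) (z : Γ(M, U)) :
    c • z = P1.scalars K U c • z := rfl

lemma poly_smul_def (M : (P1 K).Modules) (i : Fin 2) (p : K[X]) (z : Γ(M, P1.chart K i)) :
    p • z = polyToChart K i p • z := rfl

instance (M : (P1 K).Modules) (i : Fin 2) : IsScalarTower K K[X] Γ(M, P1.chart K i) where
  smul_assoc c p z := by
    rw [poly_smul_def, poly_smul_def, scalar_smul_def, smul_eq_C_mul, map_mul, polyToChart_C, mul_smul]

lemma finite_polyModule {M : (P1 K).Modules} (hM : IsCoherent M) (i : Fin 2) :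
    Module.Finite K[X] Γ(M, P1.chart K i) := by
  obtain ⟨s, hs⟩ := (hM.2 _ (isAffineOpen_chart K i)).fg_top
  refine ⟨⟨s, ?_⟩⟩
  rw [eq_top_iff]
  rintro x -
  have hx : x ∈ Submodule.span Γ(P1 K, P1.chart K i) (s : Set Γ(M, P1.chart K i)) :=
    hs ▸ Submodule.mem_top
  rw [Submodule.mem_span_finset] at hx
  obtain ⟨f, -, rfl⟩ := hx
  refine Submodule.sum_mem _ fun e he => ?_
  obtain ⟨q, hq⟩ := polyToChart_surjective K i (f e)
  rw [← hq]
  exact Submodule.smul_mem _ q (Submodule.subset_span he)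

/-- Multiplication by a function on sections, as a linear map over the ground field. -/
def smulSections (M : (P1 K).Modules) {U : (P1 K).Opens} (f : Γ(P1 K, U)) :
    Γ(M, U) →ₗ[K] Γ(M, U) where
  toFun z := f • z
  map_add' := smul_add f
  map_smul' c z := by
    rw [scalar_smul_def, RingHom.id_apply, scalar_smul_def, smul_smul, smul_smul, mul_comm]

lemma smulSections_pow (M : (P1 K).Modules) {U : (P1 K).Opens} (f : Γ(P1 K, U)) (n : ℕ)
    (z : Γ(M, U)) : (smulSections M f ^ n) z = f ^ n • z := by
  induction n with
  | zero => simp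
  | succ n ih => rw [pow_succ', Module.End.mul_apply, ih, pow_succ', mul_smul]; rfl

lemma isLocalizingAt_overlap {M : (P1 K).Modules} (hM : SheafOfModules.IsQuasicoherent M)
    (i : Fin 2) (h : P1.chart K 0 ⊓ P1.chart K 1 ≤ P1.chart K i) :
    IsLocalizingAt M h (coord K i) := by
  have h1 := isLocalizingAt_of_isQuasicoherent hM (isAffineOpen_chart K i) (coord K i)
  have h2 : (P1 K).basicOpen (coord K i) = P1.chart K 0 ⊓ P1.chart K 1 := by
    rw [basicOpen_coord]
    fin_cases i
    · rfl
    · exact inf_comm _ _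
  have key : ∀ (V : (P1 K).Opens) (hV : V ≤ P1.chart K i), (P1 K).basicOpen (coord K i) = V →
      IsLocalizingAt M hV (coord K i) := by
    rintro V hV rfl
    exact h1
  exact key _ _ h2

lemma isGluing {M : (P1 K).Modules} (hM : SheafOfModules.IsQuasicoherent M) :
    IsGluing (restrictSections M (inf_le_left : P1.chart K 0 ⊓ P1.chart K 1 ≤ P1.chart K 0))
      (restrictSections M (inf_le_right : P1.chart K 0 ⊓ P1.chart K 1 ≤ P1.chart K 1))
      (smulSections M (fres inf_le_left (coord K 0)))
      (smulSections M (fres inf_le_right (coord K 1))) where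
  uv z := by
    change (fres inf_le_left (coord K 0) : Γ(P1 K, P1.chart K 0 ⊓ P1.chart K 1)) •
      (fres inf_le_right (coord K 1) : Γ(P1 K, P1.chart K 0 ⊓ P1.chart K 1)) • z = z
    rw [smul_smul, fres_coord_mul, one_smul]
  vu z := by
    change (fres inf_le_right (coord K 1) : Γ(P1 K, P1.chart K 0 ⊓ P1.chart K 1)) •
      (fres inf_le_left (coord K 0) : Γ(P1 K, P1.chart K 0 ⊓ P1.chart K 1)) • z = z
    rw [smul_smul, mul_comm, fres_coord_mul, one_smul]
  map₀ x := by
    rw [poly_smul_def, polyToChart_X]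
    exact res_smul M _ _ _
  map₁ x := by
    rw [poly_smul_def, polyToChart_X]
    exact res_smul M _ _ _
  loc₀ z := by
    obtain ⟨n, t, ht⟩ := (isLocalizingAt_overlap hM 0 inf_le_left).exists_res_eq z
    exact ⟨n, t, by rw [smulSections_pow]; exact ht⟩
  loc₁ z := by
    obtain ⟨n, t, ht⟩ := (isLocalizingAt_overlap hM 1 inf_le_right).exists_res_eq z
    exact ⟨n, t, by rw [smulSections_pow]; exact ht⟩
  ker₀ x hx := by
    obtain ⟨n, hn⟩ := (isLocalizingAt_overlap hM 0 inf_le_left).exists_smul_eq_zero x hx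
    exact ⟨n, by rw [poly_smul_def, map_pow, polyToChart_X]; exact hn⟩
  ker₁ x hx := by
    obtain ⟨n, hn⟩ := (isLocalizingAt_overlap hM 1 inf_le_right).exists_smul_eq_zero x hx
    exact ⟨n, by rw [poly_smul_def, map_pow, polyToChart_X]; exact hn⟩

lemma cech_apply (M : (P1 K).Modules) (p : Γ(M, P1.chart K 0) × Γ(M, P1.chart K 1)) :
    cech M p = restrictSections M inf_le_right p.2 - restrictSections M inf_le_left p.1 := rfl

lemma finite_ker_cech {M : (P1 K).Modules} (hM : IsCoherent M) :
    Module.Finite K (LinearMap.ker (cech M)) := by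
  have := finite_polyModule hM 0
  have := finite_polyModule hM 1
  exact Module.Finite.iff_fg.2 ((isGluing hM.1).kernel_fg _ fun p hp => by
    rw [LinearMap.mem_ker, cech_apply, sub_eq_zero] at hp
    exact hp.symm)

lemma range_cech (M : (P1 K).Modules) : LinearMap.range (cech M) =
    LinearMap.range (restrictSections M inf_le_left) ⊔
      LinearMap.range (restrictSections M inf_le_right) := by
  apply le_antisymm
  · rintro _ ⟨p, rfl⟩
    rw [cech_apply]
    exact sub_mem (Submodule.mem_sup_right ⟨_, rfl⟩) (Submodule.mem_sup_left ⟨_, rfl⟩)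
  · refine sup_le ?_ ?_
    · rintro _ ⟨x, rfl⟩
      exact ⟨(-x, 0), by rw [cech_apply]; simp⟩
    · rintro _ ⟨x, rfl⟩
      exact ⟨(0, x), by rw [cech_apply]; simp⟩

lemma finite_coker_cech {M : (P1 K).Modules} (hM : IsCoherent M) :
    Module.Finite K (Γ(M, P1.chart K 0 ⊓ P1.chart K 1) ⧸ LinearMap.range (cech M)) := by
  have := finite_polyModule hM 0
  obtain ⟨s, hs, h⟩ := (isGluing hM.1).cokernel_finite
  rw [← range_cech] at h
  refine ⟨Submodule.fg_def.2 ⟨(LinearMap.range (cech M)).mkQ '' s, hs.image _, ?_⟩⟩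
  have h2 := congr_arg (Submodule.map (LinearMap.range (cech M)).mkQ) h
  rwa [Submodule.map_sup, Submodule.mkQ_map_self, bot_sup_eq, Submodule.map_top,
    Submodule.range_mkQ, Submodule.map_span] at h2

/-- The action of a morphism on sections, linear over the ground field. -/
def appK {M N : (P1 K).Modules} (φ : M ⟶ N) (U : (P1 K).Opens) : Γ(M, U) →ₗ[K] Γ(N, U) where
  toFun := appL φ U
  map_add' := map_add _
  map_smul' _ _ := (appL φ U).map_smul _ _

/-- The action of a morphism on the Čech cochains of degree zero. -/
def appProd {M N : (P1 K).Modules} (φ : M ⟶ N) :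
    (Γ(M, P1.chart K 0) × Γ(M, P1.chart K 1)) →ₗ[K] (Γ(N, P1.chart K 0) × Γ(N, P1.chart K 1)) :=
  (appK φ _).prodMap (appK φ _)

lemma appK_comp_cech {M N : (P1 K).Modules} (φ : M ⟶ N) :
    appK φ _ ∘ₗ cech M = cech N ∘ₗ appProd φ := by
  refine LinearMap.ext fun p => ?_
  rw [LinearMap.comp_apply, LinearMap.comp_apply, cech_apply, cech_apply, map_sub]
  exact congr_arg₂ (· - ·) (appL_res φ inf_le_right p.2) (appL_res φ inf_le_left p.1)

lemma exact_appL {S : ShortComplex (P1 K).Modules} (hS : S.ShortExact) (U : (P1 K).Opens) :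
    Function.Exact (appL S.f U) (appL S.g U) := fun z => by
  have := hS.mono_f
  constructor
  · exact exists_of_exact hS.exact U z
  · rintro ⟨x, rfl⟩
    rw [← appL_comp, S.zero, appL_zero]

/-- The charts and their overlap are affine, so the Čech complexes form a short exact sequence, to
which additivity of the index applies. -/
lemma eulerChar_add {S : ShortComplex (P1 K).Modules} (hS : S.ShortExact)
    (h₁ : IsCoherent S.X₁) (h₂ : IsCoherent S.X₂) :
    eulerChar S.X₂ = eulerChar S.X₁ + eulerChar S.X₃ := by
  have := hS.mono_f
  have h₃ := isCoherent_of_quotient hS h₁ h₂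
  have := finite_ker_cech h₂
  have := finite_ker_cech h₃
  have := finite_coker_cech h₁
  have := finite_coker_cech h₂
  refine index_add (cech S.X₁) (cech S.X₂) (cech S.X₃) (appProd S.f) (appProd S.g)
    (appK S.f _) (appK S.g _) ?_ ?_ ?_ ?_ ?_ ?_ (appK_comp_cech _) (appK_comp_cech _)
  · rintro ⟨x, y⟩
    constructor
    · intro h
      obtain ⟨a, ha⟩ := exists_of_exact hS.exact _ x (congr_arg Prod.fst h)
      obtain ⟨b, hb⟩ := exists_of_exact hS.exact _ y (congr_arg Prod.snd h)
      exact ⟨(a, b), Prod.ext ha hb⟩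
    · rintro ⟨⟨a, b⟩, h⟩
      rw [← h]
      exact Prod.ext ((exact_appL hS _ _).2 ⟨a, rfl⟩) ((exact_appL hS _ _).2 ⟨b, rfl⟩)
  · exact Function.Injective.prodMap (appL_injective_of_mono S.f _) (appL_injective_of_mono S.f _)
  · exact Function.Surjective.prodMap (appL_surjective hS h₁.1 (isAffineOpen_chart K 0))
      (appL_surjective hS h₁.1 (isAffineOpen_chart K 1))
  · exact exact_appL hS _
  · exact appL_injective_of_mono S.f _
  · exact appL_surjective hS h₁.1 (isAffineOpen_overlap K)

lemma rank_add {S : ShortComplex (P1 K).Modules} (hS : S.ShortExact)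
    (h₁ : IsCoherent S.X₁) (h₂ : IsCoherent S.X₂) :
    rank S.X₂ = rank S.X₁ + rank S.X₃ := by
  have := hS.mono_f
  have := h₂.2 _ (isAffineOpen_chart K 0)
  have r := Submodule.finrank_quotient_add_finrank (LinearMap.ker (appL S.g (P1.chart K 0)))
  rw [(appL S.g (P1.chart K 0)).quotKerEquivRange.finrank_eq,
    LinearMap.range_eq_top.2 (appL_surjective hS h₁.1 (isAffineOpen_chart K 0)), finrank_top,
    LinearMap.exact_iff.1 (exact_appL hS _),
    LinearMap.finrank_range_of_inj (appL_injective_of_mono S.f _)] at r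
  unfold rank
  omega

lemma sheafClass_add {S : ShortComplex (P1 K).Modules} (hS : S.ShortExact)
    (h₁ : IsCoherent S.X₁) (h₂ : IsCoherent S.X₂) :
    sheafClass S.X₂ = sheafClass S.X₁ + sheafClass S.X₃ := by
  have h1 := rank_add hS h₁ h₂
  have h2 := eulerChar_add hS h₁ h₂
  refine Prod.ext h1 ?_
  change eulerChar _ - rank _ = (eulerChar _ - rank _) + (eulerChar _ - rank _)
  omega

lemma section_eq_zero_of_isZero {X : Scheme.{0}} {M : X.Modules} (hM : IsZero M) {U : X.Opens}
    (s : Γ(M, U)) : s = 0 := by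
  have h1 : appL (𝟙 M) U s = 0 := by rw [hM.eq_of_src (𝟙 M) 0]; rfl
  exact h1

lemma sheafClass_of_isZero {M : (P1 K).Modules} (hM : IsZero M) : sheafClass M = 0 := by
  have h : ∀ U, Subsingleton Γ(M, U) := fun U => ⟨fun a b => by
    rw [section_eq_zero_of_isZero hM a, section_eq_zero_of_isZero hM b]⟩
  have h1 : rank M = 0 := by
    rw [rank, Module.finrank_zero_of_subsingleton]; rfl
  have h2 : eulerChar M = 0 := by
    have : Subsingleton (Γ(M, P1.chart K 0 ⊓ P1.chart K 1) ⧸ LinearMap.range (cech M)) :=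
      (Submodule.mkQ_surjective _).subsingleton
    rw [eulerChar, Module.finrank_zero_of_subsingleton, Module.finrank_zero_of_subsingleton]; rfl
  exact Prod.ext h1 (by change eulerChar M - rank M = 0; rw [h1, h2]; rfl)

lemma sheafClass_iso {M N : (P1 K).Modules} (e : M ≅ N) (hM : IsCoherent M) :
    sheafClass M = sheafClass N := by
  have h := sheafClass_add (monoSES_shortExact e.hom) hM (isCoherent_of_iso e hM)
  have h0 : sheafClass (monoSES e.hom).X₃ = 0 :=
    sheafClass_of_isZero (isZero_cokernel_of_epi e.hom)
  rw [h0, add_zero] at h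
  exact h.symm

lemma rank_nonneg (M : (P1 K).Modules) : 0 ≤ rank M := Int.natCast_nonneg _

lemma isZero_of_sections {M : (P1 K).Modules} (hM : SheafOfModules.IsQuasicoherent M)
    (h : ∀ i, ∀ s : Γ(M, P1.chart K i), s = 0) : IsZero M := by
  have hsec : ∀ (U : (P1 K).Opens) (s : Γ(M, U)), s = 0 := fun U s => by
    have key : ∀ x : U, ∃ V : (P1 K).Opens, ∃ hV : V ≤ U, x.1 ∈ V ∧ res M hV s = 0 := fun x => by
      obtain ⟨i, hi⟩ := Opens.mem_iSup.1 ((iSup_chart K).ge (Set.mem_univ x.1))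
      obtain ⟨f, hf, hx⟩ := (isAffineOpen_chart K i).exists_basicOpen_le x hi
      refine ⟨_, hf, hx, ?_⟩
      obtain ⟨n, t, ht⟩ := (isLocalizingAt_of_isQuasicoherent hM
        (isAffineOpen_chart K i) f).exists_res_eq (res M hf s)
      have hu : IsUnit (fres ((P1 K).basicOpen_le f) f) := RingedSpace.isUnit_res_basicOpen _ f
      rw [h i t, map_zero] at ht
      exact ((hu.pow n).smul_eq_zero.1 ht.symm)
    choose V hV hx hs using key
    refine eq_of_res_eq M V hV (fun x hx' => Opens.mem_iSup.2 ⟨⟨x, hx'⟩, hx _⟩) fun i => ?_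
    rw [hs, map_zero]
  rw [IsZero.iff_id_eq_zero]
  apply (Scheme.Modules.toPresheaf (P1 K)).map_injective
  refine NatTrans.ext (funext fun U => ?_)
  refine ConcreteCategory.hom_ext _ _ fun s => ?_
  exact (hsec U.unop s).trans (hsec U.unop _).symm

/-- A nonzero torsion sheaf has positive degree. -/
lemma degree_pos_of_rank_eq_zero {M : (P1 K).Modules} (hM : IsCoherent M) (h0 : ¬ IsZero M)
    (hr : (sheafClass M).1 = 0) : 0 < (sheafClass M).2 := by
  have := finite_polyModule hM 0
  have := finite_polyModule hM 1
  have hr : rank M = 0 := hr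
  have hfin := hM.2 _ (isAffineOpen_chart K 0)
  have htors : Module.IsTorsion K[X] Γ(M, P1.chart K 0) := by
    intro x
    have h1 := (Module.finrank_eq_zero_iff_isTorsion (R := Γ(P1 K, P1.chart K 0))
      (M := Γ(M, P1.chart K 0))).1 (Int.natCast_eq_zero.1 hr)
    obtain ⟨a, ha⟩ := h1 (x := x)
    obtain ⟨q, hq⟩ := polyToChart_surjective K 0 a.1
    refine ⟨⟨q, mem_nonZeroDivisors_of_ne_zero ?_⟩, ?_⟩
    · rintro rfl
      exact nonZeroDivisors.ne_zero a.2 (by rw [← hq, map_zero])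
    · change polyToChart K 0 q • x = 0
      rw [hq]
      exact ha
  have := finite_of_isTorsion (K := K) _ htors
  have hg := isGluing hM.1
  have s₀ := hg.surjective_of_finite_range
  have : Module.Finite K Γ(M, P1.chart K 0 ⊓ P1.chart K 1) := Module.Finite.of_surjective _ s₀
  have s₁ := hg.symm.surjective_of_finite_range
  have := finite_ker_cech hM
  have hc : Subsingleton (Γ(M, P1.chart K 0 ⊓ P1.chart K 1) ⧸ LinearMap.range (cech M)) := by
    rw [Submodule.Quotient.subsingleton_iff, range_cech, LinearMap.range_eq_top.2 s₀]
    exact top_sup_eq _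
  have hpos : 0 < Module.finrank K (LinearMap.ker (cech M)) := by
    by_contra hneg
    have hbot : LinearMap.ker (cech M) = ⊥ := Submodule.finrank_eq_zero.1 (by omega)
    -- Both restrictions to the overlap are surjective, so a section over one chart extends to a
    -- global section. If `H⁰` vanished, all sections over the charts would vanish.
    refine h0 (isZero_of_sections hM.1 (Fin.forall_fin_two.2 ⟨fun x => ?_, fun y => ?_⟩))
    · obtain ⟨y, hy⟩ := s₁ (restrictSections M inf_le_left x)
      have : (x, y) ∈ LinearMap.ker (cech M) := by
        rw [LinearMap.mem_ker, cech_apply, sub_eq_zero]; exact hy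
      rw [hbot, Submodule.mem_bot] at this
      exact congr_arg Prod.fst this
    · obtain ⟨x, hx⟩ := s₀ (restrictSections M inf_le_right y)
      have : (x, y) ∈ LinearMap.ker (cech M) := by
        rw [LinearMap.mem_ker, cech_apply, sub_eq_zero]; exact hx.symm
      rw [hbot, Submodule.mem_bot] at this
      exact congr_arg Prod.snd this
  have h1 : (sheafClass M).2 = eulerChar M - rank M := rfl
  rw [h1, hr, sub_zero, eulerChar, Module.finrank_zero_of_subsingleton (M := _ ⧸ _)]
  omega

/-- The Euler characteristics of subsheaves are bounded. -/
lemma eulerChar_le_of_mono {G M : (P1 K).Modules} (i : G ⟶ M) [Mono i] (hM : IsCoherent M) :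
    eulerChar G ≤ Module.finrank K (LinearMap.ker (cech M)) := by
  have := finite_ker_cech hM
  let φ : LinearMap.ker (cech G) →ₗ[K] LinearMap.ker (cech M) := (appProd i).restrict fun x hx => by
    rw [LinearMap.mem_ker, ← LinearMap.comp_apply, ← appK_comp_cech, LinearMap.comp_apply, hx,
      map_zero]
  have hφ : Function.Injective φ := fun x y hxy => Subtype.ext
    (Function.Injective.prodMap (appL_injective_of_mono i _) (appL_injective_of_mono i _)
      (congr_arg Subtype.val hxy))
  have := LinearMap.finrank_le_finrank_of_injective hφ
  unfold eulerChar
  omega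

end Cech

/-! ### Phases -/

section Phase

/-- Classes of nonzero coherent sheaves. -/
def IsPos (γ : ℤ × ℤ) : Prop := 0 < γ.1 ∨ (γ.1 = 0 ∧ 0 < γ.2)

lemma IsPos.add {γ γ' : ℤ × ℤ} (h : IsPos γ) (h' : IsPos γ') : IsPos (γ + γ') := by
  unfold IsPos at *
  rw [Prod.fst_add, Prod.snd_add]
  omega

lemma phase_of_fst_eq_zero {γ : ℤ × ℤ} (h : γ.1 = 0) (h' : 0 < γ.2) : phase γ = 1 / 2 := by
  have h1 : (⟨(γ.1 : ℝ), (γ.2 : ℝ)⟩ : ℂ) = ((γ.2 : ℝ) : ℂ) * Complex.I := by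
    apply Complex.ext <;> simp [h]
  rw [phase, h1, Complex.arg_real_mul _ (by exact_mod_cast h'), Complex.arg_I]
  field_simp

lemma phase_of_fst_pos {γ : ℤ × ℤ} (h : 0 < γ.1) :
    phase γ = Real.arctan (γ.2 / γ.1) / Real.pi := by
  have hr : (0 : ℝ) < γ.1 := by exact_mod_cast h
  have h1 : Complex.arg ⟨(γ.1 : ℝ), (γ.2 : ℝ)⟩ = Real.arctan (γ.2 / γ.1) := by
    have habs := Complex.abs_arg_lt_pi_div_two_iff.2
      (Or.inl (show 0 < (⟨(γ.1 : ℝ), (γ.2 : ℝ)⟩ : ℂ).re from hr))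
    rw [abs_lt] at habs
    rw [← Real.arctan_tan habs.1 habs.2, Complex.tan_arg]
  rw [phase, h1]

lemma neg_half_lt_phase {γ : ℤ × ℤ} (h : IsPos γ) : -(1 / 2) < phase γ := by
  rcases h with h | ⟨h, h'⟩
  · rw [phase_of_fst_pos h, lt_div_iff₀ Real.pi_pos]
    have := Real.neg_pi_div_two_lt_arctan ((γ.2 : ℝ) / γ.1)
    linarith
  · rw [phase_of_fst_eq_zero h h']
    norm_num

lemma phase_lt_half {γ : ℤ × ℤ} (h : 0 < γ.1) : phase γ < 1 / 2 := by
  rw [phase_of_fst_pos h, div_lt_iff₀ Real.pi_pos]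
  have := Real.arctan_lt_pi_div_two ((γ.2 : ℝ) / γ.1)
  linarith

lemma phase_le_half {γ : ℤ × ℤ} (h : IsPos γ) : phase γ ≤ 1 / 2 := by
  rcases h with h | ⟨h, h'⟩
  · exact (phase_lt_half h).le
  · exact (phase_of_fst_eq_zero h h').le

lemma IsPos.fst_pos_of_phase_lt {γ : ℤ × ℤ} (h : IsPos γ) (hp : phase γ < 1 / 2) : 0 < γ.1 := by
  rcases h with h | ⟨h, h'⟩
  · exact h
  · rw [phase_of_fst_eq_zero h h'] at hp
    exact absurd hp (lt_irrefl _)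

/-- In positive rank the phase is an increasing function of the slope; the cross-multiplied form
also covers rank zero, where the phase is maximal. -/
lemma phase_le_phase_iff {γ γ' : ℤ × ℤ} (h : IsPos γ) (h' : IsPos γ') :
    phase γ ≤ phase γ' ↔ γ.2 * γ'.1 ≤ γ'.2 * γ.1 := by
  rcases h with h | ⟨h, hd⟩ <;> rcases h' with h' | ⟨h', hd'⟩
  · rw [phase_of_fst_pos h, phase_of_fst_pos h', div_le_div_iff_of_pos_right Real.pi_pos,
      Real.arctan_strictMono.le_iff_le, div_le_div_iff₀ (by exact_mod_cast h) (by exact_mod_cast h')]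
    exact_mod_cast Iff.rfl
  · rw [phase_of_fst_eq_zero h' hd', h']
    have h1 : phase γ ≤ 1 / 2 := (phase_lt_half h).le
    have h2 : γ.2 * 0 ≤ γ'.2 * γ.1 := by rw [mul_zero]; positivity
    exact ⟨fun _ => h2, fun _ => h1⟩
  · rw [phase_of_fst_eq_zero h hd, h]
    have h1 := phase_lt_half h'
    have h2 : 0 < γ.2 * γ'.1 := by positivity
    constructor
    · intro h3; linarith
    · intro h3; rw [mul_zero] at h3; linarith
  · rw [phase_of_fst_eq_zero h hd, phase_of_fst_eq_zero h' hd', h, h']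
    simp

lemma phase_lt_phase_iff {γ γ' : ℤ × ℤ} (h : IsPos γ) (h' : IsPos γ') :
    phase γ < phase γ' ↔ γ.2 * γ'.1 < γ'.2 * γ.1 := by
  rw [← not_le, phase_le_phase_iff h' h, not_le]

/-- The seesaw property: the phase of a sum lies between those of its summands. -/
lemma phase_le_phase_add_iff {γ γ' : ℤ × ℤ} (h : IsPos γ) (h' : IsPos γ') :
    phase γ ≤ phase (γ + γ') ↔ phase γ ≤ phase γ' := by
  rw [phase_le_phase_iff h (h.add h'), phase_le_phase_iff h h', Prod.fst_add, Prod.snd_add,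
    mul_add, add_mul]
  constructor <;> intro <;> linarith

lemma phase_add_le_phase_iff {γ γ' : ℤ × ℤ} (h : IsPos γ) (h' : IsPos γ') :
    phase (γ + γ') ≤ phase γ ↔ phase γ' ≤ phase γ := by
  rw [phase_le_phase_iff (h.add h') h, phase_le_phase_iff h' h, Prod.fst_add, Prod.snd_add,
    mul_add, add_mul]
  constructor <;> intro <;> linarith

lemma lt_phase_add {γ γ' : ℤ × ℤ} (h : IsPos γ) (h' : IsPos γ') {x : ℝ} (hx : x < phase γ)
    (hx' : x < phase γ') : x < phase (γ + γ') := by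
  rcases le_total (phase γ) (phase γ') with hle | hle
  · exact hx.trans_le ((phase_le_phase_add_iff h h').2 hle)
  · rw [add_comm]
    exact hx'.trans_le ((phase_le_phase_add_iff h' h).2 hle)

lemma phase_add_le {γ γ' : ℤ × ℤ} (h : IsPos γ) (h' : IsPos γ') {x : ℝ} (hx : phase γ ≤ x)
    (hx' : phase γ' ≤ x) : phase (γ + γ') ≤ x := by
  rcases le_total (phase γ) (phase γ') with hle | hle
  · rw [add_comm]
    exact ((phase_add_le_phase_iff h' h).2 hle).trans hx'
  · exact ((phase_add_le_phase_iff h h').2 hle).trans hx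

/-- The class of `𝒪(-n)`. -/
def negClass (n : ℕ) : ℤ × ℤ := (1, -n)

lemma isPos_negClass (n : ℕ) : IsPos (negClass n) := Or.inl one_pos

lemma phase_negClass (n : ℕ) : phase (negClass n) = nu n - 1 := by
  rw [phase_of_fst_pos (show 0 < (negClass n).1 from one_pos), nu]
  simp [negClass, Real.arctan_neg, neg_div]

lemma snd_le_of_phase_le {γ : ℤ × ℤ} (h : IsPos γ) {n : ℕ} (hp : phase γ ≤ nu n - 1) :
    γ.2 ≤ -n * γ.1 := by
  rw [← phase_negClass, phase_le_phase_iff h (isPos_negClass n)] at hp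
  simpa [negClass] using hp

lemma lt_phase_of_lt_snd {γ : ℤ × ℤ} (h : IsPos γ) {n : ℕ} (hp : -n * γ.1 < γ.2) :
    nu n - 1 < phase γ := by
  rw [← phase_negClass, phase_lt_phase_iff (isPos_negClass n) h]
  simpa [negClass] using hp

lemma le_snd_of_le_phase {γ : ℤ × ℤ} (h : IsPos γ) {n : ℕ} (hp : nu n - 1 ≤ phase γ) :
    -n * γ.1 ≤ γ.2 := by
  rw [← phase_negClass, phase_le_phase_iff (isPos_negClass n) h] at hp
  simpa [negClass] using hp

lemma half_lt_nu (n : ℕ) : 1 / 2 < nu n := by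
  have h := Real.arctan_lt_pi_div_two n
  rw [nu]
  have : Real.arctan n / Real.pi < 1 / 2 := by
    rw [div_lt_iff₀ Real.pi_pos]; linarith
  linarith

lemma nu_le_one (n : ℕ) : nu n ≤ 1 := by
  have h : 0 ≤ Real.arctan n := Real.arctan_nonneg.2 (Nat.cast_nonneg n)
  rw [nu]
  have := div_nonneg h Real.pi_pos.le
  linarith

lemma nu_antitone {m n : ℕ} (h : m ≤ n) : nu n ≤ nu m := by
  have : Real.arctan m ≤ Real.arctan n := Real.arctan_strictMono.monotone (by exact_mod_cast h)
  have := div_le_div_of_nonneg_right this Real.pi_pos.le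
  rw [nu, nu]
  linarith

lemma exists_nu_le {x : ℝ} (hx : 1 / 2 < x) : ∃ n : ℕ, nu n ≤ x := by
  have h : Filter.Tendsto nu Filter.atTop (nhds (1 - Real.pi / 2 / Real.pi)) :=
    (((Real.tendsto_arctan_atTop.mono_right nhdsWithin_le_nhds).comp
      tendsto_natCast_atTop_atTop).div_const _).const_sub _
  have h2 : 1 - Real.pi / 2 / Real.pi = 1 / 2 := by
    have := Real.pi_ne_zero
    field_simp; norm_num
  rw [h2] at h
  exact (h.eventually (ge_mem_nhds hx)).exists

end Phase

/-! ### The torsion pairs given by the phase -/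

section TorsionPair

variable {K : Type} [Field K]

lemma isPos_sheafClass {M : (P1 K).Modules} (hM : IsCoherent M) (h0 : ¬ IsZero M) :
    IsPos (sheafClass M) := by
  rcases (rank_nonneg M).lt_or_eq with h | h
  · exact Or.inl h
  · exact Or.inr ⟨h.symm, degree_pos_of_rank_eq_zero hM h0 h.symm⟩

lemma IsPos.not_isZero {M : (P1 K).Modules} (h : IsPos (sheafClass M)) : ¬ IsZero M := fun h0 => by
  rw [sheafClass_of_isZero h0] at h
  simp [IsPos] at h

/-- Coherent sheaves all of whose nonzero quotients have phase bigger than `μ`. -/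
structure InT (μ : ℝ) (M : (P1 K).Modules) : Prop where
  coh : IsCoherent M
  lt_phase : ∀ (Q : (P1 K).Modules) (p : M ⟶ Q), Epi p → IsCoherent Q → ¬ IsZero Q →
    μ < phase (sheafClass Q)

/-- Coherent sheaves all of whose nonzero subsheaves have phase at most `μ`. -/
structure InF (μ : ℝ) (M : (P1 K).Modules) : Prop where
  coh : IsCoherent M
  phase_le : ∀ (G : (P1 K).Modules) (i : G ⟶ M), Mono i → IsCoherent G → ¬ IsZero G →
    phase (sheafClass G) ≤ μ

lemma InT.of_isZero {μ : ℝ} {M : (P1 K).Modules} (h : IsZero M) : InT μ M :=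
  ⟨isCoherent_of_isZero h, fun _ p _ _ hQ => absurd (IsZero.of_epi p h) hQ⟩

lemma InF.of_isZero {μ : ℝ} {M : (P1 K).Modules} (h : IsZero M) : InF μ M :=
  ⟨isCoherent_of_isZero h, fun _ i _ _ hG => absurd (IsZero.of_mono i h) hG⟩

lemma InT.of_epi {μ : ℝ} {M N : (P1 K).Modules} (h : InT μ M) (p : M ⟶ N) [Epi p]
    (hN : IsCoherent N) : InT μ N :=
  ⟨hN, fun Q q _ hQ h0 => h.lt_phase Q (p ≫ q) (epi_comp _ _) hQ h0⟩

lemma InF.of_mono {μ : ℝ} {M N : (P1 K).Modules} (h : InF μ M) (i : N ⟶ M) [Mono i]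
    (hN : IsCoherent N) : InF μ N :=
  ⟨hN, fun G j _ hG h0 => h.phase_le G (j ≫ i) (mono_comp _ _) hG h0⟩

lemma InT.of_iso {μ : ℝ} {M N : (P1 K).Modules} (h : InT μ M) (e : M ≅ N) : InT μ N :=
  h.of_epi e.hom (isCoherent_of_iso e h.coh)

lemma InF.of_iso {μ : ℝ} {M N : (P1 K).Modules} (h : InF μ M) (e : M ≅ N) : InF μ N :=
  h.of_mono e.inv (isCoherent_of_iso e h.coh)

/-- The image is a quotient of `M` and a subsheaf of `N`; if nonzero, its phase would be both `> μ`
and `≤ μ`. -/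
lemma InT.hom_eq_zero {μ : ℝ} {M N : (P1 K).Modules} (hM : InT μ M) (hN : InF μ N) (f : M ⟶ N) :
    f = 0 := by
  have hI := isCoherent_image f hM.coh hN.coh
  have h0 : IsZero (Abelian.image f) := by
    by_contra h0
    have h1 := hM.lt_phase _ (Abelian.factorThruImage f) inferInstance hI h0
    have h2 := hN.phase_le _ (Abelian.image.ι f) inferInstance hI h0
    exact absurd h1 (not_lt.2 h2)
  rw [← Abelian.image.fac f, h0.eq_of_tgt (Abelian.factorThruImage f) 0, zero_comp]

/-- A quotient `Q` of the middle term is an extension of a quotient of `S.X₃` by the image of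
`S.X₁`, and the seesaw property bounds its phase. -/
lemma InT.of_extension {μ : ℝ} {S : ShortComplex (P1 K).Modules} (hS : S.ShortExact)
    (h₁ : InT μ S.X₁) (h₃ : InT μ S.X₃) : InT μ S.X₂ := by
  have h₂ := isCoherent_of_extension hS h₁.coh h₃.coh
  refine ⟨h₂, fun Q p hp hQ h0 => ?_⟩
  let f := S.f ≫ p
  have hI : IsCoherent (Abelian.image f) := isCoherent_image f h₁.coh hQ
  have hC : IsCoherent (cokernel (Abelian.image.ι f)) := isCoherent_cokernel _ hI hQ
  have hcl : sheafClass Q = sheafClass (Abelian.image f) +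
      sheafClass (cokernel (Abelian.image.ι f)) :=
    sheafClass_add (monoSES_shortExact (Abelian.image.ι f)) hI hQ
  have := hS.epi_g
  have hz : S.f ≫ p ≫ cokernel.π (Abelian.image.ι f) = 0 := by
    rw [← Category.assoc]
    have h1 : (Abelian.factorThruImage f ≫ Abelian.image.ι f) ≫
        cokernel.π (Abelian.image.ι f) = 0 := by
      rw [Category.assoc, cokernel.condition, comp_zero]
    rwa [Abelian.image.fac f] at h1
  let q : S.X₃ ⟶ cokernel (Abelian.image.ι f) := hS.exact.desc _ hz
  have hq : S.g ≫ q = p ≫ cokernel.π (Abelian.image.ι f) := hS.exact.g_desc _ hz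
  have : Epi (S.g ≫ q) := by rw [hq]; exact epi_comp _ _
  have : Epi q := epi_of_epi S.g q
  by_cases hI0 : IsZero (Abelian.image f)
  · rw [hcl, sheafClass_of_isZero hI0, zero_add]
    refine h₃.lt_phase _ q inferInstance hC fun hC0 => ?_
    have hpos := isPos_sheafClass hQ h0
    rw [hcl, sheafClass_of_isZero hI0, sheafClass_of_isZero hC0] at hpos
    simp [IsPos] at hpos
  · have h1 := h₁.lt_phase _ (Abelian.factorThruImage f) inferInstance hI hI0
    by_cases hC0 : IsZero (cokernel (Abelian.image.ι f))
    · rw [hcl, sheafClass_of_isZero hC0, add_zero]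
      exact h1
    · rw [hcl]
      exact lt_phase_add (isPos_sheafClass hI hI0) (isPos_sheafClass hC hC0) h1
        (h₃.lt_phase _ q inferInstance hC hC0)

lemma InF.of_extension {μ : ℝ} {S : ShortComplex (P1 K).Modules} (hS : S.ShortExact)
    (h₁ : InF μ S.X₁) (h₃ : InF μ S.X₃) : InF μ S.X₂ := by
  have h₂ := isCoherent_of_extension hS h₁.coh h₃.coh
  refine ⟨h₂, fun G i hi hG h0 => ?_⟩
  let f := i ≫ S.g
  have hI : IsCoherent (Abelian.image f) := isCoherent_image f hG h₃.coh
  have hN : IsCoherent (kernel f) := isCoherent_kernel f hG h₃.coh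
  have hcl : sheafClass G = sheafClass (kernel f) + sheafClass (Abelian.coimage f) :=
    sheafClass_add (monoSES_shortExact (kernel.ι f)) hN hG
  rw [← sheafClass_iso (Abelian.coimageIsoImage f).symm hI] at hcl
  have := hS.mono_f
  have hz : (kernel.ι f ≫ i) ≫ S.g = 0 := by rw [Category.assoc, kernel.condition]
  let j : kernel f ⟶ S.X₁ := hS.exact.lift _ hz
  have hj : j ≫ S.f = kernel.ι f ≫ i := hS.exact.lift_f _ hz
  have : Mono (j ≫ S.f) := by rw [hj]; exact mono_comp _ _
  have : Mono j := mono_of_mono j S.f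
  by_cases hI0 : IsZero (Abelian.image f)
  · rw [hcl, sheafClass_of_isZero hI0, add_zero]
    refine h₁.phase_le _ j inferInstance hN fun hN0 => ?_
    have hpos := isPos_sheafClass hG h0
    rw [hcl, sheafClass_of_isZero hI0, sheafClass_of_isZero hN0] at hpos
    simp [IsPos] at hpos
  · have h1 := h₃.phase_le _ (Abelian.image.ι f) inferInstance hI hI0
    by_cases hN0 : IsZero (kernel f)
    · rw [hcl, sheafClass_of_isZero hN0, zero_add]
      exact h1
    · rw [hcl]
      exact phase_add_le (isPos_sheafClass hN hN0) (isPos_sheafClass hI hI0)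
        (h₁.phase_le _ j inferInstance hN hN0) h1

lemma IsSemistable.inF {μ : ℝ} {M : (P1 K).Modules} (h : IsSemistable M)
    (hμ : phase (sheafClass M) ≤ μ) : InF μ M :=
  ⟨h.1, fun G i hi hG h0 => (h.2.2 G i hG hi h0).trans hμ⟩

lemma IsSemistable.le_phase {M Q : (P1 K).Modules} (h : IsSemistable M) (p : M ⟶ Q) [Epi p]
    (hQ : IsCoherent Q) (h0 : ¬ IsZero Q) : phase (sheafClass M) ≤ phase (sheafClass Q) := by
  have hN := isCoherent_kernel p h.1 hQ
  have hcl : sheafClass M = sheafClass (kernel p) + sheafClass Q :=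
    sheafClass_add (epiSES_shortExact p) hN h.1
  by_cases hN0 : IsZero (kernel p)
  · rw [hcl, sheafClass_of_isZero hN0, zero_add]
  · have h1 := h.2.2 _ (kernel.ι p) hN inferInstance hN0
    have hp := isPos_sheafClass hN hN0
    have hq := isPos_sheafClass hQ h0
    rw [hcl, phase_le_phase_add_iff hp hq] at h1
    rw [hcl, add_comm]
    exact (phase_add_le_phase_iff hq hp).2 h1

lemma IsSemistable.inT {μ : ℝ} {M : (P1 K).Modules} (h : IsSemistable M)
    (hμ : μ < phase (sheafClass M)) : InT μ M :=
  ⟨h.1, fun _ p _ hQ h0 => hμ.trans_le (h.le_phase p hQ h0)⟩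

lemma isSemistable_of_le_phase {M : (P1 K).Modules} (hM : IsCoherent M) (h0 : ¬ IsZero M)
    (h : ∀ (Q : (P1 K).Modules) (p : M ⟶ Q), Epi p → IsCoherent Q → ¬ IsZero Q →
      phase (sheafClass M) ≤ phase (sheafClass Q)) : IsSemistable M := by
  refine ⟨hM, h0, fun G i hG _ hG0 => ?_⟩
  have hC := isCoherent_cokernel i hG hM
  have hcl : sheafClass M = sheafClass G + sheafClass (cokernel i) :=
    sheafClass_add (monoSES_shortExact i) hG hM
  by_cases hC0 : IsZero (cokernel i)
  · rw [hcl, sheafClass_of_isZero hC0, add_zero]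
  · have h1 := h _ (cokernel.π i) inferInstance hC hC0
    have hg := isPos_sheafClass hG hG0
    have hc := isPos_sheafClass hC hC0
    rw [hcl, add_comm, phase_add_le_phase_iff hc hg] at h1
    · rw [hcl]
      exact (phase_le_phase_add_iff hg hc).2 h1

lemma degree_le_of_mono {M : (P1 K).Modules} (hM : IsCoherent M) :
    ∃ B : ℤ, ∀ (G : (P1 K).Modules) (i : G ⟶ M), Mono i → (sheafClass G).2 ≤ B := by
  refine ⟨Module.finrank K (LinearMap.ker (cech M)), fun G i _ => ?_⟩
  have h1 := eulerChar_le_of_mono i hM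
  have h2 := rank_nonneg G
  change eulerChar G - rank G ≤ _
  omega

lemma fst_le_of_epi {Q M : (P1 K).Modules} (p : M ⟶ Q) [Epi p] (hQ : IsCoherent Q)
    (hM : IsCoherent M) : (sheafClass Q).1 ≤ (sheafClass M).1 := by
  have hcl : sheafClass M = sheafClass (kernel p) + sheafClass Q :=
    sheafClass_add (epiSES_shortExact p) (isCoherent_kernel p hM hQ) hM
  have := rank_nonneg (kernel p)
  rw [hcl, Prod.fst_add]
  change _ ≤ rank (kernel p) + _
  omega

/-- The minimal destabilizing quotient. -/
lemma exists_min_quotient {M : (P1 K).Modules} (hM : IsCoherent M) (hr : 0 < (sheafClass M).1) :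
    ∃ (Q : (P1 K).Modules) (p : M ⟶ Q), Epi p ∧ IsSemistable Q ∧ 0 < (sheafClass Q).1 ∧
      (∀ (Q' : (P1 K).Modules) (p' : M ⟶ Q'), Epi p' → IsCoherent Q' → ¬ IsZero Q' →
        phase (sheafClass Q) ≤ phase (sheafClass Q')) ∧
      InT (phase (sheafClass Q)) (kernel p) := by
  have hM0 : ¬ IsZero M := IsPos.not_isZero (Or.inl hr)
  obtain ⟨B, hB⟩ := degree_le_of_mono hM
  let V : Set (ℤ × ℤ) := {γ | 0 < γ.1 ∧ phase γ ≤ phase (sheafClass M) ∧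
    ∃ (Q : (P1 K).Modules) (p : M ⟶ Q), Epi p ∧ IsCoherent Q ∧ sheafClass Q = γ}
  have hfin : V.Finite := by
    -- The degree of a quotient is bounded below since its kernel has degree at most `B`, and above
    -- since its phase is at most that of `M`.
    refine ((Set.finite_Icc 1 (sheafClass M).1).prod (Set.finite_Icc ((sheafClass M).2 - B)
      (|(sheafClass M).2| * (sheafClass M).1))).subset ?_
    rintro γ ⟨h1, h2, Q, p, hp, hQ, rfl⟩
    have hcl : sheafClass M = sheafClass (kernel p) + sheafClass Q :=
      sheafClass_add (epiSES_shortExact p) (isCoherent_kernel p hM hQ) hM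
    have hk := hB _ (kernel.ι p) inferInstance
    have hle := fst_le_of_epi p hQ hM
    have h3 := congr_arg Prod.snd hcl
    rw [Prod.snd_add] at h3
    rw [phase_le_phase_iff (Or.inl h1) (Or.inl hr)] at h2
    refine ⟨⟨h1, hle⟩, by omega, ?_⟩
    have habs := le_abs_self (sheafClass M).2
    have habs0 := abs_nonneg (sheafClass M).2
    rcases le_or_gt (sheafClass Q).2 0 with h4 | h4
    · exact h4.trans (mul_nonneg habs0 hr.le)
    · calc (sheafClass Q).2 ≤ (sheafClass Q).2 * (sheafClass M).1 :=
            le_mul_of_one_le_right h4.le hr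
        _ ≤ (sheafClass M).2 * (sheafClass Q).1 := h2
        _ ≤ |(sheafClass M).2| * (sheafClass Q).1 := by gcongr
        _ ≤ |(sheafClass M).2| * (sheafClass M).1 := by gcongr
  have hMV : sheafClass M ∈ V := ⟨hr, le_rfl, M, 𝟙 M, inferInstance, hM, rfl⟩
  -- Minimal phase first and then, through the sign, maximal rank. If `kernel p` had a quotient `Q'`
  -- of phase at most that of `Q`, then `M / kernel q` would have class `[Q] + [Q']`, hence no
  -- larger phase and larger rank.
  obtain ⟨γ, ⟨hγ1, hγ2, Q, p, hp, hQ, hQγ⟩, hmin⟩ := Set.exists_min_image V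
    (fun γ => toLex (phase γ, -γ.1)) hfin ⟨_, hMV⟩
  subst hQγ
  have hQ0 : ¬ IsZero Q := IsPos.not_isZero (Or.inl hγ1)
  have hQpos := isPos_sheafClass hQ hQ0
  have hleast : ∀ (Q' : (P1 K).Modules) (p' : M ⟶ Q'), Epi p' → IsCoherent Q' → ¬ IsZero Q' →
      phase (sheafClass Q) ≤ phase (sheafClass Q') := fun Q' p' hp' hQ' h0' => by
    rcases isPos_sheafClass hQ' h0' with h | ⟨h, h'⟩
    · rcases le_or_gt (phase (sheafClass Q')) (phase (sheafClass M)) with hle | hlt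
      · have := hmin _ ⟨h, hle, Q', p', hp', hQ', rfl⟩
        rw [Prod.Lex.toLex_le_toLex] at this
        rcases this with h1 | h1
        · exact h1.le
        · exact h1.1.le
      · exact hγ2.trans hlt.le
    · rw [phase_of_fst_eq_zero h h']
      exact phase_le_half hQpos
  refine ⟨Q, p, hp, isSemistable_of_le_phase hQ hQ0 fun Q' q hq hQ' h0' =>
    hleast Q' (p ≫ q) (epi_comp _ _) hQ' h0', hγ1, hleast, isCoherent_kernel p hM hQ,
    fun Q' q hq hQ' h0' => ?_⟩
  by_contra! hle
  have hN := isCoherent_kernel q (isCoherent_kernel p hM hQ) hQ'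
  let i : kernel q ⟶ M := kernel.ι q ≫ kernel.ι p
  have hC := isCoherent_cokernel i hN hM
  have e1 : sheafClass M = sheafClass (kernel p) + sheafClass Q :=
    sheafClass_add (epiSES_shortExact p) (isCoherent_kernel p hM hQ) hM
  have e2 : sheafClass (kernel p) = sheafClass (kernel q) + sheafClass Q' :=
    sheafClass_add (epiSES_shortExact q) hN (isCoherent_kernel p hM hQ)
  have e3 : sheafClass M = sheafClass (kernel q) + sheafClass (cokernel i) :=
    sheafClass_add (monoSES_shortExact i) hN hM
  have e4 : sheafClass (cokernel i) = sheafClass Q + sheafClass Q' := by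
    rw [e1, e2, add_assoc] at e3
    rw [← add_left_cancel e3, add_comm]
  have hQ'pos := isPos_sheafClass hQ' h0'
  have hQ'1 := hQ'pos.fst_pos_of_phase_lt (hle.trans_lt (phase_lt_half hγ1))
  have hph : phase (sheafClass (cokernel i)) ≤ phase (sheafClass Q) := by
    rw [e4]
    exact (phase_add_le_phase_iff hQpos hQ'pos).2 hle
  have h1 : (sheafClass (cokernel i)).1 = (sheafClass Q).1 + (sheafClass Q').1 := by
    rw [e4, Prod.fst_add]
  have := hmin _ ⟨by omega, hph.trans hγ2, cokernel i, cokernel.π i, inferInstance, hC, rfl⟩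
  rw [Prod.Lex.toLex_le_toLex] at this
  rcases this with h2 | ⟨-, h2⟩
  · exact absurd h2 (not_lt.2 hph)
  · simp only at h2
    omega

/-- Torsion sheaves have the maximal phase. -/
lemma InT.of_fst_eq_zero {μ : ℝ} (hμ : μ < 1 / 2) {M : (P1 K).Modules} (hM : IsCoherent M)
    (h : (sheafClass M).1 = 0) : InT μ M :=
  ⟨hM, fun Q p _ hQ h0 => by
    have h1 := fst_le_of_epi p hQ hM
    rcases isPos_sheafClass hQ h0 with h2 | ⟨h2, h3⟩
    · omega
    · rwa [phase_of_fst_eq_zero h2 h3]⟩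

/-- For subobjects `N ⊆ M' ⊆ M` the short exact sequence
`0 → M'/N → M/N → M/M' → 0`. -/
lemma cokernel_comp_shortExact {C : Type*} [Category* C] [Abelian C] {N M Q : C} (p : M ⟶ Q)
    [Epi p] (i : N ⟶ kernel p) [Mono i] :
    (ShortComplex.mk (cokernel.map i (i ≫ kernel.ι p) (𝟙 _) (kernel.ι p) (by simp))
      (cokernel.desc (i ≫ kernel.ι p) p (by simp))
      (by rw [← cancel_epi (cokernel.π i)]; simp)).ShortExact := by
  have hepi : Epi (cokernel.desc (i ≫ kernel.ι p) p (by simp)) := by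
    have : Epi (cokernel.π (i ≫ kernel.ι p) ≫ cokernel.desc (i ≫ kernel.ι p) p (by simp)) := by
      rw [cokernel.π_desc]; infer_instance
    exact epi_of_epi (cokernel.π (i ≫ kernel.ι p)) _
  have hmono : Mono (cokernel.map i (i ≫ kernel.ι p) (𝟙 _) (kernel.ι p) (by simp)) := by
    rw [Preadditive.mono_iff_cancel_zero]
    intro A x hx
    obtain ⟨A', π, hπ, y, hy⟩ := surjective_up_to_refinements_of_epi (cokernel.π i) x
    have h1 : (y ≫ kernel.ι p) ≫ cokernel.π (i ≫ kernel.ι p) = 0 := by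
      have h2 : π ≫ x ≫ cokernel.map i (i ≫ kernel.ι p) (𝟙 _) (kernel.ι p) (by simp) = 0 := by
        rw [hx, comp_zero]
      rw [← Category.assoc, hy, Category.assoc] at h2
      simpa using h2
    have : Mono (monoSES (i ≫ kernel.ι p)).f := inferInstanceAs (Mono (i ≫ kernel.ι p))
    let z : A' ⟶ N := (monoSES_shortExact (i ≫ kernel.ι p)).exact.lift _ h1
    have hz : z ≫ i ≫ kernel.ι p = y ≫ kernel.ι p :=
      (monoSES_shortExact (i ≫ kernel.ι p)).exact.lift_f _ h1
    rw [← Category.assoc, cancel_mono] at hz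
    rw [← cancel_epi π, hy, ← hz, Category.assoc, cokernel.condition, comp_zero, comp_zero]
  refine ⟨ShortComplex.exact_of_g_is_cokernel _ (CokernelCofork.IsColimit.ofπ' _ _ fun {A} t ht => ?_)⟩
  have : Epi (epiSES p).g := inferInstanceAs (Epi p)
  have h3 : kernel.ι p ≫ cokernel.π (i ≫ kernel.ι p) ≫ t = 0 := by
    have := congr_arg (cokernel.π i ≫ ·) ht
    simpa using this
  refine ⟨(epiSES_shortExact p).exact.desc (cokernel.π (i ≫ kernel.ι p) ≫ t) h3, ?_⟩
  rw [← cancel_epi (cokernel.π (i ≫ kernel.ι p)), ← Category.assoc]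
  exact (congr_arg (· ≫ _) (cokernel.π_desc (i ≫ kernel.ι p) p (by simp))).trans
    ((epiSES_shortExact p).exact.g_desc _ h3)

/-- The torsion pair attached to a phase. -/
lemma exists_torsionPair_sequence {μ : ℝ} (hμ : μ < 1 / 2) {M : (P1 K).Modules}
    (hM : IsCoherent M) :
    ∃ (N : (P1 K).Modules) (i : N ⟶ M), Mono i ∧ InT μ N ∧ InF μ (cokernel i) := by
  induction hn : (sheafClass M).1.toNat using Nat.strong_induction_on generalizing M with
  | _ n ih =>
    by_cases hT : InT μ M
    · exact ⟨M, 𝟙 M, inferInstance, hT, InF.of_isZero (isZero_cokernel_of_epi (𝟙 M))⟩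
    have hr : 0 < (sheafClass M).1 := by
      refine (rank_nonneg M).lt_of_ne fun h => hT (InT.of_fst_eq_zero hμ hM h.symm)
    obtain ⟨Q, p, hp, hss, hQ1, hleast, -⟩ := exists_min_quotient hM hr
    have hk := isCoherent_kernel p hM hss.1
    have hQμ : phase (sheafClass Q) ≤ μ := by
      by_contra! hlt
      exact hT ⟨hM, fun Q' p' hp' hQ' h0' => hlt.trans_le (hleast Q' p' hp' hQ' h0')⟩
    have e1 : sheafClass M = sheafClass (kernel p) + sheafClass Q :=
      sheafClass_add (epiSES_shortExact p) hk hM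
    have e2 := congr_arg Prod.fst e1
    rw [Prod.fst_add] at e2
    obtain ⟨N, i, hi, hN, hF⟩ := ih _ (by omega) hk rfl
    refine ⟨N, i ≫ kernel.ι p, mono_comp _ _, hN, ?_⟩
    exact InF.of_extension (cokernel_comp_shortExact p i) hF (hss.inF hQμ)

end TorsionPair

/-! ### Harder–Narasimhan filtrations in the derived category -/

section HarderNarasimhan

open Pretriangulated

variable {K : Type} [Field K]

/-- A sheaf, as an object of the derived category. -/
abbrev sh (M : (P1 K).Modules) : DP1 K := (DerivedCategory.singleFunctor (P1 K).Modules 0).obj M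

/-- A morphism of sheaves, as a morphism of the derived category. -/
abbrev shMap {M N : (P1 K).Modules} (f : M ⟶ N) : sh M ⟶ sh N :=
  (DerivedCategory.singleFunctor (P1 K).Modules 0).map f

/-- The cohomology sheaves of an object of the derived category. -/
abbrev coho (i : ℤ) (E : DP1 K) : (P1 K).Modules :=
  (DerivedCategory.homologyFunctor (P1 K).Modules i).obj E

theorem distinguished_of_iso {C : Type*} [Category* C] [HasZeroObject C] [HasShift C ℤ]
    [Preadditive C] [∀ n : ℤ, (shiftFunctor C n).Additive] [Pretriangulated C]
    {A E B A' E' B' : C} {f : A ⟶ E} {g : E ⟶ B} {h : B ⟶ A⟦(1 : ℤ)⟧}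
    {f' : A' ⟶ E'} {g' : E' ⟶ B'} {h' : B' ⟶ A'⟦(1 : ℤ)⟧}
    (hT : Triangle.mk f g h ∈ distTriang C) (a : A ≅ A') (b : E ≅ E') (c : B ≅ B')
    (h₁ : f ≫ b.hom = a.hom ≫ f') (h₂ : g ≫ c.hom = b.hom ≫ g')
    (h₃ : h ≫ a.hom⟦(1 : ℤ)⟧' = c.hom ≫ h') : Triangle.mk f' g' h' ∈ distTriang C :=
  isomorphic_distinguished _ hT _ (Triangle.isoMk _ _ a b c h₁ h₂ h₃).symm

theorem HasHN.of_iso {ℓ : List ℝ} {E E' : DP1 K} (h : HasHN ℓ E) (e : E ≅ E') : HasHN ℓ E' := by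
  cases h with
  | zero E h0 => exact HasHN.zero _ (h0.of_iso e.symm)
  | cons φ ℓ T hT h₁ h₃ hlt =>
    refine HasHN.cons φ ℓ (Triangle.mk (T.mor₁ ≫ e.hom) (e.inv ≫ T.mor₂) T.mor₃) ?_ h₁ h₃ hlt
    exact distinguished_of_iso (f := T.mor₁) (g := T.mor₂) (h := T.mor₃) hT (Iso.refl _) e
      (Iso.refl _) (by simp) (by simp) (by simp)

/-- An extension of two objects whose Harder–Narasimhan phases are separated. -/
theorem HasHN.concat {ℓ₁ ℓ₃ : List ℝ} {B : DP1 K} (hB : HasHN ℓ₃ B) :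
    ∀ {A E : DP1 K} {f : A ⟶ E} {g : E ⟶ B} {h : B ⟶ A⟦(1 : ℤ)⟧}
      (_ : Triangle.mk f g h ∈ distTriang (DP1 K)) (_ : HasHN ℓ₁ A)
      (_ : ∀ φ ∈ ℓ₃, ∀ ψ ∈ ℓ₁, φ < ψ), HasHN (ℓ₃ ++ ℓ₁) E := by
  induction hB with
  | zero B h0 =>
    intro A E f g h hT hA _
    have : IsIso f := (Triangle.isZero₃_iff_isIso₁ _ hT).1 h0
    exact hA.of_iso (asIso f)
  | cons φ ℓ T hT' h₁ h₃ hlt ih =>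
    intro A E f g h hT hA hsep
    -- The factor of `B` of smallest phase is peeled off `E`; by the octahedral axiom what remains,
    -- `Z`, is an extension of the rest of `B` by `A`.
    obtain ⟨Z, v, w, hZ⟩ := distinguished_cocone_triangle₁ (g ≫ T.mor₂)
    have o := Triangulated.someOctahedron' rfl hT (v₂₃ := T.mor₁) (w₂₃ := T.mor₃) hT' hZ
    refine HasHN.cons φ (ℓ ++ ℓ₁) (Triangle.mk v (g ≫ T.mor₂) w) hZ
      (ih o.mem hA fun φ' h' ψ hψ => hsep φ' (List.mem_cons_of_mem _ h') ψ hψ) h₃ ?_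
    intro ψ hψ
    rcases List.mem_append.1 hψ with hψ | hψ
    · exact hlt ψ hψ
    · exact hsep φ List.mem_cons_self ψ hψ

theorem IsSlice.shift {φ : ℝ} {E : DP1 K} (h : IsSlice φ E) (n : ℤ) : IsSlice (φ + n) (E⟦n⟧) := by
  obtain ⟨F, m, hF, rfl, ⟨e⟩⟩ := h
  refine ⟨F, m + n, hF, by push_cast; ring, ⟨?_⟩⟩
  exact (shiftFunctor (DP1 K) n).mapIso e ≪≫ ((shiftFunctorAdd (DP1 K) m n).app (sh F)).symm

theorem HasHN.shift {ℓ : List ℝ} {E : DP1 K} (h : HasHN ℓ E) (n : ℤ) :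
    HasHN (ℓ.map (· + (n : ℝ))) (E⟦n⟧) := by
  induction h with
  | zero E h0 => exact HasHN.zero _ ((shiftFunctor (DP1 K) n).map_isZero h0)
  | cons φ ℓ T hT h₁ h₃ hlt ih =>
    refine HasHN.cons (φ + n) _ ((shiftFunctor (Triangle (DP1 K)) n).obj T)
      (Triangle.shift_distinguished _ hT n) ih (h₃.shift n) ?_
    intro ψ hψ
    obtain ⟨ψ', h', rfl⟩ := List.mem_map.1 hψ
    have := hlt ψ' h'
    simpa using this

theorem HasHN.of_slice {φ : ℝ} {E : DP1 K} (h : IsSlice φ E) : HasHN [φ] E :=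
  HasHN.cons φ [] _ (contractible_distinguished₁ E) (HasHN.zero _ (isZero_zero _)) h (by simp)

theorem IsSemistable.isSlice {F : (P1 K).Modules} (h : IsSemistable F) :
    IsSlice (phase (sheafClass F)) (sh F) :=
  ⟨F, 0, h, by simp, ⟨((shiftFunctorZero (DP1 K) ℤ).app (sh F)).symm⟩⟩

theorem isZero_sh {M : (P1 K).Modules} (h : IsZero M) : IsZero (sh M) :=
  (DerivedCategory.singleFunctor (P1 K).Modules 0).map_isZero h

/-- The Harder–Narasimhan filtration of a coherent sheaf. Each phase lies between the phase of
a quotient and the phase of a subsheaf. -/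
theorem exists_hasHN_sh {M : (P1 K).Modules} (hM : IsCoherent M) :
    ∃ ℓ : List ℝ, HasHN ℓ (sh M) ∧ ∀ φ ∈ ℓ,
      (∃ (Q : (P1 K).Modules) (p : M ⟶ Q), Epi p ∧ IsCoherent Q ∧ ¬ IsZero Q ∧
        phase (sheafClass Q) ≤ φ) ∧
      ∃ (G : (P1 K).Modules) (i : G ⟶ M), Mono i ∧ IsCoherent G ∧ ¬ IsZero G ∧
        φ ≤ phase (sheafClass G) := by
  induction hn : (sheafClass M).1.toNat using Nat.strong_induction_on generalizing M with
  | _ n ih =>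
    by_cases h0 : IsZero M
    · exact ⟨[], HasHN.zero _ (isZero_sh h0), by simp⟩
    by_cases hr : (sheafClass M).1 = 0
    -- A nonzero torsion sheaf is semistable: all its nonzero quotients have phase larger than every
    -- `μ < 1/2`.
    · have hss : IsSemistable M := isSemistable_of_le_phase hM h0 fun Q p hp hQ hQ0 =>
        (phase_le_half (isPos_sheafClass hM h0)).trans
          (le_of_forall_lt fun μ hμ => (InT.of_fst_eq_zero hμ hM hr).lt_phase Q p hp hQ hQ0)
      refine ⟨_, HasHN.of_slice hss.isSlice, fun φ hφ => ?_⟩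
      obtain rfl := List.mem_singleton.1 hφ
      exact ⟨⟨M, 𝟙 M, inferInstance, hM, h0, le_rfl⟩, ⟨M, 𝟙 M, inferInstance, hM, h0, le_rfl⟩⟩
    · have hr' : 0 < (sheafClass M).1 := (rank_nonneg M).lt_of_ne (Ne.symm hr)
      obtain ⟨Q, p, hp, hss, hQ1, hleast, hT⟩ := exists_min_quotient hM hr'
      have hk := isCoherent_kernel p hM hss.1
      have e1 : sheafClass M = sheafClass (kernel p) + sheafClass Q :=
        sheafClass_add (epiSES_shortExact p) hk hM
      have e2 := congr_arg Prod.fst e1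
      rw [Prod.fst_add] at e2
      have hk0 := rank_nonneg (kernel p)
      obtain ⟨ℓ, hℓ, hb⟩ := ih _ (by omega) hk rfl
      refine ⟨phase (sheafClass Q) :: ℓ, HasHN.cons _ _ _
        (epiSES_shortExact p).singleTriangle_distinguished hℓ hss.isSlice ?_, ?_⟩
      · intro ψ hψ
        obtain ⟨⟨Q', q, hq, hQ', h0', hle⟩, -⟩ := hb ψ hψ
        exact (hT.lt_phase Q' q hq hQ' h0').trans_le hle
      · intro φ hφ
        rcases List.mem_cons.1 hφ with rfl | hφ
        · exact ⟨⟨Q, p, hp, hss.1, hss.2.1, le_rfl⟩, ⟨M, 𝟙 M, inferInstance, hM, h0,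
            hleast M (𝟙 M) inferInstance hM h0⟩⟩
        · obtain ⟨⟨Q', q, hq, hQ', h0', hle⟩, G, i, hi, hG, hG0, hGle⟩ := hb φ hφ
          exact ⟨⟨Q, p, hp, hss.1, hss.2.1, ((hT.lt_phase Q' q hq hQ' h0').trans_le hle).le⟩,
            ⟨G, i ≫ kernel.ι p, mono_comp _ _, hG, hG0, hGle⟩⟩

theorem InT.hasHN {μ : ℝ} {M : (P1 K).Modules} (h : InT μ M) :
    ∃ ℓ : List ℝ, HasHN ℓ (sh M) ∧ ∀ φ ∈ ℓ, μ < φ ∧ φ ≤ 1 / 2 := by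
  obtain ⟨ℓ, hℓ, hb⟩ := exists_hasHN_sh h.coh
  refine ⟨ℓ, hℓ, fun φ hφ => ?_⟩
  obtain ⟨⟨Q, p, hp, hQ, h0, hle⟩, G, -, -, hGc, hG0, hG⟩ := hb φ hφ
  exact ⟨(h.lt_phase Q p hp hQ h0).trans_le hle, hG.trans (phase_le_half (isPos_sheafClass hGc hG0))⟩

theorem InF.hasHN {μ : ℝ} {M : (P1 K).Modules} (h : InF μ M) :
    ∃ ℓ : List ℝ, HasHN ℓ (sh M) ∧ ∀ φ ∈ ℓ, -(1 / 2) < φ ∧ φ ≤ μ := by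
  obtain ⟨ℓ, hℓ, hb⟩ := exists_hasHN_sh h.coh
  refine ⟨ℓ, hℓ, fun φ hφ => ?_⟩
  obtain ⟨⟨Q, p, hp, hQ, h0, hle⟩, G, i, hi, hG, hG0, hGle⟩ := hb φ hφ
  exact ⟨(neg_half_lt_phase (isPos_sheafClass hQ h0)).trans_le hle,
    hGle.trans (h.phase_le G i hi hG hG0)⟩

/-- An extension of a sheaf of `T` by the shift of a sheaf of `F` lies in the tilted heart. -/
theorem heart_of_triangle {ν : ℝ} (hν : 1 / 2 ≤ ν) (hν' : ν ≤ 1) {N M : (P1 K).Modules}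
    (hN : InF (ν - 1) N) (hM : InT (ν - 1) M) {E : DP1 K} {f : (sh N)⟦(1 : ℤ)⟧ ⟶ E}
    {g : E ⟶ sh M} {h : sh M ⟶ (sh N)⟦(1 : ℤ)⟧⟦(1 : ℤ)⟧}
    (hT : Triangle.mk f g h ∈ distTriang (DP1 K)) : heart K ν E := by
  obtain ⟨ℓ₁, h₁, hb₁⟩ := hN.hasHN
  obtain ⟨ℓ₃, h₃, hb₃⟩ := hM.hasHN
  -- After the shift these phases exceed `1/2`, the largest phase of a sheaf, so the two filtrations
  -- can be concatenated.
  have key : ∀ φ ∈ ℓ₁.map (· + ((1 : ℤ) : ℝ)), 1 / 2 < φ ∧ φ ≤ ν := by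
    intro φ hφ
    obtain ⟨ψ, hψ, rfl⟩ := List.mem_map.1 hφ
    obtain ⟨h1, h2⟩ := hb₁ ψ hψ
    constructor <;> push_cast <;> linarith
  refine ⟨_, h₃.concat hT (h₁.shift 1) fun φ hφ ψ hψ => (hb₃ φ hφ).2.trans_lt (key ψ hψ).1, ?_⟩
  intro φ hφ
  rcases List.mem_append.1 hφ with hφ | hφ
  · exact ⟨(hb₃ φ hφ).1, (hb₃ φ hφ).2.trans hν⟩
  · exact ⟨by linarith [(key φ hφ).1], (key φ hφ).2⟩

end HarderNarasimhan

/-! ### The hearts as tilts of the category of coherent sheaves -/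

section Tilt

open Pretriangulated DerivedCategory

section Abelian

variable {C : Type*} [Category* C] [Abelian C] {W X Y Z : C}

lemma shortExact_kernel_lift {f : W ⟶ X} {g : X ⟶ Y} {d : Y ⟶ Z} {w : f ≫ g = 0} {w' : g ≫ d = 0}
    [Mono f] (h : (ShortComplex.mk f g w).Exact) (h' : (ShortComplex.mk g d w').Exact) :
    (ShortComplex.mk f (kernel.lift d g w')
      (by rw [← cancel_mono (kernel.ι d)]; simp [w])).ShortExact := by
  let S₁ := ShortComplex.mk f (kernel.lift d g w')
    (by rw [← cancel_mono (kernel.ι d)]; simp [w])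
  let φ : S₁ ⟶ ShortComplex.mk f g w :=
    { τ₁ := 𝟙 _, τ₂ := 𝟙 _, τ₃ := kernel.ι d, comm₁₂ := by simp [S₁], comm₂₃ := by simp [S₁] }
  have h1 : Epi φ.τ₁ := inferInstanceAs (Epi (𝟙 _))
  have h2 : IsIso φ.τ₂ := inferInstanceAs (IsIso (𝟙 _))
  have h3 : Mono φ.τ₃ := inferInstanceAs (Mono (kernel.ι d))
  have : Epi (kernel.lift d g w') := (ShortComplex.exact_iff_epi_kernel_lift _).1 h'
  exact ⟨(ShortComplex.exact_iff_of_epi_of_isIso_of_mono φ).2 h⟩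

lemma shortExact_cokernel_desc {f : W ⟶ X} {g : X ⟶ Y} {d : Y ⟶ Z} {w : f ≫ g = 0}
    {w' : g ≫ d = 0} [Epi d] (h : (ShortComplex.mk f g w).Exact)
    (h' : (ShortComplex.mk g d w').Exact) :
    (ShortComplex.mk (cokernel.desc f g w) d
      (by rw [← cancel_epi (cokernel.π f)]; simp [w'])).ShortExact := by
  let S₂ := ShortComplex.mk (cokernel.desc f g w) d
    (by rw [← cancel_epi (cokernel.π f)]; simp [w'])
  let φ : ShortComplex.mk g d w' ⟶ S₂ :=
    { τ₁ := cokernel.π f, τ₂ := 𝟙 _, τ₃ := 𝟙 _, comm₁₂ := by simp [S₂], comm₂₃ := by simp [S₂] }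
  have h1 : Epi φ.τ₁ := inferInstanceAs (Epi (cokernel.π f))
  have h2 : IsIso φ.τ₂ := inferInstanceAs (IsIso (𝟙 _))
  have h3 : Mono φ.τ₃ := inferInstanceAs (Mono (𝟙 _))
  have : Mono (cokernel.desc f g w) := (ShortComplex.exact_iff_mono_cokernel_desc _).1 h
  exact ⟨(ShortComplex.exact_iff_of_epi_of_isIso_of_mono φ).1 h'⟩

end Abelian

variable {K : Type} [Field K]

/-- The action on `H⁰` of a morphism of the derived category. -/
abbrev cohoMap {E F : DP1 K} (f : E ⟶ F) : coho 0 E ⟶ coho 0 F :=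
  (homologyFunctor (P1 K).Modules 0).map f

/-- The cohomology of the shift. -/
def cohoShiftIso (E : DP1 K) (n a b : ℤ) (h : n + a = b) : coho a (E⟦n⟧) ≅ coho b E :=
  ((homologyFunctor (P1 K).Modules 0).shiftIso n a b h).app E

/-- The cohomology of a sheaf in degree `0`. -/
def cohoShIso (M : (P1 K).Modules) : coho 0 (sh M) ≅ M :=
  (singleFunctorCompHomologyFunctorIso (P1 K).Modules 0).app M

lemma cohoMap_shMap {M N : (P1 K).Modules} (f : M ⟶ N) :
    cohoMap (shMap f) = (cohoShIso M).hom ≫ f ≫ (cohoShIso N).inv := by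
  rw [← Category.assoc, Iso.eq_comp_inv]
  exact (singleFunctorCompHomologyFunctorIso (P1 K).Modules 0).hom.naturality f

/-- Objects of the derived category which are concentrated in degree `0`. -/
def IsSheaf (E : DP1 K) : Prop := ∀ i : ℤ, i ≠ 0 → IsZero (coho i E)

lemma isSheaf_sh (M : (P1 K).Modules) : IsSheaf (sh M) := by
  intro i hi
  rcases hi.lt_or_gt with h | h
  · exact isZero_of_isGE (sh M) 0 i h
  · exact isZero_of_isLE (sh M) 0 i h

lemma IsSheaf.of_iso {E F : DP1 K} (h : IsSheaf E) (e : E ≅ F) : IsSheaf F := fun i hi =>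
  (h i hi).of_iso ((homologyFunctor (P1 K).Modules i).mapIso e.symm)

lemma IsSheaf.exists_iso {E : DP1 K} (h : IsSheaf E) : Nonempty (E ≅ sh (coho 0 E)) := by
  have : E.IsGE 0 := (isGE_iff E 0).2 fun i hi => h i hi.ne
  have : E.IsLE 0 := (isLE_iff E 0).2 fun i hi => h i hi.ne'
  obtain ⟨M, ⟨e⟩⟩ := exists_iso_singleFunctor_obj_of_isGE_of_isLE E 0
  exact ⟨e ≪≫ (singleFunctor (P1 K).Modules 0).mapIso
    ((cohoShIso M).symm ≪≫ (homologyFunctor (P1 K).Modules 0).mapIso e.symm)⟩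

lemma IsSheaf.hom_ext {E F : DP1 K} (hE : IsSheaf E) (hF : IsSheaf F) {f g : E ⟶ F}
    (h : cohoMap f = cohoMap g) : f = g := by
  obtain ⟨e⟩ := hE.exists_iso
  obtain ⟨e'⟩ := hF.exists_iso
  obtain ⟨a, ha⟩ := (singleFunctor (P1 K).Modules 0).map_surjective (e.inv ≫ f ≫ e'.hom)
  obtain ⟨b, hb⟩ := (singleFunctor (P1 K).Modules 0).map_surjective (e.inv ≫ g ≫ e'.hom)
  have h1 : cohoMap (shMap a) = cohoMap (shMap b) := by
    rw [shMap, shMap, ha, hb]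
    simp only [cohoMap, Functor.map_comp] at h ⊢
    rw [h]
  rw [cohoMap_shMap, cohoMap_shMap, cancel_epi, cancel_mono] at h1
  rw [← cancel_epi e.inv, ← cancel_mono e'.hom, Category.assoc, Category.assoc, ← ha, ← hb, h1]

lemma IsSheaf.exists_map {E F : DP1 K} (hE : IsSheaf E) (hF : IsSheaf F)
    (φ : coho 0 E ⟶ coho 0 F) : ∃ f : E ⟶ F, cohoMap f = φ := by
  obtain ⟨e⟩ := hE.exists_iso
  obtain ⟨e'⟩ := hF.exists_iso
  let a := (homologyFunctor (P1 K).Modules 0).mapIso e ≪≫ cohoShIso (coho 0 E)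
  let b := (homologyFunctor (P1 K).Modules 0).mapIso e' ≪≫ cohoShIso (coho 0 F)
  refine ⟨e.hom ≫ shMap (a.inv ≫ φ ≫ b.hom) ≫ e'.inv, ?_⟩
  have h1 : cohoMap (e.hom ≫ shMap (a.inv ≫ φ ≫ b.hom) ≫ e'.inv) =
      a.hom ≫ (a.inv ≫ φ ≫ b.hom) ≫ b.inv := by
    have h2 : cohoMap (e.hom ≫ shMap (a.inv ≫ φ ≫ b.hom) ≫ e'.inv) =
        cohoMap e.hom ≫ cohoMap (shMap (a.inv ≫ φ ≫ b.hom)) ≫ cohoMap e'.inv := by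
      simp only [cohoMap, Functor.map_comp]
    rw [h2, cohoMap_shMap]
    simp [a, b]
  rw [h1]
  simp

section Triangle

variable {T : Triangle (DP1 K)} (hT : T ∈ distTriang (DP1 K))
include hT

lemma isZero_coho₂ {i : ℤ} (h₁ : IsZero (coho i T.obj₁)) (h₃ : IsZero (coho i T.obj₃)) :
    IsZero (coho i T.obj₂) :=
  (HomologySequence.exact₂ T hT i).isZero_of_both_isZero h₁ h₃

lemma isZero_coho₃ {i j : ℤ} (hij : i + 1 = j) (h₂ : IsZero (coho i T.obj₂))
    (h₁ : IsZero (coho j T.obj₁)) : IsZero (coho i T.obj₃) :=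
  (HomologySequence.exact₃ T hT i j hij).isZero_of_both_isZero h₂ h₁

lemma isZero_coho₁ {i j : ℤ} (hij : i + 1 = j) (h₃ : IsZero (coho i T.obj₃))
    (h₂ : IsZero (coho j T.obj₂)) : IsZero (coho j T.obj₁) :=
  (HomologySequence.exact₁ T hT i j hij).isZero_of_both_isZero h₃ h₂

end Triangle

/-- The tilt of the category of coherent sheaves at the torsion pair of slope `μ`. -/
structure InD (μ : ℝ) (E : DP1 K) : Prop where
  isZero : ∀ i : ℤ, i ≠ 0 → i ≠ -1 → IsZero (coho i E)
  inT : InT μ (coho 0 E)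
  inF : InF μ (coho (-1) E)

lemma InD.of_iso {μ : ℝ} {E F : DP1 K} (h : InD μ E) (e : E ≅ F) : InD μ F :=
  ⟨fun i h0 h1 => (h.isZero i h0 h1).of_iso ((homologyFunctor (P1 K).Modules i).mapIso e.symm),
    h.inT.of_iso ((homologyFunctor (P1 K).Modules 0).mapIso e),
    h.inF.of_iso ((homologyFunctor (P1 K).Modules (-1)).mapIso e)⟩

lemma InD.of_isZero {μ : ℝ} {E : DP1 K} (h : IsZero E) : InD μ E :=
  ⟨fun i _ _ => (homologyFunctor (P1 K).Modules i).map_isZero h,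
    InT.of_isZero ((homologyFunctor (P1 K).Modules 0).map_isZero h),
    InF.of_isZero ((homologyFunctor (P1 K).Modules (-1)).map_isZero h)⟩

lemma IsSheaf.inD {μ : ℝ} {E : DP1 K} (h : IsSheaf E) (hT : InT μ (coho 0 E)) : InD μ E :=
  ⟨fun i h0 _ => h i h0, hT, InF.of_isZero (h (-1) (by decide))⟩

lemma InD.isSheaf {μ : ℝ} {E : DP1 K} (h : InD μ E) (h0 : IsZero (coho (-1) E)) : IsSheaf E := by
  intro i hi
  by_cases h1 : i = -1
  · rwa [h1]
  · exact h.isZero i hi h1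

/-- With `δ` the connecting map from `H⁻¹(T.obj₃)` to `H⁰(T.obj₁)`, `H⁰` of the middle term is an
extension of `H⁰(T.obj₃)` by `coker δ`, and `H⁻¹` is an extension of `ker δ` by `H⁻¹(T.obj₁)`; the
closure properties of `T` and `F` apply. -/
lemma InD.of_triangle {μ : ℝ} {T : Triangle (DP1 K)} (hT : T ∈ distTriang (DP1 K))
    (h₁ : InD μ T.obj₁) (h₃ : InD μ T.obj₃) : InD μ T.obj₂ := by
  have hk := isCoherent_kernel (HomologySequence.δ T (-1) 0 (by decide)) h₃.inF.coh h₁.inT.coh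
  have hc := isCoherent_cokernel (HomologySequence.δ T (-1) 0 (by decide)) h₃.inF.coh h₁.inT.coh
  refine ⟨fun i h0 h1 => isZero_coho₂ hT (h₁.isZero i h0 h1) (h₃.isZero i h0 h1), ?_, ?_⟩
  · have : Epi ((homologyFunctor (P1 K).Modules 0).map T.mor₂) :=
      (HomologySequence.epi_homologyMap_mor₂_iff T hT 0 1 (by decide)).2
        ((h₁.isZero 1 (by decide) (by decide)).eq_of_tgt _ _)
    exact InT.of_extension (shortExact_cokernel_desc
      (HomologySequence.exact₁ T hT (-1) 0 (by decide)) (HomologySequence.exact₂ T hT 0))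
      (h₁.inT.of_epi (cokernel.π _) hc) h₃.inT
  · have : Mono ((homologyFunctor (P1 K).Modules (-1)).map T.mor₁) :=
      (HomologySequence.mono_homologyMap_mor₁_iff T hT (-2) (-1) (by decide)).2
        ((h₃.isZero (-2) (by decide) (by decide)).eq_of_src _ _)
    exact InF.of_extension (shortExact_kernel_lift
      (HomologySequence.exact₂ T hT (-1)) (HomologySequence.exact₃ T hT (-1) 0 (by decide)))
      h₁.inF (h₃.inF.of_mono (kernel.ι _) hk)

lemma InT.inD_sh {μ : ℝ} {M : (P1 K).Modules} (h : InT μ M) : InD μ (sh M) :=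
  (isSheaf_sh M).inD (h.of_iso (cohoShIso M).symm)

lemma InF.inD_shift {μ : ℝ} {M : (P1 K).Modules} (h : InF μ M) : InD μ ((sh M)⟦(1 : ℤ)⟧) :=
  ⟨fun i _ h1 => (isSheaf_sh M (1 + i) (by omega)).of_iso (cohoShiftIso (sh M) 1 i (1 + i) rfl),
    InT.of_isZero ((isSheaf_sh M 1 (by decide)).of_iso (cohoShiftIso (sh M) 1 0 1 rfl)),
    h.of_iso ((cohoShIso M).symm ≪≫ (cohoShiftIso (sh M) 1 (-1) 0 rfl).symm)⟩

/-- Sheaf phases lie in `]-1/2, 1/2]`, which leaves only the shifts `0` (a semistable sheaf in `T`)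
and `1` (one in `F`). -/
lemma IsSlice.inD {μ : ℝ} (h : -(1 / 2) ≤ μ) (h' : μ ≤ 0) {φ : ℝ} (hφ : φ ∈ Set.Ioc μ (μ + 1))
    {E : DP1 K} (hE : IsSlice φ E) : InD μ E := by
  obtain ⟨F, m, hF, rfl, ⟨e⟩⟩ := hE
  have hpos := isPos_sheafClass hF.1 hF.2.1
  have h1 := neg_half_lt_phase hpos
  have h2 := phase_le_half hpos
  have hm0 : -1 < m := by
    have : ((-1 : ℤ) : ℝ) < m := by push_cast; linarith [hφ.1]
    exact_mod_cast this
  have hm1 : m < 2 := by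
    have : (m : ℝ) < (2 : ℤ) := by push_cast; linarith [hφ.2]
    exact_mod_cast this
  obtain rfl | rfl : m = 0 ∨ m = 1 := by omega
  · refine InD.of_iso (hF.inT ?_).inD_sh ((shiftFunctorZero (DP1 K) ℤ).symm.app (sh F) ≪≫ e.symm)
    simpa using hφ.1
  · refine InD.of_iso (hF.inF ?_).inD_shift e.symm
    have := hφ.2
    push_cast at this
    linarith

lemma HasHN.inD {μ : ℝ} (h : -(1 / 2) ≤ μ) (h' : μ ≤ 0) {ℓ : List ℝ} {E : DP1 K}
    (hE : HasHN ℓ E) (hℓ : ∀ φ ∈ ℓ, φ ∈ Set.Ioc μ (μ + 1)) : InD μ E := by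
  induction hE with
  | zero E h0 => exact InD.of_isZero h0
  | cons φ ℓ T hT h₁ h₃ hlt ih =>
    exact InD.of_triangle hT (ih fun ψ hψ => hℓ ψ (List.mem_cons_of_mem _ hψ))
      (h₃.inD h h' (hℓ φ List.mem_cons_self))

/-- This is the truncation triangle: its ends are concentrated in degrees `-1` and `0`. -/
lemma InD.exists_triangle {μ : ℝ} {E : DP1 K} (h : InD μ E) :
    ∃ (N M : (P1 K).Modules) (f : (sh N)⟦(1 : ℤ)⟧ ⟶ E) (g : E ⟶ sh M)
      (d : sh M ⟶ (sh N)⟦(1 : ℤ)⟧⟦(1 : ℤ)⟧),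
      InF μ N ∧ InT μ M ∧ Triangle.mk f g d ∈ distTriang (DP1 K) := by
  obtain ⟨A, B, hA, hB, f, g, d, hT⟩ := TStructure.t.exists_triangle E (-1) 0 (by decide)
  have hA : A.IsLE (-1) := ⟨hA⟩
  have hB : B.IsGE 0 := ⟨hB⟩
  have hA' : A.IsGE (-1) := (isGE_iff A (-1)).2 fun i hi =>
    isZero_coho₁ hT (i := i - 1) (by omega) (isZero_of_isGE B 0 (i - 1) (by omega))
      (h.isZero i (by omega) (by omega))
  have hB' : B.IsLE 0 := (isLE_iff B 0).2 fun i hi =>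
    isZero_coho₃ hT (j := i + 1) rfl (h.isZero i (by omega) (by omega))
      (isZero_of_isLE A (-1) (i + 1) (by omega))
  have hBs : IsSheaf B := by
    intro i hi
    rcases hi.lt_or_gt with hi | hi
    · exact isZero_of_isGE B 0 i hi
    · exact isZero_of_isLE B 0 i hi
  have hf : IsIso ((homologyFunctor (P1 K).Modules (-1)).map f) := by
    have h1 : Epi ((homologyFunctor (P1 K).Modules (-1)).map f) :=
      (HomologySequence.epi_homologyMap_mor₁_iff _ hT (-1)).2
        ((hBs (-1) (by decide)).eq_of_tgt _ _)
    have h2 : Mono ((homologyFunctor (P1 K).Modules (-1)).map f) :=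
      (HomologySequence.mono_homologyMap_mor₁_iff _ hT (-2) (-1) (by decide)).2
        ((hBs (-2) (by decide)).eq_of_src _ _)
    exact isIso_of_mono_of_epi _
  have hg : IsIso ((homologyFunctor (P1 K).Modules 0).map g) := by
    have h1 : Epi ((homologyFunctor (P1 K).Modules 0).map g) :=
      (HomologySequence.epi_homologyMap_mor₂_iff _ hT 0 1 (by decide)).2
        ((isZero_of_isLE A (-1) 1 (by decide)).eq_of_tgt _ _)
    have h2 : Mono ((homologyFunctor (P1 K).Modules 0).map g) :=
      (HomologySequence.mono_homologyMap_mor₂_iff _ hT 0).2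
        ((isZero_of_isLE A (-1) 0 (by decide)).eq_of_src _ _)
    exact isIso_of_mono_of_epi _
  obtain ⟨N, ⟨eN⟩⟩ := exists_iso_singleFunctor_obj_of_isGE_of_isLE A (-1)
  obtain ⟨eB⟩ := hBs.exists_iso
  let eA : A ≅ (sh N)⟦(1 : ℤ)⟧ :=
    eN ≪≫ ((singleFunctors (P1 K).Modules).shiftIso 1 (-1) 0 (by decide)).symm.app N
  refine ⟨N, coho 0 B, eA.inv ≫ f, g ≫ eB.hom, eB.inv ≫ d ≫ eA.hom⟦(1 : ℤ)⟧', ?_,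
    h.inT.of_iso (asIso ((homologyFunctor (P1 K).Modules 0).map g)),
    distinguished_of_iso hT eA (Iso.refl _) eB (by simp) (by simp) (by simp)⟩
  exact h.inF.of_iso ((asIso ((homologyFunctor (P1 K).Modules (-1)).map f)).symm ≪≫
    (homologyFunctor (P1 K).Modules (-1)).mapIso eN ≪≫
    (singleFunctorCompHomologyFunctorIso (P1 K).Modules (-1)).app N)

/-- One direction is induction along the filtration, the tilt being closed under extensions; the
other concatenates the Harder–Narasimhan filtrations of `H⁻¹[1]` and `H⁰`. -/
theorem heart_iff_inD {ν : ℝ} (hν : 1 / 2 ≤ ν) (hν' : ν ≤ 1) {E : DP1 K} :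
    heart K ν E ↔ InD (ν - 1) E := by
  constructor
  · rintro ⟨ℓ, hℓ, hb⟩
    exact hℓ.inD (by linarith) (by linarith) fun φ hφ => by simpa using hb φ hφ
  · intro h
    obtain ⟨N, M, f, g, d, hN, hM, hT⟩ := h.exists_triangle
    exact heart_of_triangle hν hν' hN hM hT

lemma InF.isZero {μ : ℝ} (hμ : μ ≤ -(1 / 2)) {M : (P1 K).Modules} (h : InF μ M) : IsZero M := by
  by_contra h0
  have h1 := h.phase_le M (𝟙 M) inferInstance h.coh h0
  have h2 := neg_half_lt_phase (isPos_sheafClass h.coh h0)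
  linarith

/-- The interval lies in both `]-1/2, 1/2]` and `]σ - 1, σ]`. The first tilt is the category of
sheaves, its `F` being zero, and the second one gives the bound on quotients. -/
theorem cohI_isSheaf {σ : ℝ} (hσ : 1 / 2 < σ) (hσ' : σ ≤ 1) {E : DP1 K}
    (h : cohI K (Set.Ioc (σ - 1) (1 / 2)) E) : IsSheaf E ∧ InT (σ - 1) (coho 0 E) := by
  obtain ⟨ℓ, hℓ, hb⟩ := h
  have h1 : InD (-(1 / 2)) E := hℓ.inD le_rfl (by norm_num) fun φ hφ =>
    ⟨by linarith [(hb φ hφ).1], by linarith [(hb φ hφ).2]⟩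
  have h2 : InD (σ - 1) E := hℓ.inD (by linarith) (by linarith) fun φ hφ =>
    ⟨(hb φ hφ).1, by linarith [(hb φ hφ).2]⟩
  exact ⟨h1.isSheaf (h1.inF.isZero le_rfl), h2.inT⟩

end Tilt

/-! ### Monomorphisms and cokernels in the tilted heart -/

section HeartMorphisms

open Pretriangulated DerivedCategory

variable {K : Type} [Field K]

lemma sheafClass_cokernel_sub_kernel {L M : (P1 K).Modules} (φ : L ⟶ M) (hL : IsCoherent L)
    (hM : IsCoherent M) :
    sheafClass (cokernel φ) - sheafClass (kernel φ) = sheafClass M - sheafClass L := by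
  have h1 : sheafClass L = sheafClass (kernel φ) + sheafClass (kernel (cokernel.π φ)) :=
    sheafClass_add (shortExact_kernel_lift (ShortComplex.exact_kernel φ)
      (ShortComplex.exact_cokernel φ)) (isCoherent_kernel φ hL hM) hL
  have h2 : sheafClass M = sheafClass (kernel (cokernel.π φ)) + sheafClass (cokernel φ) :=
    sheafClass_add (epiSES_shortExact (cokernel.π φ))
      (isCoherent_kernel _ hM (isCoherent_cokernel φ hL hM)) hM
  rw [h1, h2]
  abel

lemma cls_eq {E : DP1 K} (h : ∀ i : ℤ, i ≠ 0 → i ≠ -1 → IsZero (coho i E)) :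
    cls E = sheafClass (coho 0 E) - sheafClass (coho (-1) E) := by
  rw [cls, finsum_eq_sum_of_support_subset (s := {0, -1})]
  · rw [Finset.sum_pair (by decide)]
    simp [sub_eq_add_neg]
  · intro i hi
    by_contra h'
    simp only [Finset.coe_insert, Finset.coe_singleton, Set.mem_insert_iff,
      Set.mem_singleton_iff, not_or] at h'
    exact hi (by simp only [sheafClass_of_isZero (h i h'.1 h'.2), smul_zero])

section Cone

variable {X Y Z : DP1 K} {f : X ⟶ Y} {p : Y ⟶ Z} {d : Z ⟶ X⟦(1 : ℤ)⟧}
  (hT : Triangle.mk f p d ∈ distTriang (DP1 K))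
include hT

lemma isZero_coho_cone (h₁ : IsSheaf X) (h₂ : IsSheaf Y) (i : ℤ) (h0 : i ≠ 0)
    (h1 : i ≠ -1) : IsZero (coho i Z) :=
  isZero_coho₃ hT (j := i + 1) rfl (h₂ i h0) (h₁ _ (by omega))

lemma cohoConeKernel (h₂ : IsSheaf Y) : Nonempty (coho (-1) Z ≅ kernel (cohoMap f)) := by
  have : Mono (HomologySequence.δ (Triangle.mk f p d) (-1) 0 (by decide)) :=
    (HomologySequence.exact₃ _ hT (-1) 0 (by decide)).mono_g
      ((h₂ (-1) (by decide)).eq_of_src _ _)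
  exact ⟨IsLimit.conePointUniqueUpToIso
    (HomologySequence.exact₁ _ hT (-1) 0 (by decide)).fIsKernel (limit.isLimit _)⟩

lemma cohoConeCokernel (h₁ : IsSheaf X) : Nonempty (coho 0 Z ≅ cokernel (cohoMap f)) := by
  have : Epi ((homologyFunctor (P1 K).Modules 0).map (Triangle.mk f p d).mor₂) :=
    (HomologySequence.epi_homologyMap_mor₂_iff _ hT 0 1 (by decide)).2
      ((h₁ 1 (by decide)).eq_of_tgt _ _)
  exact ⟨IsColimit.coconePointUniqueUpToIso
    (HomologySequence.exact₂ _ hT 0).gIsCokernel (colimit.isColimit _)⟩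

/-- The kernel and cokernel of `H⁰(f)` are `H⁻¹` and `H⁰` of the cone. Injectivity on sheaves is not
needed, so classes can be computed before it is known. -/
lemma cls_cone (h₁ : IsSheaf X) (h₂ : IsSheaf Y) (hc₁ : IsCoherent (coho 0 X))
    (hc₂ : IsCoherent (coho 0 Y)) :
    cls Z = sheafClass (coho 0 Y) - sheafClass (coho 0 X) := by
  obtain ⟨e⟩ := cohoConeKernel hT h₂
  obtain ⟨e'⟩ := cohoConeCokernel hT h₁
  rw [cls_eq (isZero_coho_cone hT h₁ h₂), ← sheafClass_cokernel_sub_kernel _ hc₁ hc₂,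
    sheafClass_iso e.symm (isCoherent_kernel _ hc₁ hc₂),
    sheafClass_iso e'.symm (isCoherent_cokernel _ hc₁ hc₂)]

lemma inD_cone {μ : ℝ} (h₁ : IsSheaf X) (h₂ : IsSheaf Y) (hc₁ : IsCoherent (coho 0 X))
    (hT₂ : InT μ (coho 0 Y))
    (hF : InF μ (kernel (cohoMap f))) : InD μ Z := by
  obtain ⟨e⟩ := cohoConeKernel hT h₂
  obtain ⟨e'⟩ := cohoConeCokernel hT h₁
  exact ⟨isZero_coho_cone hT h₁ h₂, (hT₂.of_epi (cokernel.π (cohoMap f))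
    (isCoherent_cokernel _ hc₁ hT₂.coh)).of_iso e'.symm, hF.of_iso e.symm⟩

end Cone

lemma IsSheaf.isGE {E : DP1 K} (h : IsSheaf E) : E.IsGE 0 := (isGE_iff E 0).2 fun i hi => h i hi.ne

lemma IsSheaf.isLE {E : DP1 K} (h : IsSheaf E) : E.IsLE 0 := (isLE_iff E 0).2 fun i hi => h i hi.ne'

lemma InD.isLE {μ : ℝ} {E : DP1 K} (h : InD μ E) : E.IsLE 0 :=
  (isLE_iff E 0).2 fun i hi => h.isZero i (by omega) (by omega)

/-- The composite to `H⁰(Z)` vanishes for degree reasons, so the map factors through `H⁻¹(Z)[1]` and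
is the shift of a map from `T` to `F`. -/
lemma InD.hom_shift_eq_zero {μ : ℝ} {E Z : DP1 K} (hE : IsSheaf E) (hT : InT μ (coho 0 E))
    (hZ : InD μ Z) (f : E⟦(1 : ℤ)⟧ ⟶ Z) : f = 0 := by
  obtain ⟨N, M, a, b, d, hN, hM, hd⟩ := hZ.exists_triangle
  have : E.IsLE 0 := hE.isLE
  have : (E⟦(1 : ℤ)⟧).IsLE (-1) := TStructure.t.isLE_shift E 0 1 (-1)
  have hfb : f ≫ b = 0 := TStructure.t.zero _ (-1) 0
  obtain ⟨g, rfl⟩ : ∃ g : E⟦(1 : ℤ)⟧ ⟶ (sh N)⟦(1 : ℤ)⟧, f = g ≫ a :=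
    Triangle.coyoneda_exact₂ _ hd f hfb
  obtain ⟨g', rfl⟩ := (shiftFunctor (DP1 K) (1 : ℤ)).map_surjective g
  have h0 : g' = 0 := hE.hom_ext (isSheaf_sh N)
    ((hT.hom_eq_zero (hN.of_iso (cohoShIso N).symm) (cohoMap g')).trans
      ((homologyFunctor (P1 K).Modules 0).map_zero _ _).symm)
  rw [h0, Functor.map_zero, zero_comp]

variable {ν : ℝ} {X Y : Heart K ν}

lemma IsCokernelOf.iso {C : Type*} [Category* C] [HasZeroMorphisms C] {X Y : C} {f : X ⟶ Y}
    {Q Q' : C} (h : IsCokernelOf f Q) (h' : IsCokernelOf f Q') : Nonempty (Q ≅ Q') := by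
  obtain ⟨p, w, ⟨hp⟩⟩ := h
  obtain ⟨p', w', ⟨hp'⟩⟩ := h'
  exact ⟨hp.coconePointUniqueUpToIso hp'⟩

lemma cls_iso {E F : DP1 K} (e : E ≅ F) (hE : ∀ i, IsCoherent (coho i E)) : cls E = cls F := by
  rw [cls, cls]
  exact finsum_congr fun i => by
    rw [sheafClass_iso ((homologyFunctor (P1 K).Modules i).mapIso e) (hE i)]

lemma InD.isCoherent {μ : ℝ} {E : DP1 K} (h : InD μ E) (i : ℤ) : IsCoherent (coho i E) := by
  by_cases h0 : i = 0
  · rw [h0]; exact h.inT.coh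
  by_cases h1 : i = -1
  · rw [h1]; exact h.inF.coh
  exact isCoherent_of_isZero (h.isZero i h0 h1)

section

variable (hν : 1 / 2 ≤ ν) (hν' : ν ≤ 1)
include hν hν'

lemma Heart.inD (X : Heart K ν) : InD (ν - 1) X.obj := (heart_iff_inD hν hν').1 X.property

/-- A subobject in the tilted heart of a sheaf is a sheaf. -/
lemma isSheaf_of_mono (f : X ⟶ Y) [Mono f] (hY : IsSheaf Y.obj) : IsSheaf X.obj := by
  have hX := Heart.inD hν hν' X
  obtain ⟨N, M, a, b, d, hN, hM, hT⟩ := hX.exists_triangle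
  have hs : IsSheaf (sh N) := isSheaf_sh N
  let A : Heart K ν := ⟨(sh N)⟦(1 : ℤ)⟧, (heart_iff_inD hν hν').2 hN.inD_shift⟩
  have : (sh N).IsLE 0 := hs.isLE
  have : Y.obj.IsGE 0 := hY.isGE
  have : ((sh N)⟦(1 : ℤ)⟧).IsLE (-1) := TStructure.t.isLE_shift (sh N) 0 1 (-1)
  -- `H⁻¹(X)[1]` has no nonzero map to a sheaf, so its map to `X` is killed by the monomorphism `f`.
  have h0 : (ObjectProperty.homMk a : A ⟶ X) = 0 := by
    rw [← cancel_mono f, zero_comp]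
    ext
    exact TStructure.t.zero _ (-1) 0
  have ha : a = 0 := congr_arg InducedCategory.Hom.hom h0
  refine hX.isSheaf ((HomologySequence.exact₂ _ hT (-1)).isZero_of_both_zeros ?_
    ((isSheaf_sh M (-1) (by decide)).eq_of_tgt _ _))
  change (homologyFunctor (P1 K).Modules (-1)).map a = 0
  rw [ha, Functor.map_zero]

/-- The part in `T` of the sheaf kernel is an object of the heart whose map to `X` is killed by `f`;
hence it vanishes and only the part in `F` remains. -/
lemma inF_kernel_of_mono (f : X ⟶ Y) [Mono f] (hY : IsSheaf Y.obj) :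
    InF (ν - 1) (kernel (cohoMap f.hom)) := by
  have hX := isSheaf_of_mono hν hν' f hY
  have hk := isCoherent_kernel (cohoMap f.hom) (Heart.inD hν hν' X).inT.coh
    (Heart.inD hν hν' Y).inT.coh
  obtain ⟨N, i, hi, hN, hF⟩ := exists_torsionPair_sequence (μ := ν - 1) (by linarith) hk
  let A : Heart K ν := ⟨sh N, (heart_iff_inD hν hν').2 hN.inD_sh⟩
  obtain ⟨g, hg⟩ := (isSheaf_sh N).exists_map hX
    ((cohoShIso N).hom ≫ i ≫ kernel.ι (cohoMap f.hom))
  have h0 : (ObjectProperty.homMk g : A ⟶ X) = 0 := by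
    rw [← cancel_mono f, zero_comp]
    ext
    refine (isSheaf_sh N).hom_ext hY ?_
    change cohoMap (g ≫ f.hom) = cohoMap 0
    rw [cohoMap, Functor.map_comp, cohoMap, Functor.map_zero]
    change cohoMap g ≫ cohoMap f.hom = 0
    rw [hg, Category.assoc, Category.assoc, kernel.condition, comp_zero, comp_zero]
  have hg0 : g = 0 := congr_arg InducedCategory.Hom.hom h0
  have hi0 : i = 0 := by
    rw [← cancel_mono (kernel.ι (cohoMap f.hom)), ← cancel_epi (cohoShIso N).hom, ← hg, hg0,
      cohoMap, Functor.map_zero, zero_comp, comp_zero]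
  have : IsIso (cokernel.π i) := by
    rw [hi0]; infer_instance
  exact hF.of_iso (asIso (cokernel.π i)).symm

/-- A morphism of sheaves which is a monomorphism is a monomorphism in the tilted heart. -/
lemma mono_of_mono_cohoMap (f : X ⟶ Y) (hX : IsSheaf X.obj) (hY : IsSheaf Y.obj)
    (hf : Mono (cohoMap f.hom)) : Mono f := by
  refine Preadditive.mono_of_cancel_zero f fun {W} g hg => ?_
  obtain ⟨Z, p, d, hT⟩ := distinguished_cocone_triangle f.hom
  obtain ⟨e⟩ := cohoConeKernel hT hY
  -- With zero kernel on `H⁰`, the cone has no cohomology in degree `-1`. A map killed by `f`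
  -- factors through `Z⟦-1⟧`, in degrees at least `1`, while `W` is in degrees at most `0`.
  have hZ : Z.IsGE 0 := by
    rw [isGE_iff]
    intro i hi
    by_cases h1 : i = -1
    · rw [h1]
      exact (isZero_kernel_of_mono (cohoMap f.hom)).of_iso e
    · exact isZero_coho_cone hT hX hY i hi.ne h1
  have hW : W.obj.IsLE 0 := (Heart.inD hν hν' W).isLE
  have : (Z⟦(-1 : ℤ)⟧).IsGE 1 := TStructure.t.isGE_shift Z 0 (-1) 1
  have hg' : g.hom ≫ f.hom = 0 := congr_arg InducedCategory.Hom.hom hg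
  obtain ⟨q, g', h'⟩ : ∃ (q : Z⟦(-1 : ℤ)⟧ ⟶ X.obj) (g' : W.obj ⟶ Z⟦(-1 : ℤ)⟧), g.hom = g' ≫ q :=
    ⟨_, Triangle.coyoneda_exact₂ _ (inv_rot_of_distTriang _ hT) g.hom hg'⟩
  have h0 : g' = 0 := TStructure.t.zero g' 0 1
  ext
  rw [h', h0, zero_comp]
  rfl

/-- Maps out of `Y` killed by `f` factor through the cone. The factorization is unique because two
of them differ by a map from `X⟦1⟧` to an object of the heart, which is zero. -/
lemma isCokernelOf_cone (f : X ⟶ Y) (hX : IsSheaf X.obj) {Z : DP1 K} {p : Y.obj ⟶ Z}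
    {d : Z ⟶ X.obj⟦(1 : ℤ)⟧} (hT : Triangle.mk f.hom p d ∈ distTriang (DP1 K))
    (hZ : heart K ν Z) : IsCokernelOf f (⟨Z, hZ⟩ : Heart K ν) := by
  have w : f ≫ (ObjectProperty.homMk p : Y ⟶ ⟨Z, hZ⟩) = 0 := by
    ext
    exact comp_distTriang_mor_zero₁₂ _ hT
  have : Epi (ObjectProperty.homMk p : Y ⟶ (⟨Z, hZ⟩ : Heart K ν)) := by
    refine Preadditive.epi_of_cancel_zero _ fun {W} g hg => ?_
    have hg' : p ≫ g.hom = 0 := congr_arg InducedCategory.Hom.hom hg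
    obtain ⟨g', h'⟩ : ∃ g' : X.obj⟦(1 : ℤ)⟧ ⟶ W.obj, g.hom = d ≫ g' :=
      Triangle.yoneda_exact₃ _ hT g.hom hg'
    ext
    rw [h', InD.hom_shift_eq_zero hX (Heart.inD hν hν' X).inT (Heart.inD hν hν' W) g', comp_zero]
    rfl
  refine ⟨ObjectProperty.homMk p, w, ⟨CokernelCofork.IsColimit.ofπ' _ w fun {W} g hg => ?_⟩⟩
  have hg' : f.hom ≫ g.hom = 0 := congr_arg InducedCategory.Hom.hom hg
  refine ⟨ObjectProperty.homMk (Triangle.yoneda_exact₂ _ hT g.hom hg').choose, ?_⟩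
  ext
  exact (Triangle.yoneda_exact₂ _ hT g.hom hg').choose_spec.symm

lemma exists_isCokernelOf (f : X ⟶ Y) (hX : IsSheaf X.obj) (hY : IsSheaf Y.obj)
    (hF : InF (ν - 1) (kernel (cohoMap f.hom))) :
    ∃ Q : Heart K ν, IsCokernelOf f Q ∧
      cls Q.obj = sheafClass (coho 0 Y.obj) - sheafClass (coho 0 X.obj) := by
  obtain ⟨Z, p, d, hT⟩ := distinguished_cocone_triangle f.hom
  have hc := (Heart.inD hν hν' X).inT.coh
  have hc' := (Heart.inD hν hν' Y).inT
  have hZ : InD (ν - 1) Z := inD_cone hT hX hY hc hc' hF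
  have hcls : cls Z = sheafClass (coho 0 Y.obj) - sheafClass (coho 0 X.obj) :=
    cls_cone hT hX hY hc hc'.coh
  have hZ' : heart K ν Z := (heart_iff_inD hν hν').2 hZ
  exact ⟨⟨Z, hZ'⟩, isCokernelOf_cone hν hν' f hX hT hZ', hcls⟩

lemma IsCokernelOf.cls_eq {f : X ⟶ Y} {Q : Heart K ν} (hQ : IsCokernelOf f Q)
    (hX : IsSheaf X.obj) (hY : IsSheaf Y.obj) (hF : InF (ν - 1) (kernel (cohoMap f.hom))) :
    cls Q.obj = sheafClass (coho 0 Y.obj) - sheafClass (coho 0 X.obj) := by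
  obtain ⟨Q', hQ', h'⟩ := exists_isCokernelOf hν hν' f hX hY hF
  obtain ⟨e⟩ := hQ.iso hQ'
  rw [← h']
  exact cls_iso ((heart K ν).ι.mapIso e) (Heart.inD hν hν' Q).isCoherent

end

end HeartMorphisms

/-! ### Intersections, sums and degree bounds for subsheaves -/

section Subsheaves

section Abelian

variable {C : Type*} [Category* C] [Abelian C] {M : C}

/-- The kernel of a map that vanishes on `X` and on `Y` is a subobject containing both, hence all of
`X ⊔ Y`. -/
lemma epi_desc_ofLE_sup (X Y : Subobject M) :
    Epi (biprod.desc (Subobject.ofLE X (X ⊔ Y) le_sup_left)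
      (-Subobject.ofLE Y (X ⊔ Y) le_sup_right)) := by
  refine Preadditive.epi_of_cancel_zero _ fun {W} g hg => ?_
  have h1 : Subobject.ofLE X (X ⊔ Y) le_sup_left ≫ g = 0 := by
    simpa using biprod.inl ≫= hg
  have h2 : Subobject.ofLE Y (X ⊔ Y) le_sup_right ≫ g = 0 := by
    simpa using biprod.inr ≫= hg
  have h3 : X ⊔ Y ≤ Subobject.mk (kernel.ι g ≫ (X ⊔ Y).arrow) :=
    sup_le (Subobject.le_mk_of_comm (kernel.lift g _ h1) (by simp))
      (Subobject.le_mk_of_comm (kernel.lift g _ h2) (by simp))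
  have h4 := Subobject.ofLEMk_comp h3
  rw [← Category.assoc] at h4
  have h5 : Subobject.ofLEMk _ _ h3 ≫ kernel.ι g = 𝟙 _ := by
    rw [← cancel_mono (X ⊔ Y).arrow, h4, Category.id_comp]
  rw [← Category.id_comp g, ← h5, Category.assoc, kernel.condition, comp_zero]

/-- The exact sequence `0 ⟶ X ∩ Y ⟶ X ⊕ Y ⟶ X + Y ⟶ 0`. -/
lemma inf_sup_shortExact (X Y : Subobject M) :
    (ShortComplex.mk
      (biprod.lift (Subobject.ofLE (X ⊓ Y) X inf_le_left) (Subobject.ofLE (X ⊓ Y) Y inf_le_right))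
      (biprod.desc (Subobject.ofLE X (X ⊔ Y) le_sup_left)
        (-Subobject.ofLE Y (X ⊔ Y) le_sup_right))
      (by rw [← cancel_mono (X ⊔ Y).arrow]; simp)).ShortExact := by
  have hp := Subobject.inf_isPullback X Y
  have hm := hp.mono_shortComplex'_f
  have he := epi_desc_ofLE_sup X Y
  let S := ShortComplex.mk
      (biprod.lift (Subobject.ofLE (X ⊓ Y) X inf_le_left) (Subobject.ofLE (X ⊓ Y) Y inf_le_right))
      (biprod.desc (Subobject.ofLE X (X ⊔ Y) le_sup_left)
        (-Subobject.ofLE Y (X ⊔ Y) le_sup_right))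
      (by rw [← cancel_mono (X ⊔ Y).arrow]; simp)
  have hdesc : biprod.desc X.arrow (-Y.arrow) = biprod.desc
      (Subobject.ofLE X (X ⊔ Y) le_sup_left) (-Subobject.ofLE Y (X ⊔ Y) le_sup_right) ≫
        (X ⊔ Y).arrow := by
    ext <;> simp
  let φ : S ⟶ hp.shortComplex' :=
    { τ₁ := 𝟙 _, τ₂ := 𝟙 _, τ₃ := (X ⊔ Y).arrow
      comm₁₂ := (Category.id_comp _).trans (Category.comp_id _).symm
      comm₂₃ := (Category.id_comp _).trans hdesc }
  have h1 : Epi φ.τ₁ := inferInstanceAs (Epi (𝟙 _))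
  have h2 : IsIso φ.τ₂ := inferInstanceAs (IsIso (𝟙 _))
  have h3 : Mono φ.τ₃ := inferInstanceAs (Mono (X ⊔ Y).arrow)
  have : Mono S.f := hm
  have : Epi S.g := he
  exact ⟨(ShortComplex.exact_iff_of_epi_of_isIso_of_mono φ).2 hp.exact_shortComplex'⟩

/-- Two lifts of subobjects to an object over `M` glue if they agree on the intersection. -/
lemma exists_lift_sup {Z : C} (z : Z ⟶ M) {X Y : Subobject M}
    (h0 : ∀ g : ((X ⊓ Y : Subobject M) : C) ⟶ kernel z, g = 0) {u : (X : C) ⟶ Z} {v : (Y : C) ⟶ Z}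
    (hu : u ≫ z = X.arrow) (hv : v ≫ z = Y.arrow) :
    ∃ t : ((X ⊔ Y : Subobject M) : C) ⟶ Z, t ≫ z = (X ⊔ Y).arrow := by
  have hS := inf_sup_shortExact X Y
  have he := epi_desc_ofLE_sup X Y
  have hm : Epi (ShortComplex.mk
      (biprod.lift (Subobject.ofLE (X ⊓ Y) X inf_le_left) (Subobject.ofLE (X ⊓ Y) Y inf_le_right))
      (biprod.desc (Subobject.ofLE X (X ⊔ Y) le_sup_left)
        (-Subobject.ofLE Y (X ⊔ Y) le_sup_right))
      (by rw [← cancel_mono (X ⊔ Y).arrow]; simp)).g := he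
  have hz : (biprod.lift (Subobject.ofLE (X ⊓ Y) X inf_le_left)
      (Subobject.ofLE (X ⊓ Y) Y inf_le_right) ≫ biprod.desc u (-v)) ≫ z = 0 := by
    simp [hu, hv]
  have hz' : biprod.lift (Subobject.ofLE (X ⊓ Y) X inf_le_left)
      (Subobject.ofLE (X ⊓ Y) Y inf_le_right) ≫ biprod.desc u (-v) = 0 := by
    -- On the intersection the two lifts differ by a map into `kernel z`, and `h0` makes it vanish.
    rw [← kernel.lift_ι z _ hz, h0 (kernel.lift z _ hz), zero_comp]
  refine ⟨hS.exact.desc (biprod.desc u (-v)) hz', ?_⟩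
  rw [← cancel_epi (biprod.desc (Subobject.ofLE X (X ⊔ Y) le_sup_left)
        (-Subobject.ofLE Y (X ⊔ Y) le_sup_right))]
  have h1 := hS.exact.g_desc (biprod.desc u (-v)) hz'
  dsimp only at h1
  rw [reassoc_of% h1]
  ext <;> simp [hu, hv]

end Abelian

variable {K : Type} [Field K]

lemma biprod_shortExact {C : Type*} [Category* C] [Abelian C] (X Y : C) :
    (ShortComplex.mk (biprod.inl : X ⟶ X ⊞ Y) (biprod.snd : X ⊞ Y ⟶ Y)
      (by simp)).ShortExact :=
  (ShortComplex.Splitting.ofHasBinaryBiproduct X Y).shortExact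

section

variable {M : (P1 K).Modules} (X Y : Subobject M)

lemma isCoherent_biprod {X Y : (P1 K).Modules} (hX : IsCoherent X) (hY : IsCoherent Y) :
    IsCoherent (X ⊞ Y) :=
  isCoherent_of_extension (biprod_shortExact X Y) hX hY

lemma isCoherent_inf (hM : IsCoherent M) (hX : IsCoherent (X : (P1 K).Modules))
    (hY : IsCoherent (Y : (P1 K).Modules)) :
    IsCoherent ((X ⊓ Y : Subobject M) : (P1 K).Modules) := by
  have hp := Subobject.inf_isPullback X Y
  have := hp.mono_shortComplex'_f
  exact isCoherent_of_iso (IsLimit.conePointUniqueUpToIso (limit.isLimit _)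
    hp.exact_shortComplex'.fIsKernel) (isCoherent_kernel _ (isCoherent_biprod hX hY) hM)

lemma isCoherent_sup (hM : IsCoherent M) (hX : IsCoherent (X : (P1 K).Modules))
    (hY : IsCoherent (Y : (P1 K).Modules)) :
    IsCoherent ((X ⊔ Y : Subobject M) : (P1 K).Modules) :=
  isCoherent_of_quotient (inf_sup_shortExact X Y) (isCoherent_inf X Y hM hX hY)
    (isCoherent_biprod hX hY)

lemma sheafClass_inf_add_sup (hM : IsCoherent M) (hX : IsCoherent (X : (P1 K).Modules))
    (hY : IsCoherent (Y : (P1 K).Modules)) :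
    sheafClass ((X ⊓ Y : Subobject M) : (P1 K).Modules) +
      sheafClass ((X ⊔ Y : Subobject M) : (P1 K).Modules) =
    sheafClass (X : (P1 K).Modules) + sheafClass (Y : (P1 K).Modules) := by
  have h := isCoherent_biprod hX hY
  exact (sheafClass_add (inf_sup_shortExact X Y) (isCoherent_inf X Y hM hX hY) h).symm.trans
    (sheafClass_add (biprod_shortExact (X : (P1 K).Modules) (Y : (P1 K).Modules)) hX h)

lemma InT.sup {μ : ℝ} (hM : IsCoherent M) (hX : InT μ (X : (P1 K).Modules))
    (hY : InT μ (Y : (P1 K).Modules)) : InT μ ((X ⊔ Y : Subobject M) : (P1 K).Modules) := by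
  have := epi_desc_ofLE_sup X Y
  exact (InT.of_extension (biprod_shortExact (X : (P1 K).Modules) (Y : (P1 K).Modules))
    hX hY).of_epi (biprod.desc (Subobject.ofLE X (X ⊔ Y) le_sup_left)
      (-Subobject.ofLE Y (X ⊔ Y) le_sup_right)) (isCoherent_sup X Y hM hX.coh hY.coh)

end

/-- The coherent subsheaves of `M` are of degree at most `C`. -/
def DegLE (C : ℤ) (M : (P1 K).Modules) : Prop :=
  ∀ (G : (P1 K).Modules) (i : G ⟶ M), Mono i → IsCoherent G → (sheafClass G).2 ≤ C

/-- The quotient by a subsheaf `G` has slope at least `-c` and rank at most that of `M`, so `deg G =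
deg M - deg (M / G)` is bounded above. -/
lemma InT.degLE {σ : ℝ} {c : ℕ} (hc : nu c ≤ σ) {M : (P1 K).Modules} (hM : InT (σ - 1) M) :
    DegLE (|(sheafClass M).2| + c * (sheafClass M).1) M := by
  intro G i _ hG
  have hQ := isCoherent_cokernel i hG hM.coh
  have h1 : sheafClass M = sheafClass G + sheafClass (cokernel i) :=
    sheafClass_add (monoSES_shortExact i) hG hM.coh
  have h2 := le_abs_self (sheafClass M).2
  have h3 : -c * (sheafClass (cokernel i)).1 ≤ (sheafClass (cokernel i)).2 := by
    by_cases h0 : IsZero (cokernel i)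
    · simp [sheafClass_of_isZero h0]
    · exact le_snd_of_le_phase (isPos_sheafClass hQ h0)
        (by linarith [hM.lt_phase (cokernel i) (cokernel.π i) inferInstance hQ h0])
  have h4 : (sheafClass (cokernel i)).1 ≤ (sheafClass M).1 := fst_le_of_epi (cokernel.π i) hQ hM.coh
  have h5 : (c : ℤ) * (sheafClass (cokernel i)).1 ≤ c * (sheafClass M).1 :=
    mul_le_mul_of_nonneg_left h4 (Int.natCast_nonneg c)
  have h6 := congr_arg Prod.snd h1
  rw [Prod.snd_add] at h6
  linarith

/-- Subsheaves of large degree are torsion for the torsion pair of slope close to `-∞`. -/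
lemma DegLE.inT {C B : ℤ} {n : ℕ} {μ : ℝ} (hμ : μ ≤ nu n - 1) (hn : B + C < n)
    {L M : (P1 K).Modules} (hM : DegLE C M) (hL : IsCoherent L) (i : L ⟶ M) [Mono i]
    (hB : -B ≤ (sheafClass L).2) : InT μ L := by
  refine ⟨hL, fun Q p _ hQ h0 => hμ.trans_lt (lt_phase_of_lt_snd (isPos_sheafClass hQ h0) ?_)⟩
  have hk := isCoherent_kernel p hL hQ
  have h1 : sheafClass L = sheafClass (kernel p) + sheafClass Q :=
    sheafClass_add (epiSES_shortExact p) hk hL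
  have h2 := hM (kernel p) (kernel.ι p ≫ i) (mono_comp _ _) hk
  have h6 := congr_arg Prod.snd h1
  rw [Prod.snd_add] at h6
  rcases isPos_sheafClass hQ h0 with h | ⟨h, h'⟩
  · have : (n : ℤ) * 1 ≤ n * (sheafClass Q).1 :=
      mul_le_mul_of_nonneg_left h (Int.natCast_nonneg n)
    linarith
  · rw [h]
    linarith

/-- A nonzero kernel in `F` has positive rank and slope at most `-n`, hence degree at most `-n`. The
image has degree at most `C`, so `L` would have degree at most `C - n < -B`. -/
lemma DegLE.mono_of_inF_kernel {C B : ℤ} {n : ℕ} {μ : ℝ} (hμ : μ ≤ nu n - 1) (hn : B + C < n)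
    {L M : (P1 K).Modules} (hM : DegLE C M) (hLc : IsCoherent L) (hMc : IsCoherent M) (φ : L ⟶ M)
    (hF : InF μ (kernel φ)) (hB : -B ≤ (sheafClass L).2) : Mono φ := by
  have hz : IsZero (kernel φ) := by
    by_contra h0
    have hpos := isPos_sheafClass hF.coh h0
    have hph := hF.phase_le (kernel φ) (𝟙 _) inferInstance hF.coh h0
    have h1 : sheafClass L = sheafClass (kernel φ) + sheafClass (kernel (cokernel.π φ)) :=
      sheafClass_add (shortExact_kernel_lift (ShortComplex.exact_kernel φ)
        (ShortComplex.exact_cokernel φ)) hF.coh hLc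
    have h2 := hM (kernel (cokernel.π φ)) (kernel.ι _) inferInstance
      (isCoherent_kernel _ hMc (isCoherent_cokernel φ hLc hMc))
    have h3 := snd_le_of_phase_le hpos (hph.trans hμ)
    have h4 := hpos.fst_pos_of_phase_lt (by linarith [nu_le_one n])
    have h5 : (n : ℤ) * 1 ≤ n * (sheafClass (kernel φ)).1 :=
      mul_le_mul_of_nonneg_left h4 (Int.natCast_nonneg n)
    have h6 := congr_arg Prod.snd h1
    rw [Prod.snd_add] at h6
    linarith
  exact Preadditive.mono_of_kernel_zero (hz.eq_of_src _ _)

end Subsheaves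

/-! ### Subobjects in the tilted heart versus subsheaves -/

section HeartSubobjects

open DerivedCategory

variable {K : Type} [Field K] {ν : ℝ} {E : Heart K ν}

lemma cohoMap_comp {A B C : DP1 K} (f : A ⟶ B) (g : B ⟶ C) :
    cohoMap (f ≫ g) = cohoMap f ≫ cohoMap g :=
  (homologyFunctor (P1 K).Modules 0).map_comp f g

instance isIso_cohoMap {A B : Heart K ν} (f : A ⟶ B) [IsIso f] : IsIso (cohoMap f.hom) :=
  inferInstanceAs (IsIso ((homologyFunctor (P1 K).Modules 0).map f.hom))

/-- The image of a morphism of sheaves. -/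
def imSub {M N : (P1 K).Modules} (f : M ⟶ N) : Subobject N := imageSubobject f

lemma imSub_iso_comp {L M N : (P1 K).Modules} (e : L ⟶ M) [IsIso e] (f : M ⟶ N) :
    imSub (e ≫ f) = imSub f :=
  imageSubobject_iso_comp e f

lemma imSub_comp_le {L M N : (P1 K).Modules} (e : L ⟶ M) (f : M ⟶ N) : imSub (e ≫ f) ≤ imSub f :=
  imageSubobject_comp_le e f

lemma imSub_of_mono {M N : (P1 K).Modules} (f : M ⟶ N) [Mono f] : imSub f = Subobject.mk f :=
  imageSubobject_mono f

/-- The subsheaf of `H⁰(E)` given by a subobject of `E` in the tilted heart. -/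
def shSub (P : Subobject E) : Subobject (coho 0 E.obj) := imSub (cohoMap P.arrow.hom)

/-- The subobjects in the tilted heart which come from subsheaves. -/
def Good (P : Subobject E) : Prop := Mono (cohoMap P.arrow.hom)

lemma cohoMap_mk_arrow {X : Heart K ν} (f : X ⟶ E) [Mono f] :
    cohoMap (Subobject.mk f).arrow.hom =
      cohoMap (Subobject.underlyingIso f).hom.hom ≫ cohoMap f.hom := by
  rw [← cohoMap_comp, ← ObjectProperty.FullSubcategory.comp_hom,
    Subobject.underlyingIso_hom_comp_eq_mk]

lemma shSub_mk {X : Heart K ν} (f : X ⟶ E) [Mono f] :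
    shSub (Subobject.mk f) = imSub (cohoMap f.hom) := by
  rw [shSub, cohoMap_mk_arrow, imSub_iso_comp]

lemma good_mk {X : Heart K ν} (f : X ⟶ E) [Mono f] (h : Mono (cohoMap f.hom)) :
    Good (Subobject.mk f) := by
  rw [Good, cohoMap_mk_arrow]
  exact mono_comp _ _

lemma shSub_mono {P P' : Subobject E} (h : P ≤ P') : shSub P ≤ shSub P' := by
  have h1 : cohoMap P.arrow.hom = cohoMap (Subobject.ofLE P P' h).hom ≫ cohoMap P'.arrow.hom := by
    rw [← cohoMap_comp, ← ObjectProperty.FullSubcategory.comp_hom, Subobject.ofLE_arrow]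
  rw [shSub, h1]
  exact imSub_comp_le _ _

/-- The sheaf underlying a good subobject. -/
def Good.iso {P : Subobject E} (h : Good P) :
    coho 0 (P : Heart K ν).obj ≅ (shSub P : (P1 K).Modules) :=
  haveI : Mono (cohoMap P.arrow.hom) := h
  Subobject.isoOfMkEq _ _ (imSub_of_mono (cohoMap P.arrow.hom)).symm

lemma Good.iso_hom_arrow {P : Subobject E} (h : Good P) :
    h.iso.hom ≫ (shSub P).arrow = cohoMap P.arrow.hom := by
  have : Mono (cohoMap P.arrow.hom) := h
  exact Subobject.ofMkLE_arrow _

lemma Good.iso_inv_arrow {P : Subobject E} (h : Good P) :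
    h.iso.inv ≫ cohoMap P.arrow.hom = (shSub P).arrow := by
  rw [Iso.inv_comp_eq, h.iso_hom_arrow]

lemma Good.sheafClass_eq (hν : 1 / 2 ≤ ν) (hν' : ν ≤ 1) {P : Subobject E}
    (h : Good P) :
    sheafClass (coho 0 (P : Heart K ν).obj) = sheafClass (shSub P : (P1 K).Modules) :=
  sheafClass_iso h.iso (Heart.inD hν hν' (P : Heart K ν)).inT.coh

section

variable (hν : 1 / 2 ≤ ν) (hν' : ν ≤ 1) (hE : IsSheaf E.obj)
include hν hν' hE

/-- Subobjects of a sheaf are sheaves, and morphisms between sheaves in the derived category are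
determined by `H⁰` and exist for any map on `H⁰`. -/
lemma le_of_cohoMap {P P' : Subobject E}
    (u : coho 0 (P : Heart K ν).obj ⟶ coho 0 (P' : Heart K ν).obj)
    (hu : u ≫ cohoMap P'.arrow.hom = cohoMap P.arrow.hom) : P ≤ P' := by
  have hP := isSheaf_of_mono hν hν' P.arrow hE
  have hP' := isSheaf_of_mono hν hν' P'.arrow hE
  obtain ⟨f, hf⟩ := hP.exists_map hP' u
  refine Subobject.le_of_comm (ObjectProperty.homMk f) ?_
  ext
  refine hP.hom_ext hE ?_
  change cohoMap (f ≫ P'.arrow.hom) = _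
  rw [cohoMap_comp, hf, hu]

lemma Good.le_of_shSub_le {P P' : Subobject E} (hP' : Good P') (h : shSub P ≤ shSub P') :
    P ≤ P' := by
  have h' : imageSubobject (cohoMap P.arrow.hom) ≤ shSub P' := h
  refine le_of_cohoMap hν hν' hE (factorThruImageSubobject (cohoMap P.arrow.hom) ≫
    Subobject.ofLE _ _ h' ≫ hP'.iso.inv) ?_
  rw [Category.assoc, Category.assoc, hP'.iso_inv_arrow, Subobject.ofLE_arrow,
    imageSubobject_arrow_comp]

/-- A subsheaf in `T` is an object of the heart, and its inclusion remains a monomorphism there. -/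
lemma exists_good (X : Subobject (coho 0 E.obj)) (hX : InT (ν - 1) (X : (P1 K).Modules)) :
    ∃ P : Subobject E, Good P ∧ shSub P = X := by
  let A : Heart K ν := ⟨sh (X : (P1 K).Modules), (heart_iff_inD hν hν').2 hX.inD_sh⟩
  obtain ⟨f, hf⟩ := (isSheaf_sh (X : (P1 K).Modules)).exists_map hE
    ((cohoShIso (X : (P1 K).Modules)).hom ≫ X.arrow)
  let f' : A ⟶ E := ObjectProperty.homMk f
  have hm : Mono (cohoMap f'.hom) := by
    change Mono (cohoMap f)
    rw [hf]
    exact mono_comp _ _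
  have : Mono f' := mono_of_mono_cohoMap hν hν' f' (isSheaf_sh _) hE hm
  refine ⟨Subobject.mk f', good_mk f' hm, ?_⟩
  rw [shSub_mk]
  change imSub (cohoMap f) = X
  rw [hf, imSub_iso_comp, imSub_of_mono, Subobject.mk_arrow]

lemma isGLB_of_good {P P' R : Subobject E} (hP : Good P) (hP' : Good P') (hR : Good R)
    (h : shSub R = shSub P ⊓ shSub P') : IsGLB {P, P'} R := by
  refine ⟨?_, fun Y hY => hR.le_of_shSub_le hν hν' hE ?_⟩
  · rintro _ (rfl | rfl)
    · exact hP.le_of_shSub_le hν hν' hE (h ▸ inf_le_left)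
    · exact hP'.le_of_shSub_le hν hν' hE (h ▸ inf_le_right)
  · rw [h]
    exact le_inf (shSub_mono (hY (Set.mem_insert _ _)))
      (shSub_mono (hY (Set.mem_insert_of_mem _ rfl)))

/-- An upper bound `Y` need not be a subsheaf: its map to `E` has kernel in `F`. The intersection
being in `T`, the lifts of the two subsheaves to `Y` agree on it and glue to a lift of their sum. -/
lemma isLUB_of_good {P P' R : Subobject E} (hP : Good P) (hP' : Good P') (hR : Good R)
    (h : shSub R = shSub P ⊔ shSub P')
    (hT : InT (ν - 1) ((shSub P ⊓ shSub P' : Subobject _) : (P1 K).Modules)) :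
    IsLUB {P, P'} R := by
  refine ⟨?_, fun Y hY => ?_⟩
  · rintro _ (rfl | rfl)
    · exact hR.le_of_shSub_le hν hν' hE (h ▸ le_sup_left)
    · exact hR.le_of_shSub_le hν hν' hE (h ▸ le_sup_right)
  · have hF := inF_kernel_of_mono hν hν' Y.arrow hE
    have key : ∀ {S : Subobject E} (hS : Good S) (hSY : S ≤ Y),
        (hS.iso.inv ≫ cohoMap (Subobject.ofLE S Y hSY).hom) ≫ cohoMap Y.arrow.hom =
          (shSub S).arrow := by
      intro S hS hSY
      rw [Category.assoc, ← cohoMap_comp, ← ObjectProperty.FullSubcategory.comp_hom,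
        Subobject.ofLE_arrow, hS.iso_inv_arrow]
    obtain ⟨t, ht⟩ := exists_lift_sup (cohoMap Y.arrow.hom) (fun g => hT.hom_eq_zero hF g)
      (key hP (hY (Set.mem_insert _ _))) (key hP' (hY (Set.mem_insert_of_mem _ rfl)))
    refine le_of_cohoMap hν hν' hE (hR.iso.hom ≫ Subobject.ofLE _ _ h.le ≫ t) ?_
    rw [Category.assoc, Category.assoc, ht, Subobject.ofLE_arrow, hR.iso_hom_arrow]

lemma inF_kernel_ofLE {S P : Subobject E} (hSP : S ≤ P) :
    InF (ν - 1) (kernel (cohoMap (Subobject.ofLE S P hSP).hom)) := by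
  have : Mono (Subobject.ofLE S P hSP) := inferInstance
  exact inF_kernel_of_mono hν hν' (Subobject.ofLE S P hSP)
    (isSheaf_of_mono hν hν' P.arrow hE)

/-- The class of an entry of the relative position of two filtrations in the tilted heart is
computed by subsheaves. -/
theorem exists_subquotient_iff {A B A' B' : Subobject E} (hA : Good A) (hB : Good B)
    (hA' : Good A') (hB' : Good B') (hAB : A ≤ B) (hAB' : A' ≤ B')
    (h₁ : InT (ν - 1) ((shSub A ⊓ shSub A' : Subobject _) : (P1 K).Modules))
    (h₂ : InT (ν - 1) ((shSub A ⊓ shSub B' : Subobject _) : (P1 K).Modules))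
    (h₃ : InT (ν - 1) ((shSub B ⊓ shSub A' : Subobject _) : (P1 K).Modules))
    (h₄ : InT (ν - 1) ((shSub B ⊓ shSub B' : Subobject _) : (P1 K).Modules)) (γ : ℤ × ℤ) :
    (∃ P P₁ P₂ S : Subobject E, IsGLB {B, B'} P ∧ IsGLB {A, B'} P₁ ∧ IsGLB {B, A'} P₂ ∧
      IsLUB {P₁, P₂} S ∧ ∃ (hSP : S ≤ P) (Q : Heart K ν),
        IsCokernelOf (Subobject.ofLE S P hSP) Q ∧ cls Q.obj = γ) ↔
    sheafClass ((shSub B ⊓ shSub B' : Subobject _) : (P1 K).Modules) -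
      sheafClass (((shSub A ⊓ shSub B') ⊔ (shSub B ⊓ shSub A') : Subobject _) :
        (P1 K).Modules) = γ := by
  have hM := (Heart.inD hν hν' E).inT.coh
  obtain ⟨P, hP, eP⟩ := exists_good hν hν' hE _ h₄
  obtain ⟨P₁, hP₁, eP₁⟩ := exists_good hν hν' hE _ h₂
  obtain ⟨P₂, hP₂, eP₂⟩ := exists_good hν hν' hE _ h₃
  obtain ⟨S, hS, eS⟩ := exists_good hν hν' hE _ (InT.sup _ _ hM h₂ h₃)
  have gP := isGLB_of_good hν hν' hE hB hB' hP eP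
  have gP₁ := isGLB_of_good hν hν' hE hA hB' hP₁ eP₁
  have gP₂ := isGLB_of_good hν hν' hE hB hA' hP₂ eP₂
  -- This is where `h₁` enters: the join criterion needs the intersection of `P₁` and `P₂` to be in
  -- `T`.
  have e : shSub P₁ ⊓ shSub P₂ = shSub A ⊓ shSub A' := by
    rw [eP₁, eP₂]
    refine le_antisymm (le_inf (inf_le_left.trans inf_le_left) (inf_le_right.trans inf_le_right))
      (le_inf (le_inf inf_le_left (inf_le_right.trans (shSub_mono hAB')))
        (le_inf (inf_le_left.trans (shSub_mono hAB)) inf_le_right))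
  have gS : IsLUB {P₁, P₂} S :=
    isLUB_of_good hν hν' hE hP₁ hP₂ hS (by rw [eS, eP₁, eP₂]) (by rw [e]; exact h₁)
  have hSP : S ≤ P := by
    refine gS.2 ?_
    rintro _ (rfl | rfl)
    · refine gP.2 ?_
      rintro _ (rfl | rfl)
      · exact (gP₁.1 (Set.mem_insert _ _)).trans hAB
      · exact gP₁.1 (Set.mem_insert_of_mem _ rfl)
    · refine gP.2 ?_
      rintro _ (rfl | rfl)
      · exact gP₂.1 (Set.mem_insert _ _)
      · exact (gP₂.1 (Set.mem_insert_of_mem _ rfl)).trans hAB'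
  have hPs := isSheaf_of_mono hν hν' P.arrow hE
  have hSs := isSheaf_of_mono hν hν' S.arrow hE
  have hF := inF_kernel_ofLE hν hν' hE hSP
  have hcls : sheafClass (coho 0 (P : Heart K ν).obj) - sheafClass (coho 0 (S : Heart K ν).obj) =
      sheafClass ((shSub B ⊓ shSub B' : Subobject _) : (P1 K).Modules) -
      sheafClass (((shSub A ⊓ shSub B') ⊔ (shSub B ⊓ shSub A') : Subobject _) :
        (P1 K).Modules) := by
    rw [hP.sheafClass_eq hν hν', hS.sheafClass_eq hν hν', eP, eS]
  rw [← hcls]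
  constructor
  · rintro ⟨R, R₁, R₂, T, gR, gR₁, gR₂, gT, hTR, Q, hQ, rfl⟩
    obtain rfl := gR.unique gP
    obtain rfl := gR₁.unique gP₁
    obtain rfl := gR₂.unique gP₂
    obtain rfl := gT.unique gS
    exact (hQ.cls_eq hν hν' hSs hPs hF).symm
  · rintro rfl
    obtain ⟨Q, hQ, hQc⟩ := exists_isCokernelOf hν hν' (Subobject.ofLE S P hSP) hSs hPs hF
    exact ⟨P, P₁, P₂, S, gP, gP₁, gP₂, gS, hSP, Q, hQ, hQc⟩

end

end HeartSubobjects

/-! ### Filtrations in the tilted heart versus filtrations by subsheaves -/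

section Flags

open DerivedCategory

lemma apply_last_eq_sum {G : Type*} [AddCommMonoid G] {s : ℕ} {α : Fin s → G}
    {f : Fin (s + 1) → G} (h0 : f 0 = 0) (h : ∀ i, f i.succ = f i.castSucc + α i) :
    f (Fin.last s) = ∑ i, α i := by
  induction s with
  | zero => simpa using h0
  | succ s ih =>
    rw [Fin.sum_univ_castSucc, ← ih (α := fun i => α i.castSucc) (f := fun i => f i.castSucc) h0
      fun i => by rw [← Fin.succ_castSucc]; exact h i.castSucc]
    exact h (Fin.last s)

/-- The values of `f` are partial sums of `α`; this produces a lower bound for the degrees of all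
terms of a flag, depending on its type only. -/
lemma neg_sum_abs_le {s : ℕ} {α : Fin s → ℤ × ℤ} {f : Fin (s + 1) → ℤ × ℤ} (h0 : f 0 = 0)
    (h : ∀ i, f i.succ = f i.castSucc + α i) (i : Fin (s + 1)) : -∑ i, |(α i).2| ≤ (f i).2 := by
  induction s with
  | zero =>
    obtain rfl : i = 0 := Fin.ext (by omega)
    simp [h0]
  | succ s ih =>
    have ih' := ih (α := fun i => α i.castSucc) (f := fun i => f i.castSucc) h0
      fun i => by rw [← Fin.succ_castSucc]; exact h i.castSucc
    rw [Fin.sum_univ_castSucc]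
    refine Fin.lastCases ?_ (fun j => ?_) i
    · have h1 := congr_arg Prod.snd (h (Fin.last s))
      have h2 := ih' (Fin.last s)
      have h3 := neg_abs_le (α (Fin.last s)).2
      rw [Prod.snd_add] at h1
      change (f (Fin.last (s + 1))).2 = _ at h1
      linarith
    · have h2 := ih' j
      have h3 := abs_nonneg (α (Fin.last s)).2
      linarith

variable {K : Type} [Field K]

/-- Filtrations by subsheaves. -/
structure ShFlag {s : ℕ} (α : Fin s → ℤ × ℤ) (A : Fin (s + 1) ⥤ DP1 K) : Prop where
  sheaf : ∀ i, IsSheaf (A.obj i)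
  coh : ∀ i, IsCoherent (coho 0 (A.obj i))
  zero : IsZero (A.obj 0)
  mono : ∀ {i j : Fin (s + 1)} (h : i ⟶ j), Mono (cohoMap (A.map h))
  quot : ∀ i : Fin s, sheafClass (coho 0 (A.obj i.succ)) =
    sheafClass (coho 0 (A.obj i.castSucc)) + α i

lemma sheafClass_coho_of_isZero {E : DP1 K} (h : IsZero E) : sheafClass (coho 0 E) = 0 :=
  sheafClass_of_isZero ((homologyFunctor (P1 K).Modules 0).map_isZero h)

lemma ShFlag.sheafClass_last {s : ℕ} {α : Fin s → ℤ × ℤ} {A : Fin (s + 1) ⥤ DP1 K}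
    (h : ShFlag α A) : sheafClass (coho 0 (A.obj (Fin.last s))) = ∑ i, α i :=
  apply_last_eq_sum (f := fun i => sheafClass (coho 0 (A.obj i)))
    (sheafClass_coho_of_isZero h.zero) h.quot

lemma ShFlag.neg_le {s : ℕ} {α : Fin s → ℤ × ℤ} {A : Fin (s + 1) ⥤ DP1 K} (h : ShFlag α A)
    (i : Fin (s + 1)) : -∑ i, |(α i).2| ≤ (sheafClass (coho 0 (A.obj i))).2 :=
  neg_sum_abs_le (f := fun i => sheafClass (coho 0 (A.obj i)))
    (sheafClass_coho_of_isZero h.zero) h.quot i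

/-- A bound for the degrees of the subsheaves of a sheaf of class `a` whose quotients have slope
at least `-c`. -/
def degBound (a : ℤ × ℤ) (c : ℕ) : ℤ := |a.2| + c * |a.1|

lemma degBound_nonneg (a : ℤ × ℤ) (c : ℕ) : 0 ≤ degBound a c := by
  unfold degBound
  positivity

lemma InT.degLE_degBound {σ : ℝ} {c : ℕ} (hc : nu c ≤ σ) {M : (P1 K).Modules}
    (hM : InT (σ - 1) M) : DegLE (degBound (sheafClass M) c) M := fun G i hi hG =>
  (hM.degLE hc G i hi hG).trans (add_le_add_right
    (mul_le_mul_of_nonneg_left (le_abs_self _) (Int.natCast_nonneg c)) _)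

section

variable {s : ℕ} {α : Fin s → ℤ × ℤ} {A : Fin (s + 1) ⥤ DP1 K} {σ ν : ℝ} {c n : ℕ}
  (hν : 1 / 2 ≤ ν) (hνn : ν ≤ nu n) (hc : nu c ≤ σ)
  (hn : ∑ i, |(α i).2| + degBound (∑ i, α i) c < n)
  (hT : InT (σ - 1) (coho 0 (A.obj (Fin.last s))))
include hν hνn hc hn hT

/-- The kernels on `H⁰` are only known to be in `F` at first. This already determines the classes of
all terms, hence bounds their degrees below, and the bound forces the maps to the last term to be
injective; the other maps factor these. -/
theorem IsFlag.shFlag (hE : IsSheaf (A.obj (Fin.last s))) (h : IsFlag ν α A) : ShFlag α A := by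
  have hν' : ν ≤ 1 := hνn.trans (nu_le_one n)
  have hm : ∀ {i j : Fin (s + 1)} (u : i ⟶ j), Mono (((heart K ν).lift A h.mem).map u) := h.mono
  have hD : ∀ i, InD (ν - 1) (A.obj i) := fun i => (heart_iff_inD hν hν').1 (h.mem i)
  have hs : ∀ i, IsSheaf (A.obj i) := fun i =>
    have := hm (homOfLE (Fin.le_last i))
    isSheaf_of_mono hν hν' (((heart K ν).lift A h.mem).map (homOfLE (Fin.le_last i))) hE
  have hF : ∀ {i j : Fin (s + 1)} (u : i ⟶ j), InF (ν - 1) (kernel (cohoMap (A.map u))) :=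
    fun {i j} u =>
    have := hm u
    inF_kernel_of_mono hν hν' (((heart K ν).lift A h.mem).map u) (hs j)
  have hq : ∀ i : Fin s, sheafClass (coho 0 (A.obj i.succ)) =
      sheafClass (coho 0 (A.obj i.castSucc)) + α i := by
    intro i
    obtain ⟨Q, hQ, hα⟩ := h.quot i
    have h1 : cls Q.obj =
        sheafClass (coho 0 (A.obj i.succ)) - sheafClass (coho 0 (A.obj i.castSucc)) :=
      hQ.cls_eq hν hν' (hs _) (hs _) (hF _)
    rw [← hα, h1]
    abel
  have hlast := apply_last_eq_sum (f := fun i => sheafClass (coho 0 (A.obj i)))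
    (sheafClass_coho_of_isZero h.zero) hq
  have hC := hT.degLE_degBound hc
  rw [hlast] at hC
  have hlm : ∀ i, Mono (cohoMap (A.map (homOfLE (Fin.le_last i)))) := fun i =>
    hC.mono_of_inF_kernel (by linarith) hn (hD i).inT.coh hT.coh _ (hF _)
      (neg_sum_abs_le (f := fun i => sheafClass (coho 0 (A.obj i)))
        (sheafClass_coho_of_isZero h.zero) hq i)
  refine ⟨hs, fun i => (hD i).inT.coh, h.zero, fun {i j} u => ?_, hq⟩
  have := hlm i
  have e : cohoMap (A.map u) ≫ cohoMap (A.map (homOfLE (Fin.le_last j))) =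
      cohoMap (A.map (homOfLE (Fin.le_last i))) := by
    rw [← cohoMap_comp, ← A.map_comp]
    rfl
  exact mono_of_mono_fac e

/-- The degrees of the terms are at least `-∑ |deg α i|`, which puts each of them in `T` and so in
the heart. -/
theorem ShFlag.isFlag (h : ShFlag α A) : IsFlag ν α A := by
  have hν' : ν ≤ 1 := hνn.trans (nu_le_one n)
  have hC := hT.degLE_degBound hc
  rw [h.sheafClass_last] at hC
  have hmem : ∀ i, heart K ν (A.obj i) := fun i => by
    have := h.mono (homOfLE (Fin.le_last i))
    exact (heart_iff_inD hν hν').2 ((h.sheaf i).inD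
      (hC.inT (by linarith) hn (h.coh i) (cohoMap (A.map (homOfLE (Fin.le_last i)))) (h.neg_le i)))
  have hm : ∀ {i j : Fin (s + 1)} (u : i ⟶ j), Mono (((heart K ν).lift A hmem).map u) :=
    fun {i j} u => mono_of_mono_cohoMap hν hν' (((heart K ν).lift A hmem).map u) (h.sheaf i)
      (h.sheaf j) (h.mono u)
  refine ⟨hmem, h.zero, hm, fun i => ?_⟩
  have := hm (homOfLE i.castSucc_lt_succ.le)
  obtain ⟨Q, hQ, hQc⟩ := exists_isCokernelOf hν hν'
    (((heart K ν).lift A hmem).map (homOfLE i.castSucc_lt_succ.le)) (h.sheaf _) (h.sheaf _)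
    (inF_kernel_of_mono hν hν' _ (h.sheaf _))
  refine ⟨Q, hQ, hQc.trans ?_⟩
  change sheafClass (coho 0 (A.obj i.succ)) - sheafClass (coho 0 (A.obj i.castSucc)) = α i
  rw [h.quot i]
  abel

end

end Flags

/-! ### Comparison of Steinberg points, cells and types -/

section RelativePosition

open DerivedCategory

variable {K : Type} [Field K]

/-- One `C` bounds the degree of `X ⊔ Y` above, so that `X ⊓ Y` has degree at least `-(B + B' + C)`;
the other bounds the kernels of quotients of `X ⊓ Y`. -/
lemma DegLE.inT_inf {C B B' : ℤ} {n : ℕ} {μ : ℝ} (hμ : μ ≤ nu n - 1) (hn : B + B' + 2 * C < n)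
    {M : (P1 K).Modules} (hM : DegLE C M) (hMc : IsCoherent M) {X Y : Subobject M}
    (hX : IsCoherent (X : (P1 K).Modules)) (hY : IsCoherent (Y : (P1 K).Modules))
    (hXB : -B ≤ (sheafClass (X : (P1 K).Modules)).2)
    (hYB : -B' ≤ (sheafClass (Y : (P1 K).Modules)).2) :
    InT μ ((X ⊓ Y : Subobject M) : (P1 K).Modules) := by
  have h1 := congr_arg Prod.snd (sheafClass_inf_add_sup X Y hMc hX hY)
  have h2 := hM _ (X ⊔ Y).arrow inferInstance (isCoherent_sup X Y hMc hX hY)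
  rw [Prod.snd_add, Prod.snd_add] at h1
  exact hM.inT (B := B + B' + C) hμ (by linarith) (isCoherent_inf X Y hMc hX hY) (X ⊓ Y).arrow
    (by linarith)

variable {s l : ℕ}

/-- The terms of the first filtration, as subsheaves. -/
def sheafFst (z : FlagPair (DP1 K) s l) (i : Fin (s + 1)) :
    Subobject (coho 0 (z.fst.obj (Fin.last s))) :=
  imSub (cohoMap (z.fst.map (homOfLE (Fin.le_last i))))

/-- The identification of the ends of the two filtrations. -/
def endIso (z : FlagPair (DP1 K) s l) : z.fst.obj (Fin.last s) ≅ z.snd.obj (Fin.last l) := z.iso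

/-- The terms of the second filtration, as subsheaves. -/
def sheafSnd (z : FlagPair (DP1 K) s l) (j : Fin (l + 1)) :
    Subobject (coho 0 (z.fst.obj (Fin.last s))) :=
  imSub (cohoMap (z.snd.map (homOfLE (Fin.le_last j)) ≫ (endIso z).inv))

/-- The relative position of two filtrations by subsheaves. -/
def ShType (z : FlagPair (DP1 K) s l) (w : Matrix (Fin s) (Fin l) (ℤ × ℤ)) : Prop :=
  ∀ i j, sheafClass ((sheafFst z i.succ ⊓ sheafSnd z j.succ : Subobject _) : (P1 K).Modules) -
    sheafClass (((sheafFst z i.castSucc ⊓ sheafSnd z j.succ) ⊔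
      (sheafFst z i.succ ⊓ sheafSnd z j.castSucc) : Subobject _) : (P1 K).Modules) = w i j

/-- A bound which is sufficiently large for the given types of filtrations. -/
def typeBound (c : ℕ) (α : Fin s → ℤ × ℤ) (α' : Fin l → ℤ × ℤ) : ℤ :=
  ∑ i, |(α i).2| + ∑ j, |(α' j).2| + 2 * degBound (∑ i, α i) c

section

variable {α : Fin s → ℤ × ℤ} {α' : Fin l → ℤ × ℤ} {σ ν : ℝ} {c n : ℕ}
  (hσ : 1 / 2 < σ) (hσ' : σ ≤ 1) (hν : 1 / 2 ≤ ν) (hνn : ν ≤ nu n) (hc : nu c ≤ σ)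
  (hsum : ∑ i, α i = ∑ j, α' j) (hn : typeBound c α α' < n) {z : FlagPair (DP1 K) s l}
include hσ hσ' hν hνn hc hsum hn

/-- The right-hand side does not mention `ν`; this is what makes the stacks coincide. -/
theorem isSteinbergPoint_iff :
    IsSteinbergPoint ν (Set.Ioc (σ - 1) (1 / 2)) α α' z ↔
      ShFlag α z.fst ∧ ShFlag α' z.snd ∧
        cohI K (Set.Ioc (σ - 1) (1 / 2)) (z.fst.obj (Fin.last s)) := by
  have hB : 0 ≤ ∑ i, |(α i).2| := Finset.sum_nonneg fun _ _ => abs_nonneg _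
  have hB' : 0 ≤ ∑ j, |(α' j).2| := Finset.sum_nonneg fun _ _ => abs_nonneg _
  have hC := degBound_nonneg (∑ i, α i) c
  have hn₁ : ∑ i, |(α i).2| + degBound (∑ i, α i) c < n := by
    unfold typeBound at hn; linarith
  have hn₂ : ∑ j, |(α' j).2| + degBound (∑ j, α' j) c < n := by
    rw [← hsum]; unfold typeBound at hn; linarith
  have key : cohI K (Set.Ioc (σ - 1) (1 / 2)) (z.fst.obj (Fin.last s)) →
      (IsFlag ν α z.fst ↔ ShFlag α z.fst) ∧ (IsFlag ν α' z.snd ↔ ShFlag α' z.snd) := by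
    intro hI
    obtain ⟨hE, hT⟩ := cohI_isSheaf hσ hσ' hI
    have hE' := hE.of_iso (endIso z)
    have hT' := hT.of_iso ((homologyFunctor (P1 K).Modules 0).mapIso (endIso z))
    exact ⟨⟨fun h => h.shFlag hν hνn hc hn₁ hT hE, fun h => h.isFlag hν hνn hc hn₁ hT⟩,
      ⟨fun h => h.shFlag hν hνn hc hn₂ hT' hE', fun h => h.isFlag hν hνn hc hn₂ hT'⟩⟩
  constructor
  · rintro ⟨h₁, h₂, hI⟩
    exact ⟨(key hI).1.1 h₁, (key hI).2.1 h₂, hI⟩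
  · rintro ⟨h₁, h₂, hI⟩
    exact ⟨(key hI).1.2 h₁, (key hI).2.2 h₂, hI⟩

theorem hasType_iff (h : IsSteinbergPoint ν (Set.Ioc (σ - 1) (1 / 2)) α α' z)
    (w : Matrix (Fin s) (Fin l) (ℤ × ℤ)) : h.HasType w ↔ ShType z w := by
  have hν' : ν ≤ 1 := hνn.trans (nu_le_one n)
  obtain ⟨hf, hf', hI⟩ := (isSteinbergPoint_iff hσ hσ' hν hνn hc hsum hn).1 h
  obtain ⟨hE, hT⟩ := cohI_isSheaf hσ hσ' hI
  have hC := hT.degLE_degBound hc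
  rw [hf.sheafClass_last] at hC
  have e₁ : ∀ i, shSub (h.subFst i) = sheafFst z i ∧ Good (h.subFst i) := by
    intro i
    have := h.fst.mono (homOfLE (Fin.le_last i))
    exact ⟨shSub_mk _, good_mk _ (hf.mono (homOfLE (Fin.le_last i)))⟩
  have e₂ : ∀ j, shSub (h.subSnd j) = sheafSnd z j ∧ Good (h.subSnd j) := by
    intro j
    have := h.snd.mono (homOfLE (Fin.le_last j))
    let e : ((heart K ν).lift z.snd h.snd.mem).obj (Fin.last l) ≅
      ((heart K ν).lift z.fst h.fst.mem).obj (Fin.last s) := (heart K ν).isoMk z.iso.symm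
    have he : h.subSnd j = Subobject.mk
        (((heart K ν).lift z.snd h.snd.mem).map (homOfLE (Fin.le_last j)) ≫ e.hom) :=
      Subobject.map_mk _ e.hom
    rw [he]
    refine ⟨shSub_mk _, good_mk _ ?_⟩
    have := hf'.mono (homOfLE (Fin.le_last j))
    change Mono (cohoMap (z.snd.map (homOfLE (Fin.le_last j)) ≫ (endIso z).inv))
    rw [cohoMap_comp]
    exact mono_comp _ _
  have hle₁ : ∀ i : Fin s, h.subFst i.castSucc ≤ h.subFst i.succ := by
    intro i
    refine (e₁ i.succ).2.le_of_shSub_le hν hν' hE ?_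
    rw [(e₁ _).1, (e₁ _).1]
    have : cohoMap (z.fst.map (homOfLE (Fin.le_last i.castSucc))) =
        cohoMap (z.fst.map (homOfLE i.castSucc_lt_succ.le)) ≫
          cohoMap (z.fst.map (homOfLE (Fin.le_last i.succ))) := by
      rw [← cohoMap_comp, ← z.fst.map_comp]
      rfl
    rw [sheafFst, this]
    exact imSub_comp_le _ _
  have hle₂ : ∀ j : Fin l, h.subSnd j.castSucc ≤ h.subSnd j.succ := by
    intro j
    refine (e₂ j.succ).2.le_of_shSub_le hν hν' hE ?_
    rw [(e₂ _).1, (e₂ _).1]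
    have : cohoMap (z.snd.map (homOfLE (Fin.le_last j.castSucc)) ≫ (endIso z).inv) =
        cohoMap (z.snd.map (homOfLE j.castSucc_lt_succ.le)) ≫
          cohoMap (z.snd.map (homOfLE (Fin.le_last j.succ)) ≫ (endIso z).inv) := by
      rw [← cohoMap_comp, ← Category.assoc, ← z.snd.map_comp]
      rfl
    rw [sheafSnd, this]
    exact imSub_comp_le _ _
  have hX : ∀ i, IsCoherent (sheafFst z i : (P1 K).Modules) ∧
      -∑ i, |(α i).2| ≤ (sheafClass (sheafFst z i : (P1 K).Modules)).2 := by
    intro i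
    have := hf.mono (homOfLE (Fin.le_last i))
    let e := Subobject.isoOfMkEq _ _ (imSub_of_mono
      (cohoMap (z.fst.map (homOfLE (Fin.le_last i))))).symm
    exact ⟨isCoherent_of_iso e (hf.coh i), (sheafClass_iso e (hf.coh i)) ▸ hf.neg_le i⟩
  have hX' : ∀ j, IsCoherent (sheafSnd z j : (P1 K).Modules) ∧
      -∑ j, |(α' j).2| ≤ (sheafClass (sheafSnd z j : (P1 K).Modules)).2 := by
    intro j
    have := hf'.mono (homOfLE (Fin.le_last j))
    have : Mono (cohoMap (z.snd.map (homOfLE (Fin.le_last j)) ≫ (endIso z).inv)) := by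
      rw [cohoMap_comp]
      exact mono_comp _ _
    let e := Subobject.isoOfMkEq _ _ (imSub_of_mono
      (cohoMap (z.snd.map (homOfLE (Fin.le_last j)) ≫ (endIso z).inv))).symm
    exact ⟨isCoherent_of_iso e (hf'.coh j), (sheafClass_iso e (hf'.coh j)) ▸ hf'.neg_le j⟩
  -- All pairwise intersections lie in `T`; the third term of `typeBound` contains the factor `2`
  -- for this purpose.
  have hinf : ∀ i j, InT (ν - 1)
      ((shSub (h.subFst i) ⊓ shSub (h.subSnd j) : Subobject _) : (P1 K).Modules) := by
    intro i j
    rw [(e₁ i).1, (e₂ j).1]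
    exact hC.inT_inf (by linarith) hn hT.coh (hX i).1 (hX' j).1 (hX i).2 (hX' j).2
  refine forall_congr' fun i => forall_congr' fun j => ?_
  refine (exists_subquotient_iff hν hν' hE (e₁ i.castSucc).2 (e₁ i.succ).2 (e₂ j.castSucc).2
    (e₂ j.succ).2 (hle₁ i) (hle₂ j) (hinf _ _) (hinf _ _) (hinf _ _) (hinf _ _) (w i j)).trans ?_
  rw [(e₁ _).1, (e₁ _).1, (e₂ _).1, (e₂ _).1]

end

section

variable {α : Fin s → ℤ × ℤ} {α' : Fin l → ℤ × ℤ} {σ ν ν' : ℝ} {c n : ℕ}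
  (hσ : 1 / 2 < σ) (hσ' : σ ≤ 1) (hc : nu c ≤ σ) (hsum : ∑ i, α i = ∑ j, α' j)
  (hn : typeBound c α α' < n) (hν : 1 / 2 ≤ ν) (hνn : ν ≤ nu n) (hν' : 1 / 2 ≤ ν')
  (hνn' : ν' ≤ nu n)
include hσ hσ' hc hsum hn hν hνn hν' hνn'

theorem steinberg_eq (R : Type) [CommRing R] :
    steinberg ν (Set.Ioc (σ - 1) (1 / 2)) α α' R =
      steinberg ν' (Set.Ioc (σ - 1) (1 / 2)) α α' R := by
  ext z
  exact forall_congr' fun K => forall_congr' fun _ => forall_congr' fun f =>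
    (isSteinbergPoint_iff hσ hσ' hν hνn hc hsum hn).trans
      (isSteinbergPoint_iff hσ hσ' hν' hνn' hc hsum hn).symm

theorem cell_eq (w : Matrix (Fin s) (Fin l) (ℤ × ℤ)) (R : Type) [CommRing R] :
    cell ν (Set.Ioc (σ - 1) (1 / 2)) α α' w R = cell ν' (Set.Ioc (σ - 1) (1 / 2)) α α' w R := by
  ext z
  refine forall_congr' fun K => forall_congr' fun _ => forall_congr' fun f => ?_
  have h1 := isSteinbergPoint_iff hσ hσ' hν hνn hc hsum hn (z := z.fibre f)
  have h2 := isSteinbergPoint_iff hσ hσ' hν' hνn' hc hsum hn (z := z.fibre f)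
  constructor
  · rintro ⟨h, hw⟩
    exact ⟨h2.2 (h1.1 h), (hasType_iff hσ hσ' hν' hνn' hc hsum hn _ w).2
      ((hasType_iff hσ hσ' hν hνn hc hsum hn h w).1 hw)⟩
  · rintro ⟨h, hw⟩
    exact ⟨h1.2 (h2.1 h), (hasType_iff hσ hσ' hν hνn hc hsum hn _ w).2
      ((hasType_iff hσ hσ' hν' hνn' hc hsum hn h w).1 hw)⟩

/-- The monoids of classes for `ν` and `ν'` differ, but a point of the cell realizes each entry as
the class of a subquotient in `Coh^ν'`, so the entries lie in the new monoid. -/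
theorem WI_subset : WI ν (Set.Ioc (σ - 1) (1 / 2)) α α' ⊆ WI ν' (Set.Ioc (σ - 1) (1 / 2)) α α' := by
  rintro w ⟨⟨-, hrow, hcol⟩, z, hz⟩
  rw [cell_eq hσ hσ' hc hsum hn hν hνn hν' hνn' w ℂ] at hz
  refine ⟨⟨fun i j => ?_, hrow, hcol⟩, z, hz⟩
  obtain ⟨h, hw⟩ := hz ℂ (RingHom.id ℂ)
  obtain ⟨_, _, _, _, -, -, -, -, -, Q, -, hQ⟩ := hw i j
  exact ⟨Q.obj, Q.property, hQ⟩

end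

end RelativePosition

end SteinbergP1

end

theorem mainTheorem9 {s l : ℕ} (σ : ℝ) (hσ : σ ∈ Set.Ioc (1 / 2 : ℝ) 1)
    (a : ℤ × ℤ) (ha : a ∈ K0plus (1 / 2))
    (α : Fin s → ℤ × ℤ) (hα : ∀ i, α i ∈ K0plus (1 / 2)) (hαsum : ∑ i, α i = a)
    (α' : Fin l → ℤ × ℤ) (hα' : ∀ j, α' j ∈ K0plus (1 / 2)) (hα'sum : ∑ j, α' j = a) :
    (∃ n₀ : ℕ, ∀ n ≥ n₀, ∀ (R : Type) [CommRing R] [Algebra ℂ R],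
      steinberg (1 / 2) (Set.Ioc (σ - 1) (1 / 2)) α α' R =
        steinberg (nu n) (Set.Ioc (σ - 1) (1 / 2)) α α' R ∧
      ∀ w : Matrix (Fin s) (Fin l) (ℤ × ℤ),
        cell (1 / 2) (Set.Ioc (σ - 1) (1 / 2)) α α' w R =
          cell (nu n) (Set.Ioc (σ - 1) (1 / 2)) α α' w R) ∧
    ∃ ν₀ ∈ Set.Ioc (1 / 2) σ, ∀ ν : ℝ, 1 / 2 < ν → ν ≤ ν₀ →
      WI (1 / 2) (Set.Ioc (σ - 1) (1 / 2)) α α' = WI ν (Set.Ioc (σ - 1) (1 / 2)) α α' := by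
  obtain ⟨hσ₀, hσ₁⟩ := hσ
  obtain ⟨c, hc⟩ := exists_nu_le hσ₀
  have hsum : ∑ i, α i = ∑ j, α' j := hαsum.trans hα'sum.symm
  -- The bound must be strict, hence the `+ 1`. As `nu` is antitone, this single integer serves for
  -- all larger `n`.
  have hn : typeBound c α α' < ((typeBound c α α').toNat + 1 : ℕ) := by omega
  generalize (typeBound c α α').toNat + 1 = n₀ at hn
  have hhalf := (half_lt_nu n₀).le
  -- The comparison is valid for every real `ν` between `1/2` and `nu n₀`, not only for the values
  -- `nu n`; the minimum with `σ` only ensures `ν₀ ≤ σ`.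
  refine ⟨⟨n₀, fun n hnn R _ _ => ⟨?_, fun w => ?_⟩⟩, min σ (nu n₀),
    ⟨lt_min hσ₀ (half_lt_nu n₀), min_le_left _ _⟩, fun ν h1 h2 => ?_⟩
  · exact steinberg_eq hσ₀ hσ₁ hc hsum hn le_rfl hhalf (half_lt_nu n).le (nu_antitone hnn) R
  · exact cell_eq hσ₀ hσ₁ hc hsum hn le_rfl hhalf (half_lt_nu n).le (nu_antitone hnn) w R
  · have h3 := h2.trans (min_le_right _ _)
    exact (WI_subset hσ₀ hσ₁ hc hsum hn le_rfl hhalf h1.le h3).antisymm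
      (WI_subset hσ₀ hσ₁ hc hsum hn h1.le h3 le_rfl hhalf)
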